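/- **Graphs.** A finite undirected graph $G$ (with loose ends) is a diagram of finite sets $A\hookleftarrow D\xrightarrow{t}V$ with a fixpoint-free involution $\dagger$ on the set $A$ of arcs; a finite directed graph is a diagram of finite sets $E\hookleftarrow I\to V\leftarrow O\hookrightarrow E$, and it has an associated undirected graph with $A=E\amalg E$ (swap involution) and $D=I\amalg O$. A graph is a tree if its geometric realization is connected and simply connected. For a subtree $S$ of an undirected tree put $\eth(S)=A_S\setminus D_S$; for a subtree $S$ of a directed tree put $\mathrm{in}(S)=E_S\setminus O_S$ and $\mathrm{out}(S)=E_S\setminus I_S$. Let $\mathrm{Emb}(G)$ be the set of subtrees of $G$. **The categories $\Gamma_0$ and $\mathbf O_0$.** The objects of $\Gamma_0$ are undirected trees; a map $G\to G'$ is a pair $(\varphi_0,\hat\varphi)$ of an involutive function $\varphi_0\colon A_G\to A_{G'}$ and a function $\hat\varphi\colon \mathrm{Emb}(G)\to\mathrm{Emb}(G')$ such that $\varphi_0$ restricts to bijections $\eth(S)\to\eth(\hat\varphi(S))$ for all $S$, and such that if $S,T$ overlap (share an edge or a vertex) then so do $\hat\varphi(S),\hat\varphi(T)$, and $\hat\varphi(S\cup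 T)=\hat\varphi(S)\cup\hat\varphi(T)$. The objects of $\mathbf O_0$ are directed trees; maps are defined in the same way, with a function $\varphi_0\colon E_G\to E_{G'}$ that restricts to bijections $\mathrm{in}(S)\to\mathrm{in}(\hat\varphi(S))$ and $\mathrm{out}(S)\to\mathrm{out}(\hat\varphi(S))$. **Segal presheaves.** Let $\mathbf C$ be $\Gamma_0$ or $\mathbf O_0$. A map is inert if $\hat\varphi$ sends the star of each vertex to the star of a vertex, and a tree is elementary if it has no internal edges (that is, it is an edge or a star). A presheaf $X\colon\mathbf C^{\mathrm{op}}\to\mathbf{Set}$ is Segal if for all $G$ the map $X_G\to\lim_{K\rightarrowtail G}X_K$ is a bijection, where the limit is over the opposite of the category of inert maps to $G$ from elementary trees $K$, with inert maps over $G$ as morphisms. $\mathrm{Seg}(\mathbf C)$ is the full subcategory of Segal presheaves. **Nerves.** Let $\mathbf{Cyc}^+$ be the category of augmented cyclic operads (symmetric, unital, colored by arbitrary involutive sets, with operation sets $P(c_1,\dots,c_n)$ for $n\ge0$ and compositions along a pair of ports with colors $c$, $c^\dagger$), and $\mathbf{DiOp}$ the category of (symmetric, unital, colored) dioperads, with operation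 sets $P(c_1,\dots,c_n;d_1,\dots,d_m)$ for $n,m\geq0$; maps may change colors. An undirected tree $G$ generates the free augmented cyclic operad $\mathsf C(G)$, with color set $A_G$, whose operations are the subtrees of $G$ with a total ordering of the boundary, composed by union; a directed tree $G$ generates the free dioperad $\mathsf D(G)$, with color set $E_G$, whose operations are the subtrees of $G$ with total orderings of the inputs and of the outputs. The nerve functors are $$N\colon\mathbf{Cyc}^+\to\mathrm{Fun}(\Gamma_0^{\mathrm{op}},\mathbf{Set}),\ NP=\mathbf{Cyc}^+(\mathsf C(-),P),\qquad N\colon\mathbf{DiOp}\to\mathrm{Fun}(\mathbf O_0^{\mathrm{op}},\mathbf{Set}),\ NP=\mathbf{DiOp}(\mathsf D(-),P).$$ **Proposition.** The nerve theorem for augmented cyclic operads implies the nerve theorem for dioperads. That is, if the nerve functor of augmented cyclic operads takes values in Segal presheaves and the resulting functor $N\colon\mathbf{Cyc}^+\to\mathrm{Seg}(\Gamma_0)$ is an equivalence of categories, then the nerve functor of dioperads takes values in Segal presheaves and the resulting functor $N\colon\mathbf{DiOp}\to\mathrm{Seg}(\mathbf O_0)$ is an equivalence of categories. -/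

import Mathlib

open CategoryTheory

universe u

/-- `e` is an enumeration without repetition of the set `s` by `Fin k`. -/
def Enumerates {k : ℕ} {α : Type*} (e : Fin k → α) (s : Set α) : Prop :=
  Function.Injective e ∧ Set.range e = s

theorem enumerates_sum {n m k : ℕ} {α : Type*} {f : Fin n → α} {g : Fin m → α}
    {s t s' t' r : Set α} {b : Set (Fin n ⊕ Fin m)} {e : Fin k → Fin n ⊕ Fin m}
    (hf : Enumerates f s) (hg : Enumerates g t) (he : Enumerates e bᶜ)
    (hs : ∀ a, f a ∈ s' ↔ Sum.inl a ∉ b) (ht : ∀ a, g a ∈ t' ↔ Sum.inr a ∉ b)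
    (hd : ∀ x, x ∈ s → x ∈ s' → x ∈ t → x ∈ t' → False)
    (hr : ∀ x, x ∈ r ↔ (x ∈ s ∧ x ∈ s') ∨ (x ∈ t ∧ x ∈ t')) :
    Enumerates (Sum.elim f g ∘ e) r := by
  have hne : ∀ w, e w ∉ b := fun w => by
    have : e w ∈ bᶜ := he.2 ▸ Set.mem_range_self w
    exact this
  have hex : ∀ y, y ∉ b → ∃ w, e w = y := fun y hy => by
    have : y ∈ Set.range e := he.2 ▸ hy
    exact this
  have hl : ∀ w a, e w = Sum.inl a → f a ∈ s ∧ f a ∈ s' := fun w a h =>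
    ⟨hf.2 ▸ Set.mem_range_self a, (hs a).2 (h ▸ hne w)⟩
  have hr' : ∀ w a, e w = Sum.inr a → g a ∈ t ∧ g a ∈ t' := fun w a h =>
    ⟨hg.2 ▸ Set.mem_range_self a, (ht a).2 (h ▸ hne w)⟩
  constructor
  · intro w w' h
    apply he.1
    rcases h1 : e w with a | a <;> rcases h2 : e w' with b | b <;>
      simp only [Function.comp_apply, h1, h2, Sum.elim_inl, Sum.elim_inr] at h
    · rw [hf.1 h]
    · have h3 := hl w a h1
      have h4 := hr' w' b h2
      rw [← h] at h4
      exact (hd _ h3.1 h3.2 h4.1 h4.2).elim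
    · have h3 := hr' w a h1
      have h4 := hl w' b h2
      rw [← h] at h4
      exact (hd _ h4.1 h4.2 h3.1 h3.2).elim
    · rw [hg.1 h]
  · ext x
    rw [hr]
    constructor
    · rintro ⟨w, rfl⟩
      rcases h1 : e w with a | a
      · left; simpa [h1] using hl w a h1
      · right; simpa [h1] using hr' w a h1
    · rintro (⟨hx, hx'⟩ | ⟨hx, hx'⟩)
      · obtain ⟨a, rfl⟩ := hf.2.symm ▸ hx
        obtain ⟨w, hw⟩ := hex _ ((hs a).1 hx')
        exact ⟨w, by simp [hw]⟩
      · obtain ⟨a, rfl⟩ := hg.2.symm ▸ hx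
        obtain ⟨w, hw⟩ := hex _ ((ht a).1 hx')
        exact ⟨w, by simp [hw]⟩

/-! ### Undirected graphs with loose ends -/

/-- A finite undirected graph `A ⟲ ← D → V`. The span `A ↩ D → V` (left leg injective) is encoded
as the partial function `t : A ⇀ V` with domain `D`. -/
structure UGraph where
  Arc : Type u
  Vert : Type u
  [finite_arc : Finite Arc]
  [finite_vert : Finite Vert]
  /-- The involution `†` on arcs. -/
  inv : Arc → Arc
  inv_inv : ∀ a, inv (inv a) = a
  inv_ne : ∀ a, inv a ≠ a
  /-- `t a = some v` means that `a ∈ D` and `t a = v`. -/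
  t : Arc → Option Vert

namespace UGraph

/-- The subset `D ⊆ A` of arcs which point to a vertex. -/
def D (G : UGraph.{u}) : Set G.Arc := {a | (G.t a).isSome}

/-- A combinatorial model of the geometric realization: one node for each arc and for each vertex,
an edge between `a` and `a†` for each arc `a`, and an edge between `d` and `t d` for each
`d ∈ D`. (Every edge of the realization is subdivided by its two arcs, so loops and multiple edges
are not lost.) -/
def realization (G : UGraph.{u}) : SimpleGraph (G.Arc ⊕ G.Vert) where
  Adj x y :=
    match x, y with
    | Sum.inl a, Sum.inl b => b = G.inv a
    | Sum.inl a, Sum.inr v => G.t a = some v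
    | Sum.inr v, Sum.inl a => G.t a = some v
    | Sum.inr _, Sum.inr _ => False
  symm := ⟨by
    rintro (a | v) (b | w) h
    · change a = G.inv b
      rw [show b = G.inv a from h, G.inv_inv]
    · exact h
    · exact h
    · exact h⟩
  loopless := ⟨by
    rintro (a | v) h
    · exact G.inv_ne a (Eq.symm h)
    · exact h⟩

/-- A tree is a (nonempty) connected and simply connected graph. -/
def IsTree (G : UGraph.{u}) : Prop := G.realization.IsTree

/-- A nonempty connected subgraph: an involutive set of arcs (that is, a set of edges) and a set of
vertices, such that all arcs pointing to one of the vertices are included. If `G` is a tree these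
are the subtrees of `G`, and they form the set `Emb(G)` of embeddings into `G` modulo isomorphism
in the domain. -/
@[ext] structure Subtree (G : UGraph.{u}) where
  arcs : Set G.Arc
  verts : Set G.Vert
  inv_mem : ∀ {a}, a ∈ arcs → G.inv a ∈ arcs
  nbhd_mem : ∀ {a v}, v ∈ verts → G.t a = some v → a ∈ arcs
  connected : (G.realization.induce {x | Sum.elim (· ∈ arcs) (· ∈ verts) x}).Connected

namespace Subtree

variable {G : UGraph.{u}}

/-- All arcs and vertices of a subtree, as a set of nodes of the realization. -/
def nodes (S : Subtree G) : Set (G.Arc ⊕ G.Vert) := {x | Sum.elim (· ∈ S.arcs) (· ∈ S.verts) x}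

/-- The boundary `ð(S) = A_S \ D_S` of a subtree, as a subset of the arcs of `G`; here `D_S` is the
set of arcs which point to a vertex of `S`. -/
def boundary (S : Subtree G) : Set G.Arc := {a | a ∈ S.arcs ∧ ∀ v ∈ S.verts, G.t a ≠ some v}

/-- Two subtrees overlap if they have an edge or a vertex in common. -/
def Overlap (S T : Subtree G) : Prop := (S.arcs ∩ T.arcs).Nonempty ∨ (S.verts ∩ T.verts).Nonempty

/-- The union of two overlapping subtrees. -/
def union (S T : Subtree G) (h : S.Overlap T) : Subtree G where
  arcs := S.arcs ∪ T.arcs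
  verts := S.verts ∪ T.verts
  inv_mem := by
    rintro a (ha | ha)
    · exact Or.inl (S.inv_mem ha)
    · exact Or.inr (T.inv_mem ha)
  nbhd_mem := by
    rintro a v (hv | hv) h
    · exact Or.inl (S.nbhd_mem hv h)
    · exact Or.inr (T.nbhd_mem hv h)
  connected := by
    have h1 := SimpleGraph.induce_union_connected (s := S.nodes) (t := T.nodes)
      S.connected.preconnected T.connected.preconnected (by
        rcases h with ⟨a, h⟩ | ⟨v, h⟩
        · exact ⟨Sum.inl a, h⟩
        · exact ⟨Sum.inr v, h⟩)
    have h2 : {x | Sum.elim (· ∈ S.arcs ∪ T.arcs) (· ∈ S.verts ∪ T.verts) x} =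
        S.nodes ∪ T.nodes := by
      ext (x | x) <;> simp [nodes]
    rw [h2]
    exact h1

theorem overlap_map {S T : Subtree G} {a : G.Arc} (hS : a ∈ S.boundary)
    (hT : G.inv a ∈ T.boundary) : S.Overlap T :=
  Or.inl ⟨a, hS.1, by simpa [G.inv_inv] using T.inv_mem hT.1⟩

theorem exists_path (S : Subtree G) {x y : G.Arc ⊕ G.Vert} (hx : x ∈ S.nodes) (hy : y ∈ S.nodes) :
    ∃ p : G.realization.Walk x y, p.IsPath ∧ ∀ z ∈ p.support, z ∈ S.nodes := by
  classical
  obtain ⟨w⟩ := S.connected.preconnected ⟨x, hx⟩ ⟨y, hy⟩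
  refine ⟨(w.map (SimpleGraph.Embedding.induce _).toHom).bypass, SimpleGraph.Walk.bypass_isPath _,
    fun z hz => ?_⟩
  have h1 := SimpleGraph.Walk.support_bypass_subset_support _ hz
  erw [SimpleGraph.Walk.support_map, List.mem_map] at h1
  obtain ⟨z', -, rfl⟩ := h1
  exact z'.2

/-- Inside `S`, a boundary arc is only adjacent to its opposite. -/
theorem eq_of_adj {S : Subtree G} {a : G.Arc} (hS : a ∈ S.boundary) {y : G.Arc ⊕ G.Vert}
    (hy : y ∈ S.nodes) (h : G.realization.Adj (Sum.inl a) y) : y = Sum.inl (G.inv a) := by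
  rcases y with b | v
  · exact congrArg Sum.inl h
  · exact absurd h (hS.2 v hy)

/-- If the tree `S` leaves through `a` and `T` leaves through `a†`, then they share only the
edge `{a, a†}`. -/
theorem eq_or_eq_of_mem (hG : G.IsTree) {S T : Subtree G} {a : G.Arc} (hS : a ∈ S.boundary)
    (hT : G.inv a ∈ T.boundary) {x : G.Arc ⊕ G.Vert} (hxS : x ∈ S.nodes) (hxT : x ∈ T.nodes) :
    x = Sum.inl a ∨ x = Sum.inl (G.inv a) := by
  by_contra! hx
  obtain ⟨p, hp, hpS⟩ := S.exists_path (x := Sum.inl a) hS.1 hxS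
  obtain ⟨q, hq, hqT⟩ := T.exists_path (x := Sum.inl (G.inv a)) hT.1 hxT
  cases p with
  | nil => exact hx.1 rfl
  | @cons _ y _ h p' =>
    have hy := eq_of_adj hS (hpS y (by simp)) h
    subst hy
    cases q with
    | nil => exact hx.2 rfl
    | @cons _ z _ h' q' =>
      have hz := eq_of_adj hT (hqT z (by simp)) h'
      rw [G.inv_inv] at hz
      subst hz
      have key := congrArg Subtype.val ((hG.isAcyclic.subsingleton_path _ _).elim ⟨_, hp⟩ ⟨q', hq.of_cons⟩)
      rw [SimpleGraph.Walk.cons_isPath_iff] at hq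
      apply hq.2
      rw [← show SimpleGraph.Walk.cons h p' = q' from key]
      simp

theorem boundary_disjoint (hG : G.IsTree) {S T : Subtree G} {a : G.Arc} (hS : a ∈ S.boundary)
    (hT : G.inv a ∈ T.boundary) {x : G.Arc} (hxS : x ∈ S.boundary) (hxa : x ≠ a)
    (hxT : x ∈ T.boundary) (hxa' : x ≠ G.inv a) : False := by
  rcases eq_or_eq_of_mem hG hS hT (x := Sum.inl x) hxS.1 hxT.1 with h | h
  · exact hxa (Sum.inl_injective h)
  · exact hxa' (Sum.inl_injective h)

/-- The boundary of the union of two subtrees glued along `a`. -/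
theorem mem_boundary_union (hG : G.IsTree) {S T : Subtree G} {a : G.Arc} (hS : a ∈ S.boundary)
    (hT : G.inv a ∈ T.boundary) (h : S.Overlap T) (x : G.Arc) :
    x ∈ (S.union T h).boundary ↔
      (x ∈ S.boundary ∧ x ≠ a) ∨ (x ∈ T.boundary ∧ x ≠ G.inv a) := by
  constructor
  · rintro ⟨hx, hv⟩
    have h1 : ∀ v ∈ S.verts, G.t x ≠ some v := fun v h => hv v (Or.inl h)
    have h2 : ∀ v ∈ T.verts, G.t x ≠ some v := fun v h => hv v (Or.inr h)
    by_cases hxa : x = a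
    · refine Or.inr ⟨⟨?_, h2⟩, ?_⟩
      · rw [hxa]; simpa [G.inv_inv] using T.inv_mem hT.1
      · rw [hxa]; exact (G.inv_ne a).symm
    by_cases hxa' : x = G.inv a
    · refine Or.inl ⟨⟨?_, h1⟩, hxa⟩
      rw [hxa']; exact S.inv_mem hS.1
    · rcases hx with hx | hx
      · exact Or.inl ⟨⟨hx, h1⟩, hxa⟩
      · exact Or.inr ⟨⟨hx, h2⟩, hxa'⟩
  · rintro (⟨hx, hxa⟩ | ⟨hx, hxa⟩)
    · refine ⟨Or.inl hx.1, ?_⟩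
      rintro v (hv | hv) htv
      · exact hx.2 v hv htv
      · rcases eq_or_eq_of_mem hG hS hT (x := Sum.inl x) hx.1 (T.nbhd_mem hv htv) with h | h
        · exact hxa (Sum.inl_injective h)
        · obtain rfl := Sum.inl_injective h
          exact hT.2 v hv htv
    · refine ⟨Or.inr hx.1, ?_⟩
      rintro v (hv | hv) htv
      · rcases eq_or_eq_of_mem hG hS hT (x := Sum.inl x) (S.nbhd_mem hv htv) hx.1 with h | h
        · obtain rfl := Sum.inl_injective h
          exact hS.2 v hv htv
        · exact hxa (Sum.inl_injective h)
      · exact hx.2 v hv htv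

/-- The edge `{a, a†}` as a subtree. -/
def edge (G : UGraph.{u}) (a : G.Arc) : Subtree G where
  arcs := {a, G.inv a}
  verts := ∅
  inv_mem := by
    rintro b (rfl | rfl)
    · exact Or.inr rfl
    · exact Or.inl (G.inv_inv a)
  nbhd_mem := by simp
  connected := by
    rw [SimpleGraph.connected_iff_exists_forall_reachable]
    refine ⟨⟨Sum.inl a, Or.inl rfl⟩, ?_⟩
    rintro ⟨b | v, hb⟩
    · rcases hb with rfl | rfl
      · exact SimpleGraph.Reachable.refl _
      · exact SimpleGraph.Adj.reachable (SimpleGraph.comap_adj.2 (show G.inv a = G.inv a from rfl))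
    · exact absurd hb (by simp)

/-- The star at the vertex `v`, as a subtree: its edges are those adjacent to `v`. -/
def star (G : UGraph.{u}) (v : G.Vert) : Subtree G where
  arcs := {a | G.t a = some v ∨ G.t (G.inv a) = some v}
  verts := {v}
  inv_mem := by
    rintro a (h | h)
    · exact Or.inr (by rwa [G.inv_inv])
    · exact Or.inl h
  nbhd_mem := by
    rintro a w rfl h
    exact Or.inl h
  connected := by
    rw [SimpleGraph.connected_iff_exists_forall_reachable]
    refine ⟨⟨Sum.inr v, rfl⟩, ?_⟩
    have key : ∀ (b : G.Arc) (hb : G.t b = some v),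
        (G.realization.induce {x | Sum.elim (· ∈ {a | G.t a = some v ∨ G.t (G.inv a) = some v})
          (· ∈ ({v} : Set G.Vert)) x}).Reachable ⟨Sum.inr v, rfl⟩ ⟨Sum.inl b, Or.inl hb⟩ :=
      fun b hb => SimpleGraph.Adj.reachable (SimpleGraph.comap_adj.2 (show G.t b = some v from hb))
    rintro ⟨b | w, hb⟩
    · rcases hb with hb | hb
      · exact key b hb
      · exact (key _ hb).trans
          (SimpleGraph.Adj.reachable (SimpleGraph.comap_adj.2
            (show b = G.inv (G.inv b) from (G.inv_inv b).symm)))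
    · obtain rfl : w = v := hb
      exact SimpleGraph.Reachable.refl _

/-- A connected subgraph whose boundary contains both arcs of an edge is that edge. -/
theorem eq_edge {S : Subtree G} {a : G.Arc} (h : a ∈ S.boundary) (h' : G.inv a ∈ S.boundary) :
    S = edge G a := by
  have key : ∀ x ∈ S.nodes, x = Sum.inl a ∨ x = Sum.inl (G.inv a) := by
    intro x hx
    obtain ⟨p, hp, hpS⟩ := S.exists_path (x := Sum.inl a) h.1 hx
    cases p with
    | nil => exact Or.inl rfl
    | @cons _ y _ hy p' =>
      have hy' := eq_of_adj h (hpS y (by simp)) hy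
      subst hy'
      cases p' with
      | nil => exact Or.inr rfl
      | @cons _ z _ hz p'' =>
        have hz' := eq_of_adj h' (hpS z (by simp)) hz
        rw [G.inv_inv] at hz'
        subst hz'
        rw [SimpleGraph.Walk.cons_isPath_iff] at hp
        exact absurd (by simp) hp.2
  ext x
  · constructor
    · intro hx
      rcases key (Sum.inl x) hx with h | h
      · exact Or.inl (Sum.inl_injective h)
      · exact Or.inr (Sum.inl_injective h)
    · rintro (rfl | rfl)
      · exact h.1
      · exact h'.1
  · constructor
    · intro hx
      rcases key (Sum.inr x) hx with h | h <;> cases h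
    · intro hx
      exact absurd hx (by simp [edge])

theorem boundary_edge (a : G.Arc) : (edge G a).boundary = {a, G.inv a} := by
  ext x
  simp [boundary, edge]

theorem union_comm (S T : Subtree G) (h : S.Overlap T) (h' : T.Overlap S) :
    S.union T h = T.union S h' := by
  ext x <;> simp [union, or_comm]

theorem union_assoc (S T R : Subtree G) (h1 : S.Overlap T) (h2 : (S.union T h1).Overlap R)
    (h3 : T.Overlap R) (h4 : S.Overlap (T.union R h3)) :
    (S.union T h1).union R h2 = S.union (T.union R h3) h4 := by
  ext x <;> simp [union, or_assoc]

theorem union_right_comm (S T R : Subtree G) (h1 : S.Overlap T) (h2 : (S.union T h1).Overlap R)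
    (h3 : S.Overlap R) (h4 : (S.union R h3).Overlap T) :
    (S.union T h1).union R h2 = (S.union R h3).union T h4 := by
  ext x <;> simp only [union, Set.mem_union] <;> tauto

theorem union_left_comm (S T R : Subtree G) (h1 : S.Overlap R) (h2 : T.Overlap (S.union R h1))
    (h3 : T.Overlap R) (h4 : S.Overlap (T.union R h3)) :
    T.union (S.union R h1) h2 = S.union (T.union R h3) h4 := by
  ext x <;> simp only [union, Set.mem_union] <;> tauto

theorem union_edge (S : Subtree G) (a : G.Arc) (ha : a ∈ S.arcs) (h : S.Overlap (edge G a)) :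
    S.union (edge G a) h = S := by
  ext x
  · simp only [union, edge, Set.mem_union, Set.mem_insert_iff, Set.mem_singleton_iff]
    constructor
    · rintro (h | rfl | rfl)
      · exact h
      · exact ha
      · exact S.inv_mem ha
    · exact Or.inl
  · simp [union, edge]

end Subtree

end UGraph

/-! ### The category of undirected trees -/

/-- An undirected tree: an object of `Γ₀`. -/
structure UTree extends UGraph.{u} where
  isTree : toUGraph.IsTree

namespace UTree

open UGraph

/-- A (full) tree map between undirected trees: an involutive function on arcs together with a
function on subtrees, which is boundary-compatible and preserves overlaps and unions. Since
boundaries are sets, boundary-compatibility as an equality of multisets means that `φ₀` restricts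
to a bijection from `ð(S)` to `ð(φ̂ S)`. -/
@[ext] structure Hom (G G' : UTree.{u}) where
  onArc : G.Arc → G'.Arc
  onSub : Subtree G.toUGraph → Subtree G'.toUGraph
  map_inv : ∀ a, onArc (G.inv a) = G'.inv (onArc a)
  boundary_compat : ∀ S, Set.BijOn onArc S.boundary (onSub S).boundary
  map_union : ∀ (S T) (h : S.Overlap T), ∃ h' : (onSub S).Overlap (onSub T),
    onSub (S.union T h) = (onSub S).union (onSub T) h'

instance : Category UTree.{u} where
  Hom := Hom
  id G :=
    { onArc := id
      onSub := id
      map_inv := fun _ => rfl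
      boundary_compat := fun S => Set.bijOn_id _
      map_union := fun S T h => ⟨h, rfl⟩ }
  comp φ ψ :=
    { onArc := ψ.onArc ∘ φ.onArc
      onSub := ψ.onSub ∘ φ.onSub
      map_inv := fun a => by simp [φ.map_inv, ψ.map_inv]
      boundary_compat := fun S => (ψ.boundary_compat _).comp (φ.boundary_compat S)
      map_union := fun S T h => by
        obtain ⟨h1, e1⟩ := φ.map_union S T h
        obtain ⟨h2, e2⟩ := ψ.map_union _ _ h1
        exact ⟨h2, by simp [e1, e2]⟩ }

theorem Hom.map_edge {G G' : UTree.{u}} (φ : Hom G G') (a : G.Arc) :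
    φ.onSub (Subtree.edge G.toUGraph a) = Subtree.edge G'.toUGraph (φ.onArc a) := by
  have h := (φ.boundary_compat (Subtree.edge G.toUGraph a)).mapsTo
  rw [Subtree.boundary_edge] at h
  refine Subtree.eq_edge (h (Or.inl rfl)) ?_
  rw [← φ.map_inv]
  exact h (Or.inr rfl)

/-- Inert maps: those sending (stars of) vertices to (stars of) vertices. -/
def IsInert {G G' : UTree.{u}} (φ : G ⟶ G') : Prop :=
  ∀ v, ∃ w, Hom.onSub φ (Subtree.star G.toUGraph v) = Subtree.star G'.toUGraph w

/-- Edges and stars: the trees without internal edges. -/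
def IsElementary (G : UTree.{u}) : Prop := ∀ a ∈ G.D, G.inv a ∉ G.D

/-- The limit of `X_K` over the opposite of the category of inert maps `K ↣ G` with `K`
elementary, and inert maps over `G` between them, as a set of compatible families. -/
def SegalLimit (X : UTree.{u}ᵒᵖ ⥤ Type u) (G : UTree.{u}) : Type (u + 1) :=
  {x : ∀ (K : UTree.{u}) (f : K ⟶ G), K.IsElementary → IsInert f → X.obj (Opposite.op K) //
    ∀ (K L : UTree.{u}) (g : L ⟶ K) (f : K ⟶ G) (hK : K.IsElementary) (hL : L.IsElementary)
      (hf : IsInert f) (hgf : IsInert (g ≫ f)), IsInert g →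
      X.map g.op (x K f hK hf) = x L (g ≫ f) hL hgf}

/-- The Segal map of the presheaf `X` at `G`. -/
def segalMap (X : UTree.{u}ᵒᵖ ⥤ Type u) (G : UTree.{u}) (y : X.obj (Opposite.op G)) :
    SegalLimit X G :=
  ⟨fun _ f _ _ => X.map f.op y, fun _ _ g f _ _ _ _ _ => by simp⟩

/-- The Segal condition for presheaves on `Γ₀`. -/
def IsSegal : ObjectProperty (UTree.{u}ᵒᵖ ⥤ Type u) := fun X =>
  ∀ G, Function.Bijective (segalMap X G)

end UTree

/-! ### Augmented cyclic operads -/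

/-- `e` enumerates all the elements of `Fin n ⊕ Fin m` other than the `i`-th in the first and the
`j`-th in the second summand. -/
def EnumGlue {n m k : ℕ} (i : Fin n) (j : Fin m) (e : Fin k → Fin n ⊕ Fin m) : Prop :=
  Enumerates e {Sum.inl i, Sum.inr j}ᶜ

/-- An augmented cyclic operad (colored by an involutive set, symmetric, unital). Here `Op n` is
the set of all operations with `n` ports, so that `P(c₁, …, cₙ)` is the set of those `p : Op n`
with `bdry p = ![c₁, …, cₙ]`. Given `p`, `q` whose ports `i` and `j` have opposite colors,
`comp p i q j e` is the composite of `p` and `q` along these ports, with its ports listed in the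
order that the enumeration `e` of the remaining ports of `p` and `q` prescribes. By `act_comp` the
composites for different `e` determine each other, so this is the same as having one operation
`ᵢ∘ⱼ`. -/
structure AugCyclicOperad where
  Color : Type u
  inv : Color → Color
  inv_inv : ∀ c, inv (inv c) = c
  Op : ℕ → Type u
  bdry : ∀ {n}, Op n → Fin n → Color
  /-- The (right) action of permutations, `P(c₁, …, cₙ) → P(c_{σ 1}, …, c_{σ n})`. -/
  act : ∀ {n}, Equiv.Perm (Fin n) → Op n → Op n
  /-- The identity of the color `c` lies in `P(c†, c)`. -/
  ident : Color → Op 2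
  comp : ∀ {n m k} (p : Op n) (i : Fin n) (q : Op m) (j : Fin m) (e : Fin k → Fin n ⊕ Fin m),
    EnumGlue i j e → bdry p i = inv (bdry q j) → Op k
  bdry_act : ∀ {n} (σ : Equiv.Perm (Fin n)) (p : Op n), bdry (act σ p) = bdry p ∘ σ
  bdry_ident : ∀ c, bdry (ident c) = ![inv c, c]
  bdry_comp : ∀ {n m k} (p : Op n) (i : Fin n) (q : Op m) (j : Fin m)
    (e : Fin k → Fin n ⊕ Fin m) (he : EnumGlue i j e) (h : bdry p i = inv (bdry q j)),
    bdry (comp p i q j e he h) = Sum.elim (bdry p) (bdry q) ∘ e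
  act_one : ∀ {n} (p : Op n), act 1 p = p
  act_act : ∀ {n} (σ τ : Equiv.Perm (Fin n)) (p : Op n), act τ (act σ p) = act (σ * τ) p
  act_ident : ∀ c, act (Equiv.swap 0 1) (ident c) = ident (inv c)
  /-- Equivariance of composition, in the order of the ports of the composite. -/
  act_comp : ∀ {n m k} (p : Op n) (i : Fin n) (q : Op m) (j : Fin m)
    (e : Fin k → Fin n ⊕ Fin m) (he : EnumGlue i j e) (h : bdry p i = inv (bdry q j))
    (σ : Equiv.Perm (Fin k)) (he' : EnumGlue i j (e ∘ σ)),
    act σ (comp p i q j e he h) = comp p i q j (e ∘ σ) he' h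
  /-- Equivariance of composition, in the order of the ports of the first factor. -/
  comp_act : ∀ {n m k} (p : Op n) (i : Fin n) (q : Op m) (j : Fin m)
    (e : Fin k → Fin n ⊕ Fin m) (σ : Equiv.Perm (Fin n)) (he : EnumGlue i j e)
    (h : bdry (act σ p) i = inv (bdry q j)) (he' : EnumGlue (σ i) j (Sum.map σ id ∘ e))
    (h' : bdry p (σ i) = inv (bdry q j)),
    comp (act σ p) i q j e he h = comp p (σ i) q j (Sum.map σ id ∘ e) he' h'
  /-- Composition does not depend on the order of the two factors. -/
  comp_comm : ∀ {n m k} (p : Op n) (i : Fin n) (q : Op m) (j : Fin m)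
    (e : Fin k → Fin n ⊕ Fin m) (he : EnumGlue i j e) (h : bdry p i = inv (bdry q j))
    (he' : EnumGlue j i (Sum.swap ∘ e)) (h' : bdry q j = inv (bdry p i)),
    comp p i q j e he h = comp q j p i (Sum.swap ∘ e) he' h'
  /-- Composing with an identity just replaces the port `i` by the other port of the identity. -/
  comp_ident : ∀ {n} (p : Op n) (i : Fin n) (c : Color) (e : Fin n → Fin n ⊕ Fin 2)
    (he : EnumGlue i 0 e) (h : bdry p i = inv (bdry (ident c) 0)) (σ : Equiv.Perm (Fin n)),
    (∀ w, e w = if σ w = i then Sum.inr 1 else Sum.inl (σ w)) →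
    comp p i (ident c) 0 e he h = act σ p
  /-- Associativity: `(p ∘ q) ∘ r = p ∘ (q ∘ r)` when `p` and `r` are attached to ports `j ≠ y`
  of `q`, and the remaining ports of `p`, `q`, `r` are listed in the same order on both sides.
  Together with `comp_comm` this gives all associativity laws. -/
  comp_assoc : ∀ {n m s k k' K} (p : Op n) (q : Op m) (r : Op s) (i : Fin n) (j y : Fin m)
    (l : Fin s) (e : Fin k → Fin n ⊕ Fin m) (x : Fin k) (e' : Fin K → Fin k ⊕ Fin s)
    (f : Fin k' → Fin m ⊕ Fin s) (z : Fin k') (f' : Fin K → Fin n ⊕ Fin k')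
    (he : EnumGlue i j e) (he' : EnumGlue x l e') (hf : EnumGlue y l f) (hf' : EnumGlue i z f')
    (h₁ : bdry p i = inv (bdry q j)) (h₂ : bdry (comp p i q j e he h₁) x = inv (bdry r l))
    (h₃ : bdry q y = inv (bdry r l)) (h₄ : bdry p i = inv (bdry (comp q y r l f hf h₃) z)),
    e x = Sum.inr y → f z = Sum.inl j →
    (∀ w, Equiv.sumAssoc _ _ _ (Sum.map e id (e' w)) = Sum.map id f (f' w)) →
    comp (comp p i q j e he h₁) x r l e' he' h₂ = comp p i (comp q y r l f hf h₃) z f' hf' h₄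

namespace AugCyclicOperad

/-- A map of augmented cyclic operads. -/
@[ext] structure Hom (P Q : AugCyclicOperad.{u}) where
  onColor : P.Color → Q.Color
  onOp : ∀ {n}, P.Op n → Q.Op n
  map_inv : ∀ c, onColor (P.inv c) = Q.inv (onColor c)
  map_bdry : ∀ {n} (p : P.Op n), Q.bdry (onOp p) = onColor ∘ P.bdry p
  map_act : ∀ {n} (σ : Equiv.Perm (Fin n)) (p : P.Op n), onOp (P.act σ p) = Q.act σ (onOp p)
  map_ident : ∀ c, onOp (P.ident c) = Q.ident (onColor c)
  map_comp : ∀ {n m k} (p : P.Op n) (i : Fin n) (q : P.Op m) (j : Fin m)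
    (e : Fin k → Fin n ⊕ Fin m) (he : EnumGlue i j e) (h : P.bdry p i = P.inv (P.bdry q j))
    (h' : Q.bdry (onOp p) i = Q.inv (Q.bdry (onOp q) j)),
    onOp (P.comp p i q j e he h) = Q.comp (onOp p) i (onOp q) j e he h'

/-- The category `Cyc⁺` of augmented cyclic operads. -/
instance : Category AugCyclicOperad.{u} where
  Hom := Hom
  id P :=
    { onColor := id
      onOp := id
      map_inv := fun _ => rfl
      map_bdry := fun _ => rfl
      map_act := fun _ _ => rfl
      map_ident := fun _ => rfl
      map_comp := fun _ _ _ _ _ _ _ _ => rfl }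
  comp F F' :=
    { onColor := F'.onColor ∘ F.onColor
      onOp := F'.onOp ∘ F.onOp
      map_inv := fun c => by simp [F.map_inv, F'.map_inv]
      map_bdry := fun p => by simp [F.map_bdry, F'.map_bdry, Function.comp_assoc]
      map_act := fun σ p => by simp [F.map_act, F'.map_act]
      map_ident := fun c => by simp [F.map_ident, F'.map_ident]
      map_comp := fun p i q j e he h h' => by
        have h₁ := by simpa [F.map_bdry, F.map_inv] using congrArg F.onColor h
        simp only [Function.comp_apply]
        rw [F.map_comp p i q j e he h (by simpa [F.map_bdry] using h₁), F'.map_comp] }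

end AugCyclicOperad

namespace UTree

open UGraph

/-- The operations of arity `n` of the augmented cyclic operad freely generated by the vertices of
a tree `G`: subtrees of `G` with a total ordering of the boundary. -/
@[ext] structure FreeOp (G : UTree.{u}) (n : ℕ) where
  sub : Subtree G.toUGraph
  label : Fin n → G.Arc
  enum : Enumerates label sub.boundary

theorem FreeOp.label_mem {G : UTree.{u}} {n : ℕ} (p : FreeOp G n) (i : Fin n) :
    p.label i ∈ p.sub.boundary := p.enum.2 ▸ Set.mem_range_self i

theorem FreeOp.inv_label {G : UTree.{u}} {n m : ℕ} {p : FreeOp G n} {q : FreeOp G m} {i : Fin n}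
    {j : Fin m} (h : p.label i = G.inv (q.label j)) : G.inv (p.label i) = q.label j := by
  rw [h, G.inv_inv]

theorem FreeOp.overlap {G : UTree.{u}} {n m : ℕ} {p : FreeOp G n} {q : FreeOp G m} {i : Fin n}
    {j : Fin m} (h : p.label i = G.inv (q.label j)) : p.sub.Overlap q.sub :=
  Subtree.overlap_map (p.label_mem i) (by rw [FreeOp.inv_label h]; exact q.label_mem j)

/-- The augmented cyclic operad `C(G)` freely generated by the vertices of the tree `G`: colors
are the arcs of `G`, operations are subtrees with a total ordering of the boundary, and composition
is the union of subtrees. -/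
def freeCyc (G : UTree.{u}) : AugCyclicOperad.{u} where
  Color := G.Arc
  inv := G.inv
  inv_inv := G.inv_inv
  Op := FreeOp G
  bdry p := p.label
  act {n} σ p :=
    { sub := p.sub
      label := p.label ∘ σ
      enum := ⟨p.enum.1.comp σ.injective, by rw [σ.surjective.range_comp, p.enum.2]⟩ }
  ident a :=
    { sub := Subtree.edge G.toUGraph a
      label := ![G.inv a, a]
      enum := by
        constructor
        · intro x y h
          have h1 := G.inv_ne a
          fin_cases x <;> fin_cases y
          · rfl
          · exact (h1 h).elim
          · exact (h1 h.symm).elim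
          · rfl
        · rw [Subtree.boundary_edge]
          ext x
          simp [eq_comm] }
  comp p i q j e he h :=
    { sub := p.sub.union q.sub (FreeOp.overlap h)
      label := Sum.elim p.label q.label ∘ e
      enum := by
        have h1 := p.label_mem i
        have h2 : G.inv (p.label i) ∈ q.sub.boundary := by
          rw [FreeOp.inv_label h]; exact q.label_mem j
        refine enumerates_sum (s' := {p.label i}ᶜ) (t' := {q.label j}ᶜ) p.enum q.enum he
          ?_ ?_ ?_ ?_
        · intro a
          simp [p.enum.1.eq_iff]
        · intro a
          simp [q.enum.1.eq_iff]
        · intro x hx hxi hx' hxj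
          rw [← FreeOp.inv_label h] at hxj
          exact Subtree.boundary_disjoint G.isTree h1 h2 hx hxi hx' hxj
        · intro x
          rw [← FreeOp.inv_label h]
          exact Subtree.mem_boundary_union G.isTree h1 h2 _ x }
  bdry_act _ _ := rfl
  bdry_ident _ := rfl
  bdry_comp _ _ _ _ _ _ _ := rfl
  act_one _ := rfl
  act_act _ _ _ := rfl
  act_ident a := by
    refine FreeOp.ext ?_ ?_
    · apply Subtree.eq_edge
      · rw [Subtree.boundary_edge]; exact Or.inr rfl
      · rw [Subtree.boundary_edge, G.inv_inv]; exact Or.inl rfl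
    · funext x
      fin_cases x <;> simp [G.inv_inv]
  act_comp _ _ _ _ _ _ _ _ _ := rfl
  comp_act p i q j e σ he h he' h' := by
    refine FreeOp.ext rfl ?_
    funext w
    simp only [Function.comp_apply]
    rcases e w with a | a <;> rfl
  comp_comm p i q j e he h he' h' := by
    apply FreeOp.ext
    · exact Subtree.union_comm _ _ (FreeOp.overlap h) (FreeOp.overlap h')
    funext w
    simp only [Function.comp_apply]
    rcases e w with a | a <;> rfl
  comp_ident p i c e he h σ hσ := by
    have hi : p.label i = c := h.trans (G.inv_inv c)
    apply FreeOp.ext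
    · exact Subtree.union_edge _ _ (by rw [← hi]; exact (p.label_mem i).1) (FreeOp.overlap h)
    · funext w
      simp only [Function.comp_apply, hσ]
      split_ifs with hw
      · simp [hw, hi]
      · rfl
  comp_assoc p q r i j y l e x e' f z f' he he' hf hf' h₁ h₂ h₃ h₄ hx hz hw := by
    apply FreeOp.ext
    · exact Subtree.union_assoc _ _ _ (FreeOp.overlap h₁) (FreeOp.overlap h₂) (FreeOp.overlap h₃)
        (FreeOp.overlap h₄)
    funext w
    have key : ∀ u v, Equiv.sumAssoc _ _ _ (Sum.map e id u) = Sum.map id f v →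
        Sum.elim (Sum.elim p.label q.label ∘ e) r.label u =
          Sum.elim p.label (Sum.elim q.label r.label ∘ f) v := by
      intro u v huv
      have h1 : Sum.elim (Sum.elim p.label q.label ∘ e) r.label u = Sum.elim p.label
          (Sum.elim q.label r.label) (Equiv.sumAssoc _ _ _ (Sum.map e id u)) := by
        rcases u with u | u
        · rcases h : e u with b | b <;> simp [h]
        · simp
      rw [h1, huv]
      rcases v with v | v <;> simp
    exact key _ _ (hw w)

/-- The functor `C : Γ₀ ⥤ Cyc⁺`. -/
def freeCycFunctor : UTree.{u} ⥤ AugCyclicOperad.{u} where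
  obj := freeCyc
  map {G G'} φ :=
    { onColor := Hom.onArc φ
      onOp := fun {n} p =>
        { sub := Hom.onSub φ p.sub
          label := Hom.onArc φ ∘ p.label
          enum := by
            have hb := Hom.boundary_compat φ p.sub
            refine ⟨fun x y h => p.enum.1 (hb.injOn (p.label_mem x) (p.label_mem y) h), ?_⟩
            rw [Set.range_comp, p.enum.2, hb.image_eq] }
      map_inv := Hom.map_inv φ
      map_bdry := fun _ => rfl
      map_act := fun _ _ => rfl
      map_ident := fun a => by
        refine FreeOp.ext (Hom.map_edge φ a) ?_
        funext x
        fin_cases x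
        · exact Hom.map_inv φ a
        · rfl
      map_comp := fun p i q j e he h h' => by
        refine FreeOp.ext (Hom.map_union φ _ _ (FreeOp.overlap h)).2 ?_
        funext w
        change Hom.onArc φ (Sum.elim p.label q.label (e w)) =
          Sum.elim (Hom.onArc φ ∘ p.label) (Hom.onArc φ ∘ q.label) (e w)
        rcases e w with a | a <;> rfl }
  map_id _ := rfl
  map_comp _ _ := rfl

end UTree

/-- The nerve functor from augmented cyclic operads to `Γ₀`-presheaves, `N P = Cyc⁺(C(-), P)`. -/
def AugCyclicOperad.nerve : AugCyclicOperad.{u} ⥤ (UTree.{u}ᵒᵖ ⥤ Type u) where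
  obj P := UTree.freeCycFunctor.op ⋙ yoneda.obj P
  map f := Functor.whiskerLeft UTree.freeCycFunctor.op (yoneda.map f)

/-! ### Directed graphs and trees -/

/-- A finite directed graph `E ← I → V ← O → E` (outer legs injective). The span `E ↩ I → V` is
encoded as the partial function `tgt : E ⇀ V` with domain `I`, and `E ↩ O → V` as the partial
function `src : E ⇀ V` with domain `O`. -/
structure DGraph where
  Edge : Type u
  Vert : Type u
  [finite_edge : Finite Edge]
  [finite_vert : Finite Vert]
  /-- `tgt e = some v` means that `e` is an input of the vertex `v`. -/
  tgt : Edge → Option Vert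
  /-- `src e = some v` means that `e` is an output of the vertex `v`. -/
  src : Edge → Option Vert

namespace DGraph

open UGraph

/-- The associated undirected graph, with `A = E ⨿ E` and `D = I ⨿ O`. -/
def toUGraph (G : DGraph.{u}) : UGraph.{u} where
  Arc := G.Edge ⊕ G.Edge
  Vert := G.Vert
  finite_arc := by
    have := G.finite_edge
    infer_instance
  finite_vert := G.finite_vert
  inv := Sum.swap
  inv_inv := Sum.swap_swap
  inv_ne := by rintro (e | e) h <;> cases h
  t := Sum.elim G.tgt G.src

/-- The arc of an edge which points in the direction of that edge. -/
def fwd (G : DGraph.{u}) (e : G.Edge) : G.toUGraph.Arc := Sum.inl e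

/-- The arc of an edge which points against the direction of that edge. -/
def bwd (G : DGraph.{u}) (e : G.Edge) : G.toUGraph.Arc := Sum.inr e

variable {G : DGraph.{u}}

theorem fwd_injective : Function.Injective G.fwd := Sum.inl_injective

theorem bwd_injective : Function.Injective G.bwd := Sum.inr_injective

theorem fwd_ne_bwd (e e' : G.Edge) : G.fwd e ≠ G.bwd e' := Sum.inl_ne_inr

theorem inv_fwd (e : G.Edge) : G.toUGraph.inv (G.fwd e) = G.bwd e := rfl

theorem inv_bwd (e : G.Edge) : G.toUGraph.inv (G.bwd e) = G.fwd e := rfl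

/-- The set of edges of a subtree. -/
def edges (S : Subtree G.toUGraph) : Set G.Edge := {e | G.fwd e ∈ S.arcs}

/-- The inputs `E_S \ O_S` of a subtree. -/
def inputs (S : Subtree G.toUGraph) : Set G.Edge :=
  {e | e ∈ edges S ∧ ∀ v ∈ S.verts, G.src e ≠ some v}

/-- The outputs `E_S \ I_S` of a subtree. -/
def outputs (S : Subtree G.toUGraph) : Set G.Edge :=
  {e | e ∈ edges S ∧ ∀ v ∈ S.verts, G.tgt e ≠ some v}

theorem mem_inputs_iff (S : Subtree G.toUGraph) (e : G.Edge) :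
    e ∈ inputs S ↔ G.bwd e ∈ S.boundary :=
  and_congr ⟨fun h => S.inv_mem (a := G.fwd e) h, fun h => S.inv_mem (a := G.bwd e) h⟩ Iff.rfl

theorem mem_outputs_iff (S : Subtree G.toUGraph) (e : G.Edge) :
    e ∈ outputs S ↔ G.fwd e ∈ S.boundary := Iff.rfl

/-- The edge `e` as a subtree. -/
def edgeSub (G : DGraph.{u}) (e : G.Edge) : Subtree G.toUGraph :=
  Subtree.edge G.toUGraph (G.fwd e)

theorem inputs_edgeSub (e : G.Edge) : inputs (G.edgeSub e) = {e} := by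
  ext x
  rw [mem_inputs_iff, edgeSub, Subtree.boundary_edge]
  constructor
  · rintro (h | h)
    · exact absurd h.symm (fwd_ne_bwd _ _)
    · exact bwd_injective h
  · rintro rfl
    exact Or.inr rfl

theorem outputs_edgeSub (e : G.Edge) : outputs (G.edgeSub e) = {e} := by
  ext x
  rw [mem_outputs_iff, edgeSub, Subtree.boundary_edge]
  constructor
  · rintro (h | h)
    · exact fwd_injective h
    · exact absurd h (fwd_ne_bwd _ _)
  · rintro rfl
    exact Or.inl rfl

theorem eq_edgeSub {S : Subtree G.toUGraph} {e : G.Edge} (h : e ∈ inputs S) (h' : e ∈ outputs S) :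
    S = G.edgeSub e :=
  Subtree.eq_edge h' ((mem_inputs_iff S e).1 h)

end DGraph

/-- A directed tree: an object of `O₀`. -/
structure DTree extends DGraph.{u} where
  isTree : toDGraph.toUGraph.IsTree

namespace DTree

open UGraph DGraph

/-- A tree map between directed trees: a function on edges together with a function on subtrees,
which is boundary-compatible and preserves overlaps and unions. -/
@[ext] structure Hom (G G' : DTree.{u}) where
  onEdge : G.Edge → G'.Edge
  onSub : Subtree G.toUGraph → Subtree G'.toUGraph
  inputs_compat : ∀ S, Set.BijOn onEdge (inputs S) (inputs (onSub S))
  outputs_compat : ∀ S, Set.BijOn onEdge (outputs S) (outputs (onSub S))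
  map_union : ∀ (S T) (h : S.Overlap T), ∃ h' : (onSub S).Overlap (onSub T),
    onSub (S.union T h) = (onSub S).union (onSub T) h'

instance : Category DTree.{u} where
  Hom := Hom
  id G :=
    { onEdge := id
      onSub := id
      inputs_compat := fun S => Set.bijOn_id _
      outputs_compat := fun S => Set.bijOn_id _
      map_union := fun S T h => ⟨h, rfl⟩ }
  comp φ ψ :=
    { onEdge := ψ.onEdge ∘ φ.onEdge
      onSub := ψ.onSub ∘ φ.onSub
      inputs_compat := fun S => (ψ.inputs_compat _).comp (φ.inputs_compat S)
      outputs_compat := fun S => (ψ.outputs_compat _).comp (φ.outputs_compat S)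
      map_union := fun S T h => by
        obtain ⟨h1, e1⟩ := φ.map_union S T h
        obtain ⟨h2, e2⟩ := ψ.map_union _ _ h1
        exact ⟨h2, by simp [e1, e2]⟩ }

theorem Hom.map_edge {G G' : DTree.{u}} (φ : Hom G G') (e : G.Edge) :
    φ.onSub (G.edgeSub e) = G'.edgeSub (φ.onEdge e) :=
  eq_edgeSub ((φ.inputs_compat _).mapsTo (by rw [inputs_edgeSub]; rfl))
    ((φ.outputs_compat _).mapsTo (by rw [outputs_edgeSub]; rfl))

/-- Inert maps: those sending (stars of) vertices to (stars of) vertices. -/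
def IsInert {G G' : DTree.{u}} (φ : G ⟶ G') : Prop :=
  ∀ v, ∃ w, Hom.onSub φ (Subtree.star G.toUGraph v) = Subtree.star G'.toUGraph w

/-- Edges and stars: the trees without internal edges, that is, no edge is both an input of a
vertex and an output of a vertex. -/
def IsElementary (G : DTree.{u}) : Prop := ∀ e, G.tgt e = none ∨ G.src e = none

/-- The limit of `X_K` over the opposite of the category of inert maps `K ↣ G` with `K`
elementary, and inert maps over `G` between them, as a set of compatible families. -/
def SegalLimit (X : DTree.{u}ᵒᵖ ⥤ Type u) (G : DTree.{u}) : Type (u + 1) :=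
  {x : ∀ (K : DTree.{u}) (f : K ⟶ G), K.IsElementary → IsInert f → X.obj (Opposite.op K) //
    ∀ (K L : DTree.{u}) (g : L ⟶ K) (f : K ⟶ G) (hK : K.IsElementary) (hL : L.IsElementary)
      (hf : IsInert f) (hgf : IsInert (g ≫ f)), IsInert g →
      X.map g.op (x K f hK hf) = x L (g ≫ f) hL hgf}

/-- The Segal map of the presheaf `X` at `G`. -/
def segalMap (X : DTree.{u}ᵒᵖ ⥤ Type u) (G : DTree.{u}) (y : X.obj (Opposite.op G)) :
    SegalLimit X G :=
  ⟨fun _ f _ _ => X.map f.op y, fun _ _ g f _ _ _ _ _ => by simp⟩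

/-- The Segal condition for presheaves on `O₀`. -/
def IsSegal : ObjectProperty (DTree.{u}ᵒᵖ ⥤ Type u) := fun X =>
  ∀ G, Function.Bijective (segalMap X G)

end DTree

/-! ### Dioperads -/

/-- A dioperad, or symmetric polycategory (colored, unital). Here `Op n m` is the set of all
operations with `n` inputs and `m` outputs, so that `P(c₁, …, cₙ; d₁, …, dₘ)` is the set of those
`p : Op n m` with `inp p = ![c₁, …, cₙ]` and `out p = ![d₁, …, dₘ]`. If input `i` of `p` and output
`j` of `q` have the same color, `comp p i q j e e'` is their composite along these, with its inputs
and outputs listed in the orders that the enumerations `e` and `e'` of the remaining inputs and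
outputs of `p` and `q` prescribe. By `act_comp` the composites for different `e`, `e'` determine
each other, so this is the same as having one operation `ᵢ∘ⱼ`. -/
structure Dioperad where
  Color : Type u
  Op : ℕ → ℕ → Type u
  inp : ∀ {n m}, Op n m → Fin n → Color
  out : ∀ {n m}, Op n m → Fin m → Color
  /-- The (right) action of permutations of the inputs and of the outputs. -/
  act : ∀ {n m}, Equiv.Perm (Fin n) → Equiv.Perm (Fin m) → Op n m → Op n m
  ident : Color → Op 1 1
  comp : ∀ {n m n' m' k k'} (p : Op n m) (i : Fin n) (q : Op n' m') (j : Fin m')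
    (e : Fin k → Fin n ⊕ Fin n') (e' : Fin k' → Fin m ⊕ Fin m'),
    Enumerates e {Sum.inl i}ᶜ → Enumerates e' {Sum.inr j}ᶜ → inp p i = out q j → Op k k'
  inp_act : ∀ {n m} (σ : Equiv.Perm (Fin n)) (τ : Equiv.Perm (Fin m)) (p : Op n m),
    inp (act σ τ p) = inp p ∘ σ
  out_act : ∀ {n m} (σ : Equiv.Perm (Fin n)) (τ : Equiv.Perm (Fin m)) (p : Op n m),
    out (act σ τ p) = out p ∘ τ
  inp_ident : ∀ c, inp (ident c) = ![c]
  out_ident : ∀ c, out (ident c) = ![c]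
  inp_comp : ∀ {n m n' m' k k'} (p : Op n m) (i : Fin n) (q : Op n' m') (j : Fin m')
    (e : Fin k → Fin n ⊕ Fin n') (e' : Fin k' → Fin m ⊕ Fin m')
    (he : Enumerates e {Sum.inl i}ᶜ) (he' : Enumerates e' {Sum.inr j}ᶜ) (h : inp p i = out q j),
    inp (comp p i q j e e' he he' h) = Sum.elim (inp p) (inp q) ∘ e
  out_comp : ∀ {n m n' m' k k'} (p : Op n m) (i : Fin n) (q : Op n' m') (j : Fin m')
    (e : Fin k → Fin n ⊕ Fin n') (e' : Fin k' → Fin m ⊕ Fin m')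
    (he : Enumerates e {Sum.inl i}ᶜ) (he' : Enumerates e' {Sum.inr j}ᶜ) (h : inp p i = out q j),
    out (comp p i q j e e' he he' h) = Sum.elim (out p) (out q) ∘ e'
  act_one : ∀ {n m} (p : Op n m), act 1 1 p = p
  act_act : ∀ {n m} (σ σ' : Equiv.Perm (Fin n)) (τ τ' : Equiv.Perm (Fin m)) (p : Op n m),
    act σ' τ' (act σ τ p) = act (σ * σ') (τ * τ') p
  /-- Equivariance of composition, in the order of the inputs and outputs of the composite. -/
  act_comp : ∀ {n m n' m' k k'} (p : Op n m) (i : Fin n) (q : Op n' m') (j : Fin m')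
    (e : Fin k → Fin n ⊕ Fin n') (e' : Fin k' → Fin m ⊕ Fin m')
    (he : Enumerates e {Sum.inl i}ᶜ) (he' : Enumerates e' {Sum.inr j}ᶜ) (h : inp p i = out q j)
    (σ : Equiv.Perm (Fin k)) (τ : Equiv.Perm (Fin k'))
    (hσ : Enumerates (e ∘ σ) {Sum.inl i}ᶜ) (hτ : Enumerates (e' ∘ τ) {Sum.inr j}ᶜ),
    act σ τ (comp p i q j e e' he he' h) = comp p i q j (e ∘ σ) (e' ∘ τ) hσ hτ h
  /-- Equivariance of composition, in the order of the inputs and outputs of the two factors. -/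
  comp_act : ∀ {n m n' m' k k'} (p : Op n m) (i : Fin n) (q : Op n' m') (j : Fin m')
    (e : Fin k → Fin n ⊕ Fin n') (e' : Fin k' → Fin m ⊕ Fin m')
    (σ : Equiv.Perm (Fin n)) (τ : Equiv.Perm (Fin m))
    (σ' : Equiv.Perm (Fin n')) (τ' : Equiv.Perm (Fin m'))
    (he : Enumerates e {Sum.inl i}ᶜ) (he' : Enumerates e' {Sum.inr j}ᶜ)
    (h : inp (act σ τ p) i = out (act σ' τ' q) j)
    (hσ : Enumerates (Sum.map σ σ' ∘ e) {Sum.inl (σ i)}ᶜ)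
    (hτ : Enumerates (Sum.map τ τ' ∘ e') {Sum.inr (τ' j)}ᶜ) (h' : inp p (σ i) = out q (τ' j)),
    comp (act σ τ p) i (act σ' τ' q) j e e' he he' h =
      comp p (σ i) q (τ' j) (Sum.map σ σ' ∘ e) (Sum.map τ τ' ∘ e') hσ hτ h'
  /-- Left unit law. -/
  ident_comp : ∀ {n m} (c : Color) (q : Op n m) (j : Fin m) (e : Fin n → Fin 1 ⊕ Fin n)
    (e' : Fin m → Fin 1 ⊕ Fin m) (he : Enumerates e {Sum.inl 0}ᶜ)
    (he' : Enumerates e' {Sum.inr j}ᶜ) (h : inp (ident c) 0 = out q j)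
    (σ : Equiv.Perm (Fin n)) (τ : Equiv.Perm (Fin m)), (∀ w, e w = Sum.inr (σ w)) →
    (∀ w, e' w = if τ w = j then Sum.inl 0 else Sum.inr (τ w)) →
    comp (ident c) 0 q j e e' he he' h = act σ τ q
  /-- Right unit law. -/
  comp_ident : ∀ {n m} (p : Op n m) (i : Fin n) (c : Color) (e : Fin n → Fin n ⊕ Fin 1)
    (e' : Fin m → Fin m ⊕ Fin 1) (he : Enumerates e {Sum.inl i}ᶜ)
    (he' : Enumerates e' {Sum.inr 0}ᶜ) (h : inp p i = out (ident c) 0)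
    (σ : Equiv.Perm (Fin n)) (τ : Equiv.Perm (Fin m)),
    (∀ w, e w = if σ w = i then Sum.inr 0 else Sum.inl (σ w)) → (∀ w, e' w = Sum.inl (τ w)) →
    comp p i (ident c) 0 e e' he he' h = act σ τ p
  /-- Sequential associativity: `(p ∘ q) ∘ r = p ∘ (q ∘ r)` when output `j` of `q` is attached to
  `p` and output `l` of `r` is attached to input `y` of `q`. -/
  comp_assoc : ∀ {n m n' m' n'' m'' k k' s s' K K'} (p : Op n m) (q : Op n' m') (r : Op n'' m'')
    (i : Fin n) (j : Fin m') (y : Fin n') (l : Fin m'')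
    (e : Fin k → Fin n ⊕ Fin n') (e' : Fin k' → Fin m ⊕ Fin m') (x : Fin k)
    (ε : Fin K → Fin k ⊕ Fin n'') (ε' : Fin K' → Fin k' ⊕ Fin m'')
    (d : Fin s → Fin n' ⊕ Fin n'') (d' : Fin s' → Fin m' ⊕ Fin m'') (z : Fin s')
    (δ : Fin K → Fin n ⊕ Fin s) (δ' : Fin K' → Fin m ⊕ Fin s')
    (he : Enumerates e {Sum.inl i}ᶜ) (he' : Enumerates e' {Sum.inr j}ᶜ)
    (hε : Enumerates ε {Sum.inl x}ᶜ) (hε' : Enumerates ε' {Sum.inr l}ᶜ)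
    (hd : Enumerates d {Sum.inl y}ᶜ) (hd' : Enumerates d' {Sum.inr l}ᶜ)
    (hδ : Enumerates δ {Sum.inl i}ᶜ) (hδ' : Enumerates δ' {Sum.inr z}ᶜ)
    (h₁ : inp p i = out q j) (h₂ : inp (comp p i q j e e' he he' h₁) x = out r l)
    (h₃ : inp q y = out r l) (h₄ : inp p i = out (comp q y r l d d' hd hd' h₃) z),
    e x = Sum.inr y → d' z = Sum.inl j →
    (∀ w, Equiv.sumAssoc _ _ _ (Sum.map e id (ε w)) = Sum.map id d (δ w)) →
    (∀ w, Equiv.sumAssoc _ _ _ (Sum.map e' id (ε' w)) = Sum.map id d' (δ' w)) →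
    comp (comp p i q j e e' he he' h₁) x r l ε ε' hε hε' h₂ =
      comp p i (comp q y r l d d' hd hd' h₃) z δ δ' hδ hδ' h₄
  /-- Parallel associativity in the inputs: `(p ∘ q) ∘ r = (p ∘ r) ∘ q` when `q` and `r` are
  attached to two inputs `i ≠ y` of `p`. -/
  comp_comm_inp : ∀ {n m n' m' n'' m'' k k' s s' K K'} (p : Op n m) (q : Op n' m') (r : Op n'' m'')
    (i y : Fin n) (j : Fin m') (l : Fin m'')
    (e : Fin k → Fin n ⊕ Fin n') (e' : Fin k' → Fin m ⊕ Fin m') (x : Fin k)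
    (ε : Fin K → Fin k ⊕ Fin n'') (ε' : Fin K' → Fin k' ⊕ Fin m'')
    (d : Fin s → Fin n ⊕ Fin n'') (d' : Fin s' → Fin m ⊕ Fin m'') (z : Fin s)
    (δ : Fin K → Fin s ⊕ Fin n') (δ' : Fin K' → Fin s' ⊕ Fin m')
    (he : Enumerates e {Sum.inl i}ᶜ) (he' : Enumerates e' {Sum.inr j}ᶜ)
    (hε : Enumerates ε {Sum.inl x}ᶜ) (hε' : Enumerates ε' {Sum.inr l}ᶜ)
    (hd : Enumerates d {Sum.inl y}ᶜ) (hd' : Enumerates d' {Sum.inr l}ᶜ)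
    (hδ : Enumerates δ {Sum.inl z}ᶜ) (hδ' : Enumerates δ' {Sum.inr j}ᶜ)
    (h₁ : inp p i = out q j) (h₂ : inp (comp p i q j e e' he he' h₁) x = out r l)
    (h₃ : inp p y = out r l) (h₄ : inp (comp p y r l d d' hd hd' h₃) z = out q j),
    e x = Sum.inl y → d z = Sum.inl i →
    (∀ w, Sum.map id Sum.swap (Equiv.sumAssoc _ _ _ (Sum.map e id (ε w))) =
      Equiv.sumAssoc _ _ _ (Sum.map d id (δ w))) →
    (∀ w, Sum.map id Sum.swap (Equiv.sumAssoc _ _ _ (Sum.map e' id (ε' w))) =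
      Equiv.sumAssoc _ _ _ (Sum.map d' id (δ' w))) →
    comp (comp p i q j e e' he he' h₁) x r l ε ε' hε hε' h₂ =
      comp (comp p y r l d d' hd hd' h₃) z q j δ δ' hδ hδ' h₄
  /-- Parallel associativity in the outputs: `p ∘ (q ∘ r) = q ∘ (p ∘ r)` when `p` and `q` are
  attached to two outputs `j ≠ l` of `r`. -/
  comp_comm_out : ∀ {n m n' m' n'' m'' k k' s s' K K'} (p : Op n m) (q : Op n' m') (r : Op n'' m'')
    (i : Fin n) (y : Fin n') (j l : Fin m'')
    (e : Fin k → Fin n ⊕ Fin n'') (e' : Fin k' → Fin m ⊕ Fin m'') (x : Fin k')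
    (ε : Fin K → Fin n' ⊕ Fin k) (ε' : Fin K' → Fin m' ⊕ Fin k')
    (d : Fin s → Fin n' ⊕ Fin n'') (d' : Fin s' → Fin m' ⊕ Fin m'') (z : Fin s')
    (δ : Fin K → Fin n ⊕ Fin s) (δ' : Fin K' → Fin m ⊕ Fin s')
    (he : Enumerates e {Sum.inl i}ᶜ) (he' : Enumerates e' {Sum.inr j}ᶜ)
    (hε : Enumerates ε {Sum.inl y}ᶜ) (hε' : Enumerates ε' {Sum.inr x}ᶜ)
    (hd : Enumerates d {Sum.inl y}ᶜ) (hd' : Enumerates d' {Sum.inr l}ᶜ)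
    (hδ : Enumerates δ {Sum.inl i}ᶜ) (hδ' : Enumerates δ' {Sum.inr z}ᶜ)
    (h₁ : inp p i = out r j) (h₂ : inp q y = out (comp p i r j e e' he he' h₁) x)
    (h₃ : inp q y = out r l) (h₄ : inp p i = out (comp q y r l d d' hd hd' h₃) z),
    e' x = Sum.inr l → d' z = Sum.inr j →
    (∀ w, (Equiv.sumAssoc _ _ _).symm (Sum.map id e (ε w)) =
      Sum.map Sum.swap id ((Equiv.sumAssoc _ _ _).symm (Sum.map id d (δ w)))) →
    (∀ w, (Equiv.sumAssoc _ _ _).symm (Sum.map id e' (ε' w)) =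
      Sum.map Sum.swap id ((Equiv.sumAssoc _ _ _).symm (Sum.map id d' (δ' w)))) →
    comp q y (comp p i r j e e' he he' h₁) x ε ε' hε hε' h₂ =
      comp p i (comp q y r l d d' hd hd' h₃) z δ δ' hδ hδ' h₄

namespace Dioperad

/-- A map of dioperads. -/
@[ext] structure Hom (P Q : Dioperad.{u}) where
  onColor : P.Color → Q.Color
  onOp : ∀ {n m}, P.Op n m → Q.Op n m
  map_inp : ∀ {n m} (p : P.Op n m), Q.inp (onOp p) = onColor ∘ P.inp p
  map_out : ∀ {n m} (p : P.Op n m), Q.out (onOp p) = onColor ∘ P.out p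
  map_act : ∀ {n m} (σ : Equiv.Perm (Fin n)) (τ : Equiv.Perm (Fin m)) (p : P.Op n m),
    onOp (P.act σ τ p) = Q.act σ τ (onOp p)
  map_ident : ∀ c, onOp (P.ident c) = Q.ident (onColor c)
  map_comp : ∀ {n m n' m' k k'} (p : P.Op n m) (i : Fin n) (q : P.Op n' m') (j : Fin m')
    (e : Fin k → Fin n ⊕ Fin n') (e' : Fin k' → Fin m ⊕ Fin m')
    (he : Enumerates e {Sum.inl i}ᶜ) (he' : Enumerates e' {Sum.inr j}ᶜ)
    (h : P.inp p i = P.out q j) (h' : Q.inp (onOp p) i = Q.out (onOp q) j),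
    onOp (P.comp p i q j e e' he he' h) = Q.comp (onOp p) i (onOp q) j e e' he he' h'

/-- The category `DiOp` of dioperads. -/
instance : Category Dioperad.{u} where
  Hom := Hom
  id P :=
    { onColor := id
      onOp := id
      map_inp := fun _ => rfl
      map_out := fun _ => rfl
      map_act := fun _ _ _ => rfl
      map_ident := fun _ => rfl
      map_comp := fun _ _ _ _ _ _ _ _ _ _ => rfl }
  comp F F' :=
    { onColor := F'.onColor ∘ F.onColor
      onOp := F'.onOp ∘ F.onOp
      map_inp := fun p => by simp [F.map_inp, F'.map_inp, Function.comp_assoc]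
      map_out := fun p => by simp [F.map_out, F'.map_out, Function.comp_assoc]
      map_act := fun σ τ p => by simp [F.map_act, F'.map_act]
      map_ident := fun c => by simp [F.map_ident, F'.map_ident]
      map_comp := fun p i q j e e' he he' h h' => by
        have h₁ := congrArg F.onColor h
        simp only [Function.comp_apply]
        rw [F.map_comp p i q j e e' he he' h (by simpa [F.map_inp, F.map_out] using h₁),
          F'.map_comp] }

end Dioperad

namespace DTree

open UGraph DGraph

/-- The operations with `n` inputs and `m` outputs of the dioperad freely generated by the vertices
of a directed tree `G`: subtrees of `G` with total orderings of their inputs and outputs. -/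
@[ext] structure FreeOp (G : DTree.{u}) (n m : ℕ) where
  sub : Subtree G.toUGraph
  inp : Fin n → G.Edge
  out : Fin m → G.Edge
  enum_inp : Enumerates inp (inputs sub)
  enum_out : Enumerates out (outputs sub)

namespace FreeOp

variable {G : DTree.{u}} {n m n' m' : ℕ}

theorem inp_mem (p : FreeOp G n m) (i : Fin n) : G.bwd (p.inp i) ∈ p.sub.boundary :=
  (mem_inputs_iff _ _).1 (p.enum_inp.2 ▸ Set.mem_range_self i)

theorem out_mem (p : FreeOp G n m) (i : Fin m) : G.fwd (p.out i) ∈ p.sub.boundary :=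
  (mem_outputs_iff _ _).1 (p.enum_out.2 ▸ Set.mem_range_self i)

theorem inv_inp_mem {p : FreeOp G n m} {q : FreeOp G n' m'} {i : Fin n} {j : Fin m'}
    (h : p.inp i = q.out j) : G.toUGraph.inv (G.bwd (p.inp i)) ∈ q.sub.boundary := by
  rw [inv_bwd, h]; exact q.out_mem j

theorem overlap {p : FreeOp G n m} {q : FreeOp G n' m'} {i : Fin n} {j : Fin m'}
    (h : p.inp i = q.out j) : p.sub.Overlap q.sub :=
  Subtree.overlap_map (p.inp_mem i) (inv_inp_mem h)

end FreeOp

theorem elim_assoc {α : Type*} {n m s k k' : ℕ} {a : Fin n → α} {b : Fin m → α} {c : Fin s → α}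
    {e : Fin k → Fin n ⊕ Fin m} {f : Fin k' → Fin m ⊕ Fin s} {u : Fin k ⊕ Fin s}
    {v : Fin n ⊕ Fin k'} (h : Equiv.sumAssoc _ _ _ (Sum.map e id u) = Sum.map id f v) :
    Sum.elim (Sum.elim a b ∘ e) c u = Sum.elim a (Sum.elim b c ∘ f) v := by
  have h1 : Sum.elim (Sum.elim a b ∘ e) c u =
      Sum.elim a (Sum.elim b c) (Equiv.sumAssoc _ _ _ (Sum.map e id u)) := by
    rcases u with u | u
    · rcases h : e u with b | b <;> simp [h]
    · simp
  rw [h1, h]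
  rcases v with v | v <;> simp

theorem elim_comm_inp {α : Type*} {n m s k k' : ℕ} {a : Fin n → α} {b : Fin m → α} {c : Fin s → α}
    {e : Fin k → Fin n ⊕ Fin m} {d : Fin k' → Fin n ⊕ Fin s} {u : Fin k ⊕ Fin s}
    {v : Fin k' ⊕ Fin m}
    (h : Sum.map id Sum.swap (Equiv.sumAssoc _ _ _ (Sum.map e id u)) =
      Equiv.sumAssoc _ _ _ (Sum.map d id v)) :
    Sum.elim (Sum.elim a b ∘ e) c u = Sum.elim (Sum.elim a c ∘ d) b v := by
  have h1 : Sum.elim (Sum.elim a b ∘ e) c u = Sum.elim a (Sum.elim c b)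
      (Sum.map id Sum.swap (Equiv.sumAssoc _ _ _ (Sum.map e id u))) := by
    rcases u with u | u
    · rcases h : e u with b | b <;> simp [h]
    · simp
  rw [h1, h]
  rcases v with v | v
  · rcases h : d v with b | b <;> simp [h]
  · simp

theorem elim_comm_out {α : Type*} {n m s k k' : ℕ} {a : Fin n → α} {b : Fin m → α} {c : Fin s → α}
    {e : Fin k → Fin n ⊕ Fin s} {d : Fin k' → Fin m ⊕ Fin s} {u : Fin m ⊕ Fin k}
    {v : Fin n ⊕ Fin k'}
    (h : (Equiv.sumAssoc _ _ _).symm (Sum.map id e u) =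
      Sum.map Sum.swap id ((Equiv.sumAssoc _ _ _).symm (Sum.map id d v))) :
    Sum.elim b (Sum.elim a c ∘ e) u = Sum.elim a (Sum.elim b c ∘ d) v := by
  have h1 : Sum.elim b (Sum.elim a c ∘ e) u = Sum.elim (Sum.elim b a) c
      ((Equiv.sumAssoc _ _ _).symm (Sum.map id e u)) := by
    rcases u with u | u
    · simp
    · rcases h : e u with b | b <;> simp [h]
  rw [h1, h]
  rcases v with v | v
  · simp
  · rcases h : d v with b | b <;> simp [h]

/-- The dioperad freely generated by the vertices of the directed tree `G`: colors are the edges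
of `G`, operations are subtrees with total orderings of their inputs and outputs, and composition
is the union of subtrees. -/
def freeDi (G : DTree.{u}) : Dioperad.{u} where
  Color := G.Edge
  Op := FreeOp G
  inp p := p.inp
  out p := p.out
  act σ τ p :=
    { sub := p.sub
      inp := p.inp ∘ σ
      out := p.out ∘ τ
      enum_inp := ⟨p.enum_inp.1.comp σ.injective, by
        rw [σ.surjective.range_comp, p.enum_inp.2]⟩
      enum_out := ⟨p.enum_out.1.comp τ.injective, by
        rw [τ.surjective.range_comp, p.enum_out.2]⟩ }
  ident e :=
    { sub := G.edgeSub e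
      inp := ![e]
      out := ![e]
      enum_inp := ⟨Function.injective_of_subsingleton _, by rw [inputs_edgeSub]; simp⟩
      enum_out := ⟨Function.injective_of_subsingleton _, by rw [outputs_edgeSub]; simp⟩ }
  comp p i q j e e' he he' h :=
    { sub := p.sub.union q.sub (FreeOp.overlap h)
      inp := Sum.elim p.inp q.inp ∘ e
      out := Sum.elim p.out q.out ∘ e'
      enum_inp := by
        have h1 := p.inp_mem i
        have h2 := FreeOp.inv_inp_mem h
        refine enumerates_sum (s' := {p.inp i}ᶜ) (t' := Set.univ) p.enum_inp q.enum_inp he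
          ?_ ?_ ?_ ?_
        · intro a
          simp [p.enum_inp.1.eq_iff]
        · intro a
          simp
        · intro x hx hxi hx' _
          rw [mem_inputs_iff] at hx hx'
          exact Subtree.boundary_disjoint G.isTree h1 h2 hx (fun h => hxi (bwd_injective h)) hx'
            (fwd_ne_bwd _ _).symm
        · intro x
          rw [mem_inputs_iff, mem_inputs_iff, mem_inputs_iff,
            Subtree.mem_boundary_union G.isTree h1 h2, bwd_injective.ne_iff, inv_bwd]
          simp [(fwd_ne_bwd (p.inp i) x).symm]
      enum_out := by
        have h1 := p.inp_mem i
        have h2 := FreeOp.inv_inp_mem h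
        refine enumerates_sum (s' := Set.univ) (t' := {q.out j}ᶜ) p.enum_out q.enum_out he'
          ?_ ?_ ?_ ?_
        · intro a
          simp
        · intro a
          simp [q.enum_out.1.eq_iff]
        · intro x hx _ hx' hxj
          rw [mem_outputs_iff] at hx hx'
          rw [← h] at hxj
          exact Subtree.boundary_disjoint G.isTree h1 h2 hx (fwd_ne_bwd _ _) hx'
            (fun h => hxj (fwd_injective h))
        · intro x
          rw [mem_outputs_iff, mem_outputs_iff, mem_outputs_iff,
            Subtree.mem_boundary_union G.isTree h1 h2, inv_bwd, fwd_injective.ne_iff, h]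
          simp [fwd_ne_bwd x] }
  inp_act _ _ _ := rfl
  out_act _ _ _ := rfl
  inp_ident _ := rfl
  out_ident _ := rfl
  inp_comp _ _ _ _ _ _ _ _ _ := rfl
  out_comp _ _ _ _ _ _ _ _ _ := rfl
  act_one _ := rfl
  act_act _ _ _ _ _ := rfl
  act_comp _ _ _ _ _ _ _ _ _ _ _ _ _ := rfl
  comp_act p i q j e e' σ τ σ' τ' he he' h hσ hτ h' := by
    apply FreeOp.ext
    · rfl
    · funext w
      simp only [Function.comp_apply]
      rcases e w with a | a <;> rfl
    · funext w
      simp only [Function.comp_apply]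
      rcases e' w with a | a <;> rfl
  ident_comp c q j e e' he he' h σ τ hσ hτ := by
    have hc : c = q.out j := h
    apply FreeOp.ext
    · have hm : G.fwd c ∈ q.sub.arcs := hc ▸ (q.out_mem j).1
      have ho : q.sub.Overlap (G.edgeSub c) := Or.inl ⟨G.fwd c, hm, Or.inl rfl⟩
      exact (Subtree.union_comm _ _ (FreeOp.overlap h) ho).trans (Subtree.union_edge _ _ hm ho)
    · funext w
      simp [hσ]
    · funext w
      simp only [Function.comp_apply, hτ]
      split_ifs with hw
      · rw [hw]; exact hc
      · rfl
  comp_ident p i c e e' he he' h σ τ hσ hτ := by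
    have hc : p.inp i = c := h
    apply FreeOp.ext
    · refine Subtree.union_edge _ _ ?_ (FreeOp.overlap h)
      have h1 := p.sub.inv_mem (p.inp_mem i).1
      rwa [inv_bwd, hc] at h1
    · funext w
      simp only [Function.comp_apply, hσ]
      split_ifs with hw
      · rw [hw]; exact hc.symm
      · rfl
    · funext w
      simp [hτ]
  comp_assoc p q r i j y l e e' x ε ε' d d' z δ δ' he he' hε hε' hd hd' hδ hδ' h₁ h₂ h₃ h₄ hx hz
      hw hw' := by
    apply FreeOp.ext
    · exact Subtree.union_assoc _ _ _ (FreeOp.overlap h₁) (FreeOp.overlap h₂) (FreeOp.overlap h₃)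
        (FreeOp.overlap h₄)
    · exact funext fun w => elim_assoc (hw w)
    · exact funext fun w => elim_assoc (hw' w)
  comp_comm_inp p q r i y j l e e' x ε ε' d d' z δ δ' he he' hε hε' hd hd' hδ hδ' h₁ h₂ h₃ h₄ hx hz
      hw hw' := by
    apply FreeOp.ext
    · exact Subtree.union_right_comm _ _ _ (FreeOp.overlap h₁) (FreeOp.overlap h₂)
        (FreeOp.overlap h₃) (FreeOp.overlap h₄)
    · exact funext fun w => elim_comm_inp (hw w)
    · exact funext fun w => elim_comm_inp (hw' w)
  comp_comm_out p q r i y j l e e' x ε ε' d d' z δ δ' he he' hε hε' hd hd' hδ hδ' h₁ h₂ h₃ h₄ hx hz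
      hw hw' := by
    apply FreeOp.ext
    · exact Subtree.union_left_comm _ _ _ (FreeOp.overlap h₁) (FreeOp.overlap h₂)
        (FreeOp.overlap h₃) (FreeOp.overlap h₄)
    · exact funext fun w => elim_comm_out (hw w)
    · exact funext fun w => elim_comm_out (hw' w)

/-- The functor `O₀ ⥤ DiOp`. -/
def freeDiFunctor : DTree.{u} ⥤ Dioperad.{u} where
  obj := freeDi
  map {G G'} φ :=
    { onColor := Hom.onEdge φ
      onOp := fun {n m} p =>
        { sub := Hom.onSub φ p.sub
          inp := Hom.onEdge φ ∘ p.inp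
          out := Hom.onEdge φ ∘ p.out
          enum_inp := by
            have hb := Hom.inputs_compat φ p.sub
            have hm : ∀ x, p.inp x ∈ inputs p.sub := fun x => p.enum_inp.2 ▸ Set.mem_range_self x
            refine ⟨fun x y h => p.enum_inp.1 (hb.injOn (hm x) (hm y) h), ?_⟩
            rw [Set.range_comp, p.enum_inp.2, hb.image_eq]
          enum_out := by
            have hb := Hom.outputs_compat φ p.sub
            have hm : ∀ x, p.out x ∈ outputs p.sub := fun x => p.enum_out.2 ▸ Set.mem_range_self x
            refine ⟨fun x y h => p.enum_out.1 (hb.injOn (hm x) (hm y) h), ?_⟩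
            rw [Set.range_comp, p.enum_out.2, hb.image_eq] }
      map_inp := fun _ => rfl
      map_out := fun _ => rfl
      map_act := fun _ _ _ => rfl
      map_ident := fun e => by
        apply FreeOp.ext
        · exact Hom.map_edge φ e
        · funext x
          fin_cases x
          rfl
        · funext x
          fin_cases x
          rfl
      map_comp := fun p i q j e e' he he' h h' => by
        apply FreeOp.ext
        · exact (Hom.map_union φ _ _ (FreeOp.overlap h)).2
        · funext w
          change Hom.onEdge φ (Sum.elim p.inp q.inp (e w)) =
            Sum.elim (Hom.onEdge φ ∘ p.inp) (Hom.onEdge φ ∘ q.inp) (e w)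
          rcases e w with a | a <;> rfl
        · funext w
          change Hom.onEdge φ (Sum.elim p.out q.out (e' w)) =
            Sum.elim (Hom.onEdge φ ∘ p.out) (Hom.onEdge φ ∘ q.out) (e' w)
          rcases e' w with a | a <;> rfl }
  map_id _ := rfl
  map_comp _ _ := rfl

end DTree

/-- The nerve functor from dioperads to `O₀`-presheaves, `N P = DiOp(D(-), P)`. -/
def Dioperad.nerve : Dioperad.{u} ⥤ (DTree.{u}ᵒᵖ ⥤ Type u) where
  obj P := DTree.freeDiFunctor.op ⋙ yoneda.obj P
  map f := Functor.whiskerLeft DTree.freeDiFunctor.op (yoneda.map f)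

namespace UGraph

/-- An isomorphism of undirected graphs. -/
structure Iso (G G' : UGraph.{u}) where
  arc : G.Arc ≃ G'.Arc
  vert : G.Vert ≃ G'.Vert
  map_inv : ∀ a, arc (G.inv a) = G'.inv (arc a)
  map_t : ∀ a, G'.t (arc a) = (G.t a).map vert

namespace Iso

variable {G G' : UGraph.{u}} (e : Iso G G')

theorem t_eq_some_iff (a : G.Arc) (v : G.Vert) :
    G'.t (e.arc a) = some (e.vert v) ↔ G.t a = some v := by
  rw [e.map_t]
  constructor
  · intro h
    obtain ⟨w, hw, hw'⟩ := Option.map_eq_some_iff.1 h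
    rwa [← e.vert.injective hw']
  · intro h
    rw [h]
    rfl

/-- The inverse isomorphism. -/
def symm : Iso G' G where
  arc := e.arc.symm
  vert := e.vert.symm
  map_inv a := by
    rw [Equiv.symm_apply_eq, e.map_inv, Equiv.apply_symm_apply]
  map_t a := by
    obtain ⟨b, rfl⟩ := e.arc.surjective a
    rw [e.map_t, Equiv.symm_apply_apply, Option.map_map]
    simp

theorem symm_map_inv (a : G'.Arc) : e.arc.symm (G'.inv a) = G.inv (e.arc.symm a) :=
  e.symm.map_inv a

/-- The induced isomorphism of geometric realizations. -/
def realization : G.realization ≃g G'.realization where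
  toEquiv := Equiv.sumCongr e.arc e.vert
  map_rel_iff' := by
    rintro (a | v) (b | w)
    · change e.arc b = G'.inv (e.arc a) ↔ b = G.inv a
      rw [← e.map_inv, e.arc.apply_eq_iff_eq]
    · exact e.t_eq_some_iff a w
    · exact e.t_eq_some_iff b v
    · exact Iff.rfl

/-- The image of a subtree under an isomorphism. -/
def mapSub (S : Subtree G) : Subtree G' where
  arcs := {a | e.arc.symm a ∈ S.arcs}
  verts := {v | e.vert.symm v ∈ S.verts}
  inv_mem {a} h := by
    have h' := S.inv_mem h
    rwa [← e.symm_map_inv] at h'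
  nbhd_mem {a v} hv h := by
    refine S.nbhd_mem hv ?_
    rw [← e.t_eq_some_iff]
    simpa using h
  connected := by
    refine (SimpleGraph.Iso.connected_iff (e.realization.induce ?_)).1 S.connected
    refine ⟨?_, e.realization.injective.injOn, ?_⟩
    · rintro (a | v) h
      · simpa [realization] using h
      · simpa [realization] using h
    · rintro (a | v) h
      · exact ⟨Sum.inl (e.arc.symm a), h, by simp [realization]⟩
      · exact ⟨Sum.inr (e.vert.symm v), h, by simp [realization]⟩

theorem mapSub_boundary (S : Subtree G) :
    (e.mapSub S).boundary = {a | e.arc.symm a ∈ S.boundary} := by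
  ext a
  obtain ⟨a, rfl⟩ := e.arc.surjective a
  refine and_congr Iff.rfl ⟨fun h v hv hav => ?_, fun h v hv hav => ?_⟩
  · rw [Equiv.symm_apply_apply] at hav
    exact h (e.vert v) (by simpa [mapSub] using hv) ((e.t_eq_some_iff a v).2 hav)
  · obtain ⟨v, rfl⟩ := e.vert.surjective v
    rw [e.t_eq_some_iff] at hav
    exact h v (by simpa [mapSub] using hv) (by simpa using hav)

theorem mapSub_star (v : G.Vert) :
    e.mapSub (Subtree.star G v) = Subtree.star G' (e.vert v) := by
  ext x
  · obtain ⟨a, rfl⟩ := e.arc.surjective x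
    simp [mapSub, Subtree.star, ← e.map_inv, e.t_eq_some_iff]
  · obtain ⟨a, rfl⟩ := e.vert.surjective x
    simp [mapSub, Subtree.star]

end Iso

end UGraph

namespace UTree

open UGraph

variable {G G' : UTree.{u}}

/-- The map of trees given by an isomorphism of graphs. -/
def homOfIso (e : UGraph.Iso G.toUGraph G'.toUGraph) : G ⟶ G' where
  onArc := e.arc
  onSub := e.mapSub
  map_inv := e.map_inv
  boundary_compat S := by
    rw [e.mapSub_boundary]
    refine ⟨fun a ha => ?_, e.arc.injective.injOn, fun a ha => ⟨e.arc.symm a, ha, ?_⟩⟩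
    · simpa using ha
    · simp
  map_union S T h := by
    refine ⟨?_, rfl⟩
    rcases h with ⟨a, h⟩ | ⟨v, h⟩
    · exact Or.inl ⟨e.arc a, by simpa [Iso.mapSub] using h⟩
    · exact Or.inr ⟨e.vert v, by simpa [Iso.mapSub] using h⟩

/-- The isomorphism of trees given by an isomorphism of graphs. -/
def isoOfIso (e : UGraph.Iso G.toUGraph G'.toUGraph) : G ≅ G' where
  hom := homOfIso e
  inv := homOfIso e.symm
  hom_inv_id := by
    apply Hom.ext
    · funext a
      exact e.arc.symm_apply_apply a
    · funext S
      refine Subtree.ext ?_ ?_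
      · ext a
        change e.arc.symm (e.arc a) ∈ S.arcs ↔ a ∈ S.arcs
        rw [Equiv.symm_apply_apply]
      · ext a
        change e.vert.symm (e.vert a) ∈ S.verts ↔ a ∈ S.verts
        rw [Equiv.symm_apply_apply]
  inv_hom_id := by
    apply Hom.ext
    · funext a
      exact e.arc.apply_symm_apply a
    · funext S
      refine Subtree.ext ?_ ?_
      · ext a
        change e.arc (e.arc.symm a) ∈ S.arcs ↔ a ∈ S.arcs
        rw [Equiv.apply_symm_apply]
      · ext a
        change e.vert (e.vert.symm a) ∈ S.verts ↔ a ∈ S.verts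
        rw [Equiv.apply_symm_apply]

theorem isInert_homOfIso (e : UGraph.Iso G.toUGraph G'.toUGraph) : IsInert (homOfIso e) :=
  fun v => ⟨e.vert v, e.mapSub_star v⟩

theorem IsInert.comp {G'' : UTree.{u}} {φ : G ⟶ G'} {ψ : G' ⟶ G''} (hφ : IsInert φ)
    (hψ : IsInert ψ) : IsInert (φ ≫ ψ) := fun v => by
  obtain ⟨w, hw⟩ := hφ v
  obtain ⟨x, hx⟩ := hψ w
  refine ⟨x, ?_⟩
  change Hom.onSub ψ (Hom.onSub φ _) = _
  rw [hw, hx]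

theorem isElementary_of_iso (e : UGraph.Iso G.toUGraph G'.toUGraph) (h : G.IsElementary) :
    G'.IsElementary := by
  have key : ∀ a, e.arc a ∈ G'.D ↔ a ∈ G.D := fun a => by
    simp [UGraph.D, e.map_t]
  intro a ha ha'
  obtain ⟨a, rfl⟩ := e.arc.surjective a
  rw [← e.map_inv, key] at ha'
  exact h a ((key a).1 ha) ha'

/-- Every arc of an oriented tree is positive or opposite to a positive arc. -/
def orientEquiv (H : UTree.{u}) (χ : H.Arc → Bool) (hχ : ∀ a, χ (H.inv a) = !χ a) :
    {a // χ a = true} ⊕ {a // χ a = true} ≃ H.Arc where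
  toFun := Sum.elim (fun e => e.1) (fun e => H.inv e.1)
  invFun a := if h : χ a = true then Sum.inl ⟨a, h⟩ else
    Sum.inr ⟨H.inv a, by simpa [hχ] using h⟩
  left_inv := by
    rintro (⟨a, ha⟩ | ⟨a, ha⟩)
    · exact dif_pos ha
    · refine (dif_neg (by simp [ha, hχ])).trans (congrArg Sum.inr (Subtype.ext ?_))
      exact H.inv_inv a
  right_inv a := by
    by_cases h : χ a = true
    · exact congrArg (Sum.elim _ _) (dif_pos h)
    · exact (congrArg (Sum.elim _ _) (dif_neg h)).trans (H.inv_inv a)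

/-- The directed graph with edges the arcs `a` with `χ a`. -/
def orientGraph (H : UTree.{u}) (χ : H.Arc → Bool) : DGraph.{u} where
  Edge := {a : H.Arc // χ a = true}
  Vert := H.Vert
  finite_edge := by
    have := H.finite_arc
    infer_instance
  finite_vert := H.finite_vert
  tgt e := H.t e.1
  src e := H.t (H.inv e.1)

/-- An oriented tree is isomorphic to the underlying graph of its directed graph. -/
def orientIso (H : UTree.{u}) (χ : H.Arc → Bool) (hχ : ∀ a, χ (H.inv a) = !χ a) :
    UGraph.Iso (H.orientGraph χ).toUGraph H.toUGraph where
  arc := H.orientEquiv χ hχ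
  vert := Equiv.refl _
  map_inv := by
    rintro (⟨a, ha⟩ | ⟨a, ha⟩)
    · rfl
    · exact (H.inv_inv a).symm
  map_t := by
    rintro (⟨a, ha⟩ | ⟨a, ha⟩)
    · exact Option.map_id'.symm ▸ rfl
    · exact Option.map_id'.symm ▸ rfl

/-- The directed tree given by an oriented tree. -/
def orient (H : UTree.{u}) (χ : H.Arc → Bool) (hχ : ∀ a, χ (H.inv a) = !χ a) : DTree.{u} where
  toDGraph := H.orientGraph χ
  isTree := (H.orientIso χ hχ).realization.isTree_iff.2 H.isTree

end UTree

namespace DTree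

open UGraph DGraph

/-- The underlying undirected tree. -/
abbrev undirObj (G : DTree.{u}) : UTree.{u} := ⟨G.toUGraph, G.isTree⟩

theorem mem_boundary_iff {G : DGraph.{u}} (S : Subtree G.toUGraph) (a : G.Edge ⊕ G.Edge) :
    (show G.toUGraph.Arc from a) ∈ S.boundary ↔
      Sum.elim (· ∈ outputs S) (· ∈ inputs S) a := by
  rcases a with e | e
  · exact (mem_outputs_iff S e).symm
  · exact (mem_inputs_iff S e).symm

/-- The functor sending a directed tree to its underlying undirected tree. -/
def undir : DTree.{u} ⥤ UTree.{u} where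
  obj := undirObj
  map φ :=
    { onArc := Sum.map (Hom.onEdge φ) (Hom.onEdge φ)
      onSub := Hom.onSub φ
      map_inv := by rintro (e | e) <;> rfl
      boundary_compat := fun S => by
        have hi := Hom.inputs_compat φ S
        have ho := Hom.outputs_compat φ S
        refine ⟨?_, ?_, ?_⟩
        · rintro (e | e) h
          · exact ho.mapsTo h
          · rw [mem_boundary_iff] at h ⊢
            exact hi.mapsTo h
        · rintro (e | e) h (e' | e') h' he
          · exact congrArg Sum.inl (ho.injOn h h' (Sum.inl_injective he))
          · cases he
          · cases he
          · rw [mem_boundary_iff] at h h'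
            exact congrArg Sum.inr (hi.injOn h h' (Sum.inr_injective he))
        · rintro (e | e) h
          · obtain ⟨e', he', rfl⟩ := ho.surjOn h
            exact ⟨Sum.inl e', he', rfl⟩
          · rw [mem_boundary_iff] at h
            obtain ⟨e', he', rfl⟩ := hi.surjOn h
            exact ⟨Sum.inr e', (mem_boundary_iff _ _).2 he', rfl⟩
      map_union := Hom.map_union φ }
  map_id G := by
    apply UTree.Hom.ext
    · exact Sum.map_id_id
    · rfl
  map_comp φ ψ := by
    apply UTree.Hom.ext
    · funext a
      rcases a with a | a <;> rfl
    · rfl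

/-- The direction of the arcs of a directed tree. -/
def isFwd (G : DTree.{u}) (a : G.Edge ⊕ G.Edge) : Bool := a.isLeft

theorem isInert_undir_iff {G G' : DTree.{u}} (φ : G ⟶ G') :
    UTree.IsInert (undir.map φ) ↔ IsInert φ := Iff.rfl

theorem isElementary_undir_iff {G : DTree.{u}} :
    (undir.obj G).IsElementary ↔ G.IsElementary := by
  constructor
  · intro h e
    by_contra! he
    exact h (Sum.inl e) (Option.isSome_iff_ne_none.2 he.1) (Option.isSome_iff_ne_none.2 he.2)
  · rintro h (e | e) he he'
    · exact (h e).elim (Option.isSome_iff_ne_none.1 he) (Option.isSome_iff_ne_none.1 he')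
    · exact (h e).elim (Option.isSome_iff_ne_none.1 he') (Option.isSome_iff_ne_none.1 he)

end DTree

namespace AugCyclicOperad

/-- The augmented cyclic operad with two opposite colors, `true` for outgoing and `false` for
incoming, and exactly one operation for each list of colors. -/
def direction : AugCyclicOperad.{u} where
  Color := ULift Bool
  inv c := ⟨!c.down⟩
  inv_inv c := by simp
  Op n := Fin n → ULift Bool
  bdry p := p
  act σ p := p ∘ σ
  ident c := ![⟨!c.down⟩, c]
  comp p _ q _ e _ _ := Sum.elim p q ∘ e
  bdry_act _ _ := rfl
  bdry_ident _ := rfl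
  bdry_comp _ _ _ _ _ _ _ := rfl
  act_one _ := rfl
  act_act _ _ _ := rfl
  act_ident c := by
    funext i
    fin_cases i <;> simp
  act_comp _ _ _ _ _ _ _ _ _ := rfl
  comp_act p i q j e σ he h he' h' := by
    funext w
    simp only [Function.comp_apply]
    rcases e w with a | a <;> rfl
  comp_comm p i q j e he h he' h' := by
    funext w
    simp only [Function.comp_apply]
    rcases e w with a | a <;> rfl
  comp_ident p i c e he h σ hσ := by
    funext w
    simp only [Function.comp_apply, hσ]
    have hi : p i = c := h.trans (by simp)
    split_ifs with hw
    · simp [hw, hi]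
    · rfl
  comp_assoc p q r i j y l e x e' f z f' he he' hf hf' h₁ h₂ h₃ h₄ hx hz hw := by
    funext w
    exact DTree.elim_assoc (hw w)

theorem hom_direction_ext {Q : AugCyclicOperad.{u}} {F F' : Q ⟶ direction.{u}}
    (h : ∀ c, Hom.onColor F c = Hom.onColor F' c) : F = F' := by
  refine Hom.ext (funext h) ?_
  have key : ∀ {n} (p : Q.Op n), Hom.onOp F p = Hom.onOp F' p := fun p =>
    (Hom.map_bdry F p).trans <| .trans (congrArg (· ∘ Q.bdry p) (funext h)) (Hom.map_bdry F' p).symm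
  funext n p
  exact key p

/-- A map to `direction` is a direction of the colors. -/
def toDirection (Q : AugCyclicOperad.{u}) (χ : Q.Color → Bool) (h : ∀ c, χ (Q.inv c) = !χ c) :
    Q ⟶ direction.{u} where
  onColor c := ⟨χ c⟩
  onOp p i := ⟨χ (Q.bdry p i)⟩
  map_inv c := congrArg ULift.up (h c)
  map_bdry _ := rfl
  map_act σ p := by
    funext i
    simp only [Q.bdry_act]
    rfl
  map_ident c := by
    funext i
    simp only [Q.bdry_ident]
    fin_cases i
    · exact congrArg ULift.up (h c)
    · rfl
  map_comp p i q j e he hh h' := by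
    funext w
    simp only [Q.bdry_comp]
    change _ = Sum.elim (fun i => (⟨χ (Q.bdry p i)⟩ : ULift Bool))
      (fun i => (⟨χ (Q.bdry q i)⟩ : ULift Bool)) (e w)
    simp only [Function.comp_apply]
    rcases e w with a | a <;> rfl

/-- The direction of the colors given by a map to `direction`. -/
def dir {Q : AugCyclicOperad.{u}} (F : Q ⟶ direction.{u}) (c : Q.Color) : Bool :=
  (Hom.onColor F c).down

theorem dir_inv {Q : AugCyclicOperad.{u}} (F : Q ⟶ direction.{u}) (c : Q.Color) :
    dir F (Q.inv c) = !dir F c :=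
  congrArg ULift.down (Hom.map_inv F c)

end AugCyclicOperad

namespace DTree

open UGraph DGraph AugCyclicOperad Opposite

/-- The canonical direction of the arcs of a directed tree. -/
def direction (G : DTree.{u}) :
    UTree.freeCycFunctor.obj (undir.obj G) ⟶ AugCyclicOperad.direction.{u} :=
  toDirection (UTree.freeCyc (undir.obj G)) G.isFwd (by rintro (e | e) <;> rfl)

theorem direction_naturality {G G' : DTree.{u}} (φ : G ⟶ G') :
    UTree.freeCycFunctor.map (undir.map φ) ≫ G'.direction = G.direction := by
  apply hom_direction_ext
  rintro (e | e) <;> rfl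

/-- The functor `undir` is full on maps which preserve directions. -/
theorem exists_undir_map_eq {G G' : DTree.{u}} (ψ : undir.obj G ⟶ undir.obj G')
    (h : UTree.freeCycFunctor.map ψ ≫ G'.direction = G.direction) :
    ∃ φ : G ⟶ G', undir.map φ = ψ := by
  have h1 : ∀ a, G'.isFwd (UTree.Hom.onArc ψ a) = G.isFwd a := fun a =>
    congrArg ULift.down (congrFun (congrArg Hom.onColor h) a)
  have hf : ∀ e : G.Edge, ∃ e' : G'.Edge, UTree.Hom.onArc ψ (G.fwd e) = G'.fwd e' := fun e =>
    Sum.isLeft_iff.1 (h1 (Sum.inl e))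
  choose f hf using hf
  have hb : ∀ e : G.Edge, UTree.Hom.onArc ψ (G.bwd e) = G'.bwd (f e) := fun e => by
    rw [← inv_fwd, ← inv_fwd, ← hf]
    exact UTree.Hom.map_inv ψ _
  refine ⟨⟨f, UTree.Hom.onSub ψ, fun S => ?_, fun S => ?_, UTree.Hom.map_union ψ⟩, ?_⟩
  · have hS := UTree.Hom.boundary_compat ψ S
    refine ⟨fun e he => ?_, fun e he e' he' hee => ?_, fun e he => ?_⟩
    · refine (mem_inputs_iff _ _).2 ?_
      rw [← hb]
      exact hS.mapsTo ((mem_inputs_iff _ _).1 he)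
    · rw [mem_inputs_iff] at he he'
      apply bwd_injective
      apply hS.injOn he he'
      rw [hb, hb, hee]
    · obtain ⟨a | a, ha, hae⟩ := hS.surjOn ((mem_inputs_iff _ _).1 he)
      · rw [show UTree.Hom.onArc ψ (Sum.inl a) = _ from hf a] at hae
        exact absurd hae (fwd_ne_bwd _ _)
      · refine ⟨a, (mem_inputs_iff _ _).2 ha, bwd_injective ?_⟩
        rw [← hb]
        exact hae
  · have hS := UTree.Hom.boundary_compat ψ S
    refine ⟨fun e he => ?_, fun e he e' he' hee => ?_, fun e he => ?_⟩
    · refine (mem_outputs_iff _ _).2 ?_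
      rw [← hf]
      exact hS.mapsTo ((mem_outputs_iff _ _).1 he)
    · rw [mem_outputs_iff] at he he'
      apply fwd_injective
      apply hS.injOn he he'
      rw [hf, hf, hee]
    · obtain ⟨a | a, ha, hae⟩ := hS.surjOn ((mem_outputs_iff _ _).1 he)
      · refine ⟨a, (mem_outputs_iff _ _).2 ha, fwd_injective ?_⟩
        rw [← hf]
        exact hae
      · rw [show UTree.Hom.onArc ψ (Sum.inr a) = _ from hb a] at hae
        exact absurd hae.symm (fwd_ne_bwd _ _)
  · apply UTree.Hom.ext
    · funext a
      rcases a with e | e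
      · exact (hf e).symm
      · exact (hb e).symm
    · rfl

instance : undir.{u}.Faithful where
  map_injective {G G' φ φ'} h := by
    have h1 := congrArg UTree.Hom.onArc h
    have h2 := congrArg UTree.Hom.onSub h
    refine Hom.ext (funext fun e => ?_) h2
    exact Sum.inl_injective (congrFun h1 (Sum.inl e))

/-- Every directed undirected tree is isomorphic to a directed tree. -/
theorem exists_orient (H : UTree.{u})
    (F : UTree.freeCycFunctor.obj H ⟶ AugCyclicOperad.direction.{u}) :
    ∃ (G : DTree.{u}) (i : undir.obj G ≅ H), UTree.IsInert i.hom ∧ UTree.IsInert i.inv ∧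
      (H.IsElementary → G.IsElementary) ∧ UTree.freeCycFunctor.map i.hom ≫ F = G.direction := by
  let e := H.orientIso (dir F) (dir_inv F)
  let G := H.orient (dir F) (dir_inv F)
  refine ⟨G, UTree.isoOfIso (G := undir.obj G) e, UTree.isInert_homOfIso (G := undir.obj G) e,
    UTree.isInert_homOfIso (G' := undir.obj G) e.symm, fun h => isElementary_undir_iff.1
    (UTree.isElementary_of_iso (G' := undir.obj G) e.symm h), ?_⟩
  apply hom_direction_ext
  rintro (⟨a, ha⟩ | ⟨a, ha⟩)
  · exact ULift.down_injective ha
  · refine ULift.down_injective ((dir_inv F a).trans ?_)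
    rw [ha]
    rfl

/-- The functor sending a directed tree to its underlying tree and the direction of its arcs. -/
def toCostructuredArrow :
    DTree.{u} ⥤ CostructuredArrow yoneda (AugCyclicOperad.nerve.obj AugCyclicOperad.direction.{u})
    where
  obj G := CostructuredArrow.mk (Y := undir.obj G) (yonedaEquiv.symm G.direction)
  map φ := CostructuredArrow.homMk (undir.map φ) (by
    rw [CostructuredArrow.mk_hom_eq_self, CostructuredArrow.mk_hom_eq_self]
    apply yonedaEquiv.injective
    rw [← yonedaEquiv_naturality]
    refine (congrArg _ (Equiv.apply_symm_apply yonedaEquiv _)).trans ?_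
    refine Eq.trans ?_ (Equiv.apply_symm_apply yonedaEquiv _).symm
    exact direction_naturality φ)

instance : toCostructuredArrow.{u}.Faithful where
  map_injective h := undir.map_injective (congrArg CommaMorphism.left h)

instance : toCostructuredArrow.{u}.Full where
  map_surjective {G G'} f := by
    have h := congrArg yonedaEquiv (CostructuredArrow.w f)
    rw [← yonedaEquiv_naturality] at h
    obtain ⟨φ, hφ⟩ := exists_undir_map_eq f.left (by
      have h1 : yonedaEquiv (toCostructuredArrow.obj G).hom = G.direction :=
        Equiv.apply_symm_apply _ _
      have h2 : yonedaEquiv (toCostructuredArrow.obj G').hom = G'.direction :=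
        Equiv.apply_symm_apply _ _
      rw [h1, h2] at h
      exact h)
    exact ⟨φ, CostructuredArrow.hom_ext _ _ hφ⟩

instance : toCostructuredArrow.{u}.EssSurj where
  mem_essImage s := by
    let F : UTree.freeCycFunctor.obj s.left ⟶ AugCyclicOperad.direction.{u} := yonedaEquiv s.hom
    obtain ⟨G, i, -, -, -, h⟩ := exists_orient s.left F
    refine ⟨G, ⟨CostructuredArrow.isoMk i ?_⟩⟩
    apply yonedaEquiv.injective
    rw [← yonedaEquiv_naturality]
    refine Eq.trans ?_ (Equiv.apply_symm_apply yonedaEquiv _).symm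
    exact h

instance : toCostructuredArrow.{u}.IsEquivalence where

/-- Presheaves on undirected trees over the nerve of `direction` are presheaves on directed
trees. -/
def fiberFunctor :
    Over (AugCyclicOperad.nerve.obj AugCyclicOperad.direction.{u}) ⥤ (DTree.{u}ᵒᵖ ⥤ Type u) :=
  (overEquivPresheafCostructuredArrow _).functor ⋙
    (Functor.whiskeringLeft _ _ _).obj toCostructuredArrow.op

instance : fiberFunctor.{u}.IsEquivalence := by
  unfold fiberFunctor
  infer_instance

end DTree

namespace UTree

theorem SegalLimit.map_eq {X : UTree.{u}ᵒᵖ ⥤ Type u} {G : UTree.{u}} (x : SegalLimit X G)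
    {K L : UTree.{u}} (g : L ⟶ K) (f : K ⟶ G) (f' : L ⟶ G) (hK : K.IsElementary)
    (hL : L.IsElementary) (hf : IsInert f) (hf' : IsInert f') (hg : IsInert g) (h : g ≫ f = f') :
    X.map g.op (x.1 K f hK hf) = x.1 L f' hL hf' := by
  subst h
  exact x.2 K L g f hK hL hf hf' hg

theorem segalMap_eq_iff {X : UTree.{u}ᵒᵖ ⥤ Type u} {G : UTree.{u}} (y : X.obj (Opposite.op G))
    (x : SegalLimit X G) :
    segalMap X G y = x ↔ ∀ K f hK hf, X.map f.op y = x.1 K f hK hf := by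
  constructor
  · rintro rfl K f hK hf
    rfl
  · intro h
    apply Subtype.ext
    funext K f hK hf
    exact h K f hK hf

end UTree

namespace DTree

open UGraph DGraph AugCyclicOperad Opposite

theorem SegalLimit.map_eq {X : DTree.{u}ᵒᵖ ⥤ Type u} {G : DTree.{u}} (x : SegalLimit X G)
    {K L : DTree.{u}} (g : L ⟶ K) (f : K ⟶ G) (f' : L ⟶ G) (hK : K.IsElementary)
    (hL : L.IsElementary) (hf : IsInert f) (hf' : IsInert f') (hg : IsInert g) (h : g ≫ f = f') :
    X.map g.op (x.1 K f hK hf) = x.1 L f' hL hf' := by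
  subst h
  exact x.2 K L g f hK hL hf hf' hg

theorem segalMap_eq_iff {X : DTree.{u}ᵒᵖ ⥤ Type u} {G : DTree.{u}} (y : X.obj (Opposite.op G))
    (x : SegalLimit X G) :
    segalMap X G y = x ↔ ∀ K f hK hf, X.map f.op y = x.1 K f hK hf := by
  constructor
  · rintro rfl K f hK hf
    rfl
  · intro h
    apply Subtype.ext
    funext K f hK hf
    exact h K f hK hf

instance : ObjectProperty.IsClosedUnderIsomorphisms IsSegal.{u} where
  of_iso {X Y} e hX G := by
    have key : ∀ {K L : DTree.{u}} (f : K ⟶ L) (x : X.obj (op L)),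
        Y.map f.op (e.hom.app _ x) = e.hom.app _ (X.map f.op x) := fun f x =>
      (NatTrans.naturality_apply e.hom f.op x).symm
    have key' : ∀ {K L : DTree.{u}} (f : K ⟶ L) (x : Y.obj (op L)),
        X.map f.op (e.inv.app _ x) = e.inv.app _ (Y.map f.op x) := fun f x =>
      (NatTrans.naturality_apply e.inv f.op x).symm
    have h1 : ∀ {K : DTree.{u}} (x : Y.obj (op K)), e.hom.app _ (e.inv.app _ x) = x :=
      fun x => by simp
    have h2 : ∀ {K : DTree.{u}} (x : X.obj (op K)), e.inv.app _ (e.hom.app _ x) = x :=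
      fun x => by simp
    constructor
    · intro y y' h
      replace h := (segalMap_eq_iff _ _).1 h
      have h3 : e.inv.app _ y = e.inv.app _ y' := by
        apply (hX G).1
        refine (segalMap_eq_iff _ _).2 ?_
        intro K f hK hf
        change _ = X.map f.op _
        rw [key', key', h K f hK hf]
        rfl
      rw [← h1 y, h3, h1]
    · intro y
      obtain ⟨x, hx⟩ := (hX G).2 ⟨fun K f hK hf => e.inv.app _ (y.1 K f hK hf),
        fun K L g f hK hL hf hgf hg => by
          rw [key', y.map_eq g f _ hK hL hf hgf hg rfl]⟩
      replace hx : ∀ K f hK hf, X.map f.op x = e.inv.app _ (y.1 K f hK hf) :=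
        (segalMap_eq_iff _ _).1 hx
      refine ⟨e.hom.app _ x, ?_⟩
      refine (segalMap_eq_iff _ _).2 ?_
      intro K f hK hf
      rw [key, hx K f hK hf, h1]

/-- Maps to the underlying tree of a directed tree lift, up to an inert isomorphism. -/
theorem exists_lift (G : DTree.{u}) {L : UTree.{u}} (f : L ⟶ undir.obj G) :
    ∃ (K : DTree.{u}) (i : undir.obj K ≅ L) (φ : K ⟶ G), UTree.IsInert i.hom ∧
      UTree.IsInert i.inv ∧ (L.IsElementary → K.IsElementary) ∧ undir.map φ = i.hom ≫ f := by
  obtain ⟨K, i, hi, hi', hK, h⟩ := exists_orient L (UTree.freeCycFunctor.map f ≫ G.direction)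
  obtain ⟨φ, hφ⟩ := exists_undir_map_eq (i.hom ≫ f) (by rw [Functor.map_comp, Category.assoc, h])
  exact ⟨K, i, φ, hi, hi', hK, hφ⟩

/-- A directed tree map is determined by an undirected one over a common target. -/
theorem exists_undir_map_eq_of_comp {G G' G'' : DTree.{u}} (ψ : undir.obj G ⟶ undir.obj G')
    (φ' : G' ⟶ G'') (φ : G ⟶ G'') (h : ψ ≫ undir.map φ' = undir.map φ) :
    ∃ γ : G ⟶ G', undir.map γ = ψ ∧ γ ≫ φ' = φ := by
  obtain ⟨γ, hγ⟩ := exists_undir_map_eq ψ (by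
    rw [← direction_naturality φ', ← Category.assoc, ← Functor.map_comp, h, direction_naturality])
  exact ⟨γ, hγ, undir.map_injective (by rw [Functor.map_comp, hγ, h])⟩

section Fiber

variable (Y : Over (AugCyclicOperad.nerve.obj AugCyclicOperad.direction.{u}))

/-- The underlying element of an element of the fiber. -/
def fiberVal {G : DTree.{u}} (x : (fiberFunctor.obj Y).obj (op G)) :
    Y.left.obj (op (undir.obj G)) := x.1

variable {Y}

theorem fiberVal_injective {G : DTree.{u}} :
    Function.Injective (fiberVal Y (G := G)) := Subtype.val_injective

theorem app_fiberVal {G : DTree.{u}} (x : (fiberFunctor.obj Y).obj (op G)) :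
    Y.hom.app _ (fiberVal Y x) = G.direction :=
  x.2.app.trans (Equiv.apply_symm_apply yonedaEquiv _)

theorem exists_fiberVal_eq {G : DTree.{u}} (y : Y.left.obj (op (undir.obj G)))
    (h : Y.hom.app _ y = G.direction) : ∃ x, fiberVal Y (G := G) x = y :=
  have h' : yonedaEquiv (toCostructuredArrow.obj G).hom = G.direction :=
    Equiv.apply_symm_apply yonedaEquiv _
  ⟨⟨y, ⟨h.trans h'.symm⟩⟩, rfl⟩

theorem fiberVal_map {G G' : DTree.{u}} (φ : G ⟶ G') (x : (fiberFunctor.obj Y).obj (op G')) :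
    fiberVal Y ((fiberFunctor.obj Y).map φ.op x) = Y.left.map (undir.map φ).op (fiberVal Y x) :=
  rfl

theorem isSegal_fiber (hA : UTree.IsSegal (AugCyclicOperad.nerve.obj
    AugCyclicOperad.direction.{u})) (hY : UTree.IsSegal Y.left) :
    IsSegal (fiberFunctor.obj Y) := by
  have hmap : ∀ {K L M : UTree.{u}} (f : K ⟶ L) (g : L ⟶ M) (y : Y.left.obj (op M)),
      Y.left.map f.op (Y.left.map g.op y) = Y.left.map (f ≫ g).op y := fun f g y => by simp
  have hid : ∀ {K : UTree.{u}} (y : Y.left.obj (op K)), Y.left.map (𝟙 K).op y = y :=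
    fun y => by simp
  have hinj : ∀ {K L : UTree.{u}} (i : K ≅ L), Function.Injective (Y.left.map i.hom.op) :=
    fun i => Function.LeftInverse.injective (g := Y.left.map i.inv.op) fun y => by simp [hmap]
  intro G
  constructor
  · intro x x' h
    replace h := (segalMap_eq_iff _ _).1 h
    apply fiberVal_injective
    apply (hY _).1
    refine (UTree.segalMap_eq_iff _ _).2 ?_
    intro L f hL hf
    obtain ⟨K, i, φ, hi, -, hK, hφ⟩ := exists_lift G f
    have h1 := congrArg (fiberVal Y) (h K φ (hK hL)
      ((isInert_undir_iff φ).1 (hφ ▸ hi.comp hf)))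
    change fiberVal Y ((fiberFunctor.obj Y).map φ.op x) =
      fiberVal Y ((fiberFunctor.obj Y).map φ.op x') at h1
    rw [fiberVal_map, fiberVal_map, hφ, ← hmap, ← hmap] at h1
    exact hinj i h1
  · intro z
    choose lK li lφ hi hi' hlK hlφ using fun (L : UTree.{u}) (f : L ⟶ undir.obj G) =>
      exists_lift G f
    have hlf : ∀ L f, UTree.IsInert f → IsInert (lφ L f) := fun L f hf =>
      (isInert_undir_iff _).1 (hlφ L f ▸ (hi L f).comp hf)
    have key : ∀ (L : UTree.{u}) (f : L ⟶ undir.obj G) (hL : L.IsElementary)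
        (hf : UTree.IsInert f) (K : DTree.{u}) (φ : K ⟶ G) (hK : K.IsElementary) (hφ : IsInert φ)
        (g : L ⟶ undir.obj K), UTree.IsInert g → g ≫ undir.map φ = f →
        Y.left.map g.op (fiberVal Y (z.1 K φ hK hφ)) =
          Y.left.map (li L f).inv.op (fiberVal Y (z.1 _ (lφ L f) (hlK L f hL) (hlf L f hf))) := by
      intro L f hL hf K φ hK hφ g hg hgφ
      obtain ⟨γ, hγ, hγ'⟩ := exists_undir_map_eq_of_comp ((li L f).hom ≫ g) φ (lφ L f)
        (by rw [Category.assoc, hgφ, hlφ])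
      rw [← z.map_eq γ φ _ hK (hlK L f hL) hφ (hlf L f hf)
        ((isInert_undir_iff γ).1 (hγ ▸ (hi L f).comp hg)) hγ', fiberVal_map, hγ, hmap,
        Iso.inv_hom_id_assoc]
    obtain ⟨y, hy⟩ := (hY (undir.obj G)).2 ⟨fun L f hL hf =>
      Y.left.map (li L f).inv.op (fiberVal Y (z.1 _ (lφ L f) (hlK L f hL) (hlf L f hf))),
      fun L L' g f hL hL' hf hgf hg => by
        rw [hmap]
        refine key L' (g ≫ f) hL' hgf _ _ _ _ _ (hg.comp (hi' _ _)) ?_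
        rw [hlφ, Category.assoc, Iso.inv_hom_id_assoc]⟩
    replace hy : ∀ L f hL hf, Y.left.map f.op y = Y.left.map (li L f).inv.op
      (fiberVal Y (z.1 _ (lφ L f) (hlK L f hL) (hlf L f hf))) := (UTree.segalMap_eq_iff _ _).1 hy
    have hyd : Y.hom.app _ y = G.direction := by
      apply (hA _).1
      refine (UTree.segalMap_eq_iff _ _).2 ?_
      intro L f hL hf
      rw [← NatTrans.naturality_apply Y.hom f.op, hy L f hL hf,
        NatTrans.naturality_apply Y.hom, app_fiberVal, ← direction_naturality, hlφ]
      change UTree.freeCycFunctor.map (li L f).inv ≫ UTree.freeCycFunctor.map _ ≫ G.direction =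
        UTree.freeCycFunctor.map f ≫ G.direction
      rw [← Functor.map_comp_assoc, Iso.inv_hom_id_assoc]
    obtain ⟨x, rfl⟩ := exists_fiberVal_eq y hyd
    refine ⟨x, ?_⟩
    refine (segalMap_eq_iff _ _).2 ?_
    intro K φ hK hφ
    apply fiberVal_injective
    rw [fiberVal_map, hy _ _ (isElementary_undir_iff.2 hK) ((isInert_undir_iff φ).2 hφ)]
    refine (key (undir.obj K) (undir.map φ) (isElementary_undir_iff.2 hK)
      ((isInert_undir_iff φ).2 hφ) K φ hK hφ (𝟙 _) (fun v => ⟨v, rfl⟩)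
      (Category.id_comp _)).symm.trans (hid _)

theorem isSegal_of_fiber (hA : UTree.IsSegal (AugCyclicOperad.nerve.obj
    AugCyclicOperad.direction.{u})) (hY : IsSegal (fiberFunctor.obj Y)) :
    UTree.IsSegal Y.left := by
  have hmap : ∀ {K L M : UTree.{u}} (f : K ⟶ L) (g : L ⟶ M) (y : Y.left.obj (op M)),
      Y.left.map f.op (Y.left.map g.op y) = Y.left.map (f ≫ g).op y := fun f g y => by simp
  have hinj : ∀ {K L : UTree.{u}} (i : K ≅ L), Function.Injective (Y.left.map i.hom.op) :=
    fun i => Function.LeftInverse.injective (g := Y.left.map i.inv.op) fun y => by simp [hmap]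
  have hnat : ∀ {K L : UTree.{u}} (f : K ⟶ L) (y : Y.left.obj (op L)),
      Y.hom.app _ (Y.left.map f.op y) = UTree.freeCycFunctor.map f ≫ Y.hom.app _ y := fun f y =>
    NatTrans.naturality_apply Y.hom f.op y
  intro H
  constructor
  · intro y y' h
    replace h := (UTree.segalMap_eq_iff _ _).1 h
    have hd : Y.hom.app _ y = Y.hom.app _ y' := by
      apply (hA _).1
      refine (UTree.segalMap_eq_iff _ _).2 ?_
      intro K f hK hf
      refine (hnat f y).symm.trans ((congrArg _ (h K f hK hf)).trans (hnat f y'))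
    obtain ⟨G, i, hi, -, -, hG⟩ := exists_orient H (Y.hom.app _ y)
    obtain ⟨x, hx⟩ := exists_fiberVal_eq (Y := Y) (G := G) (Y.left.map i.hom.op y)
      ((hnat _ _).trans hG)
    obtain ⟨x', hx'⟩ := exists_fiberVal_eq (Y := Y) (G := G) (Y.left.map i.hom.op y')
      ((hnat _ _).trans (hd ▸ hG))
    have hxx : x = x' := by
      apply (hY G).1
      refine (segalMap_eq_iff _ _).2 ?_
      intro K φ hK hφ
      apply fiberVal_injective
      change _ = fiberVal Y ((fiberFunctor.obj Y).map φ.op x')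
      rw [fiberVal_map, fiberVal_map, hx, hx', hmap, hmap]
      exact h _ _ (isElementary_undir_iff.2 hK)
        (UTree.IsInert.comp ((isInert_undir_iff φ).2 hφ) hi)
    rw [hxx, hx'] at hx
    exact (hinj i hx).symm
  · intro w
    obtain ⟨F, hF⟩ := (hA H).2 ⟨fun L f hL hf => Y.hom.app _ (w.1 L f hL hf),
      fun L L' g f hL hL' hf hgf hg => by
        rw [← NatTrans.naturality_apply Y.hom g.op, w.map_eq g f _ hL hL' hf hgf hg rfl]⟩
    replace hF : ∀ L (f : L ⟶ H) hL hf, UTree.freeCycFunctor.map f ≫ F =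
      Y.hom.app _ (w.1 L f hL hf) := (UTree.segalMap_eq_iff _ _).1 hF
    obtain ⟨G, i, hi, hi', -, hG⟩ := exists_orient H F
    choose z hz using fun (K : DTree.{u}) (φ : K ⟶ G) (hK : K.IsElementary) (hφ : IsInert φ) =>
      exists_fiberVal_eq (Y := Y) (G := K) (w.1 _ (undir.map φ ≫ i.hom)
        (isElementary_undir_iff.2 hK) (UTree.IsInert.comp ((isInert_undir_iff φ).2 hφ) hi)) (by
          rw [← direction_naturality φ, ← hG]
          refine (hF _ _ _ _).symm.trans ?_
          rw [Functor.map_comp]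
          rfl)
    obtain ⟨x, hx⟩ := (hY G).2 ⟨z, fun K L g f hK hL hf hgf hg => by
      apply fiberVal_injective
      rw [fiberVal_map, hz, hz]
      exact w.map_eq _ _ _ _ _ _ _ ((isInert_undir_iff g).2 hg) (by simp)⟩
    replace hx : ∀ K φ hK hφ, (fiberFunctor.obj Y).map φ.op x = z K φ hK hφ :=
      (segalMap_eq_iff _ _).1 hx
    refine ⟨Y.left.map i.inv.op (fiberVal Y x), ?_⟩
    refine (UTree.segalMap_eq_iff _ _).2 ?_
    intro L f hL hf
    obtain ⟨K, k, φ, hk, -, hK, hφ⟩ := exists_lift G (f ≫ i.inv)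
    have hφi : IsInert φ := (isInert_undir_iff φ).1 (hφ ▸ hk.comp (hf.comp hi'))
    have h1 := congrArg (fiberVal Y) (hx K φ (hK hL) hφi)
    rw [fiberVal_map, hz, ← w.map_eq k.hom f _ hL (isElementary_undir_iff.2 (hK hL)) hf _ hk
      (by rw [hφ]; simp), hφ, ← hmap, ← hmap] at h1
    exact hinj k h1

end Fiber

end DTree

theorem enumerates_iff {k : ℕ} {α : Type*} {e : Fin k → α} {s : Set α} :
    Enumerates e s ↔ Function.Injective e ∧ ∀ x, (∃ w, e w = x) ↔ x ∈ s :=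
  and_congr_right fun _ => Set.ext_iff

/-- Reindexing an enumeration along bijections. -/
theorem Enumerates.equiv {k l : ℕ} {α β : Type*} {e : Fin k → α} {s : Set α} {e' : Fin l → β}
    {s' : Set β} (h : Enumerates e s) (f : α ≃ β) (g : Fin l ≃ Fin k)
    (he : ∀ w, e' w = f (e (g w))) (hs : ∀ x, x ∈ s ↔ f x ∈ s') : Enumerates e' s' := by
  rw [enumerates_iff] at h ⊢
  refine ⟨fun w w' hw => ?_, fun y => ?_⟩
  · rw [he, he] at hw
    exact g.injective (h.1 (f.injective hw))
  · obtain ⟨x, rfl⟩ := f.surjective y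
    rw [← hs, ← h.2]
    constructor
    · rintro ⟨w, hw⟩
      rw [he] at hw
      exact ⟨g w, f.injective hw⟩
    · rintro ⟨w, hw⟩
      exact ⟨g.symm w, by rw [he, g.apply_symm_apply, hw]⟩

/-- Given the splittings `s`, `s'`, `S` of the ports into inputs and outputs, the enumeration `E`
of ports splits into the enumerations `e` of inputs and `e'` of outputs. -/
def Splits {n₀ n₀' k₀ n m n' m' k k' : ℕ} (s : Fin n₀ ≃ Fin n ⊕ Fin m)
    (s' : Fin n₀' ≃ Fin n' ⊕ Fin m') (S : Fin k₀ ≃ Fin k ⊕ Fin k')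
    (E : Fin k₀ → Fin n₀ ⊕ Fin n₀') (e : Fin k → Fin n ⊕ Fin n')
    (e' : Fin k' → Fin m ⊕ Fin m') : Prop :=
  ∀ w, Equiv.sumSumSumComm _ _ _ _ (Sum.map s s' (E w)) = Sum.map e e' (S w)

namespace Splits

variable {n₀ n₀' k₀ n m n' m' k k' : ℕ} {s : Fin n₀ ≃ Fin n ⊕ Fin m}
  {s' : Fin n₀' ≃ Fin n' ⊕ Fin m'} {S : Fin k₀ ≃ Fin k ⊕ Fin k'}
  {E : Fin k₀ → Fin n₀ ⊕ Fin n₀'} {e : Fin k → Fin n ⊕ Fin n'} {e' : Fin k' → Fin m ⊕ Fin m'}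

theorem eq (h : Splits s s' S E e e') (w : Fin k₀) :
    E w = Sum.map s.symm s'.symm
      ((Equiv.sumSumSumComm _ _ _ _).symm (Sum.map e e' (S w))) := by
  rw [← h w, Equiv.symm_apply_apply, Sum.map_map]
  rcases E w with a | a <;> simp

theorem enumerates_map (h : Splits s s' S E e e') {i : Fin n₀} {j : Fin n₀'} {i' : Fin n}
    {j' : Fin m'} (hi : s i = Sum.inl i') (hj : s' j = Sum.inr j') :
    EnumGlue i j E ↔ Function.Injective (Sum.map e e') ∧
      ∀ x, (∃ w, Sum.map e e' w = x) ↔ x ∉ ({Sum.inl (Sum.inl i'), Sum.inr (Sum.inr j')} : Set _) := by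
  let f := (Equiv.sumCongr s s').trans (Equiv.sumSumSumComm _ _ _ _)
  have hf : ∀ w, f (E w) = Sum.map e e' (S w) := h
  have hfi : f (Sum.inl i) = Sum.inl (Sum.inl i') := by simp [f, hi]
  have hfj : f (Sum.inr j) = Sum.inr (Sum.inr j') := by simp [f, hj]
  have hx : ∀ x, x ∈ ({Sum.inl i, Sum.inr j}ᶜ : Set _) ↔
      f x ∉ ({Sum.inl (Sum.inl i'), Sum.inr (Sum.inr j')} : Set _) := fun x => by
    rw [Set.mem_compl_iff, Set.mem_insert_iff, Set.mem_insert_iff, Set.mem_singleton_iff,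
      Set.mem_singleton_iff, ← hfi, ← hfj, f.apply_eq_iff_eq, f.apply_eq_iff_eq]
  unfold EnumGlue
  rw [enumerates_iff]
  refine and_congr ?_ ?_
  · have h1 : f ∘ E = Sum.map e e' ∘ S := funext hf
    rw [← f.injective.of_comp_iff E, h1, S.injective_comp]
  · rw [← f.forall_congr_right]
    refine forall_congr' fun x => iff_congr ?_ (hx x)
    rw [← S.exists_congr_right]
    refine exists_congr fun w => ?_
    rw [← hf, f.apply_eq_iff_eq]

theorem enumGlue_iff (h : Splits s s' S E e e') {i : Fin n₀} {j : Fin n₀'} {i' : Fin n}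
    {j' : Fin m'} (hi : s i = Sum.inl i') (hj : s' j = Sum.inr j') :
    EnumGlue i j E ↔ Enumerates e {Sum.inl i'}ᶜ ∧ Enumerates e' {Sum.inr j'}ᶜ := by
  rw [h.enumerates_map hi hj, Sum.map_injective, enumerates_iff, enumerates_iff, Sum.forall]
  simp only [Sum.exists, Sum.map_inl, Sum.map_inr, Sum.inl.injEq, Sum.inr.injEq, reduceCtorEq,
    exists_false, or_false, false_or, Set.mem_insert_iff, Set.mem_singleton_iff,
    Set.mem_compl_iff]
  tauto

/-- An enumeration of ports splits as soon as the splittings are compatible with it. -/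
theorem exists_of_isLeft (s : Fin n₀ ≃ Fin n ⊕ Fin m) (s' : Fin n₀' ≃ Fin n' ⊕ Fin m')
    (S : Fin k₀ ≃ Fin k ⊕ Fin k') (E : Fin k₀ → Fin n₀ ⊕ Fin n₀')
    (h : ∀ w, (S w).isRight = Sum.elim (fun a => (s a).isRight) (fun a => (s' a).isRight) (E w)) :
    ∃ e e', Splits s s' S E e e' := by
  have key : ∀ w, (S w).isRight =
      (Equiv.sumSumSumComm _ _ _ _ (Sum.map s s' (E w))).isRight := fun w => by
    rw [h]
    rcases E w with a | a
    · rcases h' : s a with b | b <;> simp [h']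
    · rcases h' : s' a with b | b <;> simp [h']
  have hl : ∀ a : Fin k, ∃ b,
      Equiv.sumSumSumComm _ _ _ _ (Sum.map s s' (E (S.symm (Sum.inl a)))) = Sum.inl b :=
    fun a => Sum.isLeft_iff.1 (by
      have := key (S.symm (Sum.inl a))
      rw [S.apply_symm_apply] at this
      rw [← Sum.not_isRight, ← this]
      simp)
  have hr : ∀ a : Fin k', ∃ b,
      Equiv.sumSumSumComm _ _ _ _ (Sum.map s s' (E (S.symm (Sum.inr a)))) = Sum.inr b :=
    fun a => Sum.isRight_iff.1 (by
      have := key (S.symm (Sum.inr a))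
      rw [S.apply_symm_apply] at this
      rw [← this]
      simp)
  choose e he using hl
  choose e' he' using hr
  refine ⟨e, e', fun w => ?_⟩
  obtain ⟨a | a, rfl⟩ := S.symm.surjective w
  · rw [he, S.apply_symm_apply, Sum.map_inl]
  · rw [he', S.apply_symm_apply, Sum.map_inr]

end Splits

/-- Two splittings of the same ports with the same outputs differ by permutations. -/
theorem exists_perm_of_isRight_eq {α : Type*} {n m n' m' : ℕ} (s : α ≃ Fin n ⊕ Fin m)
    (s' : α ≃ Fin n' ⊕ Fin m') (h : ∀ a, (s a).isRight = (s' a).isRight) :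
    n = n' ∧ m = m' ∧ ∃ (σ : Fin n ≃ Fin n') (τ : Fin m ≃ Fin m'),
      ∀ a, s' a = Sum.map σ τ (s a) := by
  have hl : ∀ i, ∃ i', s' (s.symm (Sum.inl i)) = Sum.inl i' := fun i => Sum.isLeft_iff.1 (by
    rw [← Sum.not_isRight, ← h]; simp)
  have hr : ∀ i, ∃ i', s' (s.symm (Sum.inr i)) = Sum.inr i' := fun i => Sum.isRight_iff.1 (by
    rw [← h]; simp)
  choose σ hσ using hl
  choose τ hτ using hr
  have key : ∀ a, s' a = Sum.map σ τ (s a) := fun a => by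
    obtain ⟨a | a, rfl⟩ := s.symm.surjective a
    · simp [hσ]
    · simp [hτ]
  have hb : Function.Bijective (Sum.map σ τ) := by
    have h1 : Sum.map σ τ = s' ∘ s.symm := funext fun a => by simp [key]
    rw [h1]
    exact (s.symm.trans s').bijective
  rw [Sum.map_bijective] at hb
  refine ⟨?_, ?_, Equiv.ofBijective σ hb.1, Equiv.ofBijective τ hb.2, key⟩
  · simpa using Fintype.card_of_bijective hb.1
  · simpa using Fintype.card_of_bijective hb.2

/-- Every set of ports with a direction can be split into inputs and outputs. -/
theorem exists_split {k : ℕ} (χ : Fin k → Bool) :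
    ∃ (n m : ℕ) (s : Fin k ≃ Fin n ⊕ Fin m), ∀ a, (s a).isRight = χ a := by
  classical
  let e := (Equiv.sumCompl (fun a => χ a = false)).symm
  let f := Fintype.equivFin {a // χ a = false}
  let g := Fintype.equivFin {a // ¬ χ a = false}
  refine ⟨_, _, e.trans (Equiv.sumCongr f g), fun a => ?_⟩
  by_cases h : χ a = false
  · have h1 : e a = Sum.inl ⟨a, h⟩ := Equiv.sumCompl_symm_apply_of_pos (p := fun a => χ a = false) h
    simp [h1, h]
  · have h1 : e a = Sum.inr ⟨a, h⟩ := Equiv.sumCompl_symm_apply_of_neg (p := fun a => χ a = false) h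
    simp only [Equiv.trans_apply, h1]
    simp at h
    simp [h]

namespace AugCyclicOperad

variable {Q : AugCyclicOperad.{u}}

theorem comp_congr {n m k : ℕ} {p p' : Q.Op n} {i i' : Fin n} {q q' : Q.Op m} {j j' : Fin m}
    {e e' : Fin k → Fin n ⊕ Fin m} {he : EnumGlue i j e} (he' : EnumGlue i' j' e')
    {h : Q.bdry p i = Q.inv (Q.bdry q j)} (h' : Q.bdry p' i' = Q.inv (Q.bdry q' j'))
    (hp : p = p') (hi : i = i') (hq : q = q') (hj : j = j') (hee : e = e') :
    Q.comp p i q j e he h = Q.comp p' i' q' j' e' he' h' := by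
  subst hp hi hq hj hee
  rfl

end AugCyclicOperad

theorem sumAssoc_swap_of_eq {α β γ κ ι : Type*} {e : κ → α ⊕ β} {d : ι → α ⊕ γ} {u : κ ⊕ γ}
    {v : ι ⊕ β} (h : Sum.map id Sum.swap (Equiv.sumAssoc _ _ _ (Sum.map e id u)) =
      Equiv.sumAssoc _ _ _ (Sum.map d id v)) :
    Equiv.sumAssoc _ _ _ (Sum.map (Sum.swap ∘ e) id u) = Sum.map id d (Sum.swap v) := by
  rcases u with a | a <;> rcases v with b | b
  · rcases h1 : e a with c | c <;> rcases h2 : d b with c' | c' <;> simp [h1, h2] at h ⊢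
    exact h
  · rcases h1 : e a with c | c <;> simp [h1] at h ⊢
    exact h
  · rcases h2 : d b with c' | c' <;> simp [h2] at h ⊢
    exact h
  · simp at h

theorem sumAssoc_symm_swap_of_eq {α β γ κ ι : Type*} {e : κ → α ⊕ γ} {d : ι → β ⊕ γ} {u : β ⊕ κ}
    {v : α ⊕ ι} (h : (Equiv.sumAssoc _ _ _).symm (Sum.map id e u) =
      Sum.map Sum.swap id ((Equiv.sumAssoc _ _ _).symm (Sum.map id d v))) :
    Sum.map id Sum.swap (Equiv.sumAssoc _ _ _ (Sum.map (Sum.swap ∘ e) id (Sum.swap u))) =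
      Equiv.sumAssoc _ _ _ (Sum.map (Sum.swap ∘ d) id (Sum.swap v)) := by
  rcases u with a | a <;> rcases v with b | b
  · simp at h
  · rcases h2 : d b with c' | c' <;> simp [h2] at h ⊢
    exact h
  · rcases h1 : e a with c | c <;> simp [h1] at h ⊢
    exact h
  · rcases h1 : e a with c | c <;> rcases h2 : d b with c' | c' <;> simp [h1, h2] at h ⊢
    exact h

theorem EnumGlue.swap {n m k : ℕ} {i : Fin n} {j : Fin m} {e : Fin k → Fin n ⊕ Fin m}
    (h : EnumGlue i j e) : EnumGlue j i (Sum.swap ∘ e) :=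
  Enumerates.equiv h (Equiv.sumComm _ _) (Equiv.refl _) (fun _ => rfl) (by
    rintro (a | a) <;> simp)

theorem EnumGlue.map {n m k : ℕ} {i : Fin n} {j : Fin m} {e : Fin k → Fin n ⊕ Fin m}
    (h : EnumGlue i j e) (σ : Equiv.Perm (Fin n)) (τ : Equiv.Perm (Fin m)) :
    EnumGlue (σ i) (τ j) (Sum.map σ τ ∘ e) :=
  Enumerates.equiv h (Equiv.sumCongr σ τ) (Equiv.refl _) (fun _ => rfl) (by
    rintro (a | a) <;> simp)

namespace AugCyclicOperad

variable {Q : AugCyclicOperad.{u}}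

theorem comp_act_act {n m k : ℕ} (p : Q.Op n) (i : Fin n) (q : Q.Op m) (j : Fin m)
    (e : Fin k → Fin n ⊕ Fin m) (σ : Equiv.Perm (Fin n)) (τ : Equiv.Perm (Fin m))
    (he : EnumGlue i j e) (h : Q.bdry (Q.act σ p) i = Q.inv (Q.bdry (Q.act τ q) j))
    (h' : Q.bdry p (σ i) = Q.inv (Q.bdry q (τ j))) :
    Q.comp (Q.act σ p) i (Q.act τ q) j e he h =
      Q.comp p (σ i) q (τ j) (Sum.map σ τ ∘ e) (he.map σ τ) h' := by
  have h1 : Q.bdry p (σ i) = Q.inv (Q.bdry (Q.act τ q) j) := by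
    rw [h', Q.bdry_act]; rfl
  have he1 : EnumGlue (σ i) j (Sum.map σ id ∘ e) := he.map σ 1
  have h2 : Q.bdry (Q.act τ q) j = Q.inv (Q.bdry p (σ i)) := by rw [h1, Q.inv_inv]
  have h3 : Q.bdry q (τ j) = Q.inv (Q.bdry p (σ i)) := by rw [h', Q.inv_inv]
  have he2 : EnumGlue (τ j) (σ i) (Sum.map τ id ∘ Sum.swap ∘ Sum.map σ id ∘ e) :=
    he1.swap.map τ 1
  rw [Q.comp_act p i _ j e σ he h he1 h1, Q.comp_comm _ _ _ _ _ _ _ he1.swap h2,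
    Q.comp_act q j p (σ i) _ τ he1.swap h2 he2 h3,
    Q.comp_comm _ _ _ _ _ _ _ he2.swap h']
  refine comp_congr _ _ rfl rfl rfl rfl (funext fun w => ?_)
  simp only [Function.comp_apply]
  rcases e w with a | a <;> rfl

theorem comp_ident_one {n : ℕ} (p : Q.Op n) (i : Fin n) (c : Q.Color) (e : Fin n → Fin n ⊕ Fin 2)
    (he : EnumGlue i 1 e) (h : Q.bdry p i = Q.inv (Q.bdry (Q.ident c) 1))
    (σ : Equiv.Perm (Fin n)) (hσ : ∀ w, e w = if σ w = i then Sum.inr 0 else Sum.inl (σ w)) :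
    Q.comp p i (Q.ident c) 1 e he h = Q.act σ p := by
  have h1 : Q.ident c = Q.act (Equiv.swap 0 1) (Q.ident (Q.inv c)) := by
    rw [Q.act_ident, Q.inv_inv]
  have h2 : p = Q.act 1 p := (Q.act_one p).symm
  have hc : Q.bdry p i = Q.inv c := by
    rw [h, Q.bdry_ident]
    rfl
  have h3 : Q.bdry p i = Q.inv (Q.bdry (Q.ident (Q.inv c)) 0) := by
    rw [hc, Q.bdry_ident, Matrix.cons_val_zero, Q.inv_inv]
  have h4 : Q.bdry p i = Q.inv (Q.bdry (Q.ident (Q.inv c)) ((Equiv.swap 0 1 : Equiv.Perm (Fin 2)) 1)) := by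
    simpa using h3
  have he0 : EnumGlue i 0 (Sum.map id (Equiv.swap 0 1 : Equiv.Perm (Fin 2)) ∘ e) := by
    simpa using he.map 1 (Equiv.swap 0 1)
  rw [comp_congr he (by rw [← h2, ← h1, h]) h2 rfl h1 rfl rfl]
  refine (comp_act_act _ _ _ _ _ _ _ _ _ h4).trans ?_
  refine (comp_congr he0 h3 rfl rfl rfl (by simp) rfl).trans ?_
  refine Q.comp_ident _ _ _ _ _ _ _ fun w => ?_
  rw [Function.comp_apply, hσ]
  split_ifs <;> simp

theorem comp_right_comm {n m s k k' K : ℕ} (p : Q.Op n) (q : Q.Op m) (r : Q.Op s) (i y : Fin n)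
    (j : Fin m) (l : Fin s) (e : Fin k → Fin n ⊕ Fin m) (x : Fin k) (ε : Fin K → Fin k ⊕ Fin s)
    (d : Fin k' → Fin n ⊕ Fin s) (z : Fin k') (δ : Fin K → Fin k' ⊕ Fin m)
    (he : EnumGlue i j e) (hε : EnumGlue x l ε) (hd : EnumGlue y l d) (hδ : EnumGlue z j δ)
    (h₁ : Q.bdry p i = Q.inv (Q.bdry q j))
    (h₂ : Q.bdry (Q.comp p i q j e he h₁) x = Q.inv (Q.bdry r l))
    (h₃ : Q.bdry p y = Q.inv (Q.bdry r l))
    (h₄ : Q.bdry (Q.comp p y r l d hd h₃) z = Q.inv (Q.bdry q j))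
    (hx : e x = Sum.inl y) (hz : d z = Sum.inl i)
    (hw : ∀ w, Sum.map id Sum.swap (Equiv.sumAssoc _ _ _ (Sum.map e id (ε w))) =
      Equiv.sumAssoc _ _ _ (Sum.map d id (δ w))) :
    Q.comp (Q.comp p i q j e he h₁) x r l ε hε h₂ =
      Q.comp (Q.comp p y r l d hd h₃) z q j δ hδ h₄ := by
  have h₁' : Q.bdry q j = Q.inv (Q.bdry p i) := by rw [h₁, Q.inv_inv]
  have h₄' : Q.bdry q j = Q.inv (Q.bdry (Q.comp p y r l d hd h₃) z) := by rw [h₄, Q.inv_inv]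
  have hc := Q.comp_comm p i q j e he h₁ he.swap h₁'
  have h₂' : Q.bdry (Q.comp q j p i _ he.swap h₁') x = Q.inv (Q.bdry r l) := by rw [← hc, h₂]
  rw [comp_congr hε h₂' hc rfl rfl rfl rfl, Q.comp_comm _ z q j _ _ _ hδ.swap h₄']
  refine Q.comp_assoc _ _ _ _ _ _ _ _ _ _ _ _ _ _ _ _ _ _ _ _ _ ?_ hz fun w => ?_
  · rw [Function.comp_apply, hx]
    rfl
  · exact sumAssoc_swap_of_eq (hw w)

theorem comp_left_comm {n m s k k' K : ℕ} (p : Q.Op n) (q : Q.Op m) (r : Q.Op s)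
    (i : Fin n) (y : Fin m) (j l : Fin s) (e : Fin k → Fin n ⊕ Fin s) (x : Fin k)
    (ε : Fin K → Fin m ⊕ Fin k) (d : Fin k' → Fin m ⊕ Fin s) (z : Fin k')
    (δ : Fin K → Fin n ⊕ Fin k')
    (he : EnumGlue i j e) (hε : EnumGlue y x ε) (hd : EnumGlue y l d) (hδ : EnumGlue i z δ)
    (h₁ : Q.bdry p i = Q.inv (Q.bdry r j))
    (h₂ : Q.bdry q y = Q.inv (Q.bdry (Q.comp p i r j e he h₁) x))
    (h₃ : Q.bdry q y = Q.inv (Q.bdry r l))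
    (h₄ : Q.bdry p i = Q.inv (Q.bdry (Q.comp q y r l d hd h₃) z))
    (hx : e x = Sum.inr l) (hz : d z = Sum.inr j)
    (hw : ∀ w, (Equiv.sumAssoc _ _ _).symm (Sum.map id e (ε w)) =
      Sum.map Sum.swap id ((Equiv.sumAssoc _ _ _).symm (Sum.map id d (δ w)))) :
    Q.comp q y (Q.comp p i r j e he h₁) x ε hε h₂ =
      Q.comp p i (Q.comp q y r l d hd h₃) z δ hδ h₄ := by
  have h₁' : Q.bdry r j = Q.inv (Q.bdry p i) := by rw [h₁, Q.inv_inv]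
  have h₃' : Q.bdry r l = Q.inv (Q.bdry q y) := by rw [h₃, Q.inv_inv]
  have hc := Q.comp_comm p i r j e he h₁ he.swap h₁'
  have hc' := Q.comp_comm q y r l d hd h₃ hd.swap h₃'
  have h₂' : Q.bdry q y = Q.inv (Q.bdry (Q.comp r j p i _ he.swap h₁') x) := by rw [← hc, h₂]
  have h₄' : Q.bdry p i = Q.inv (Q.bdry (Q.comp r l q y _ hd.swap h₃') z) := by rw [← hc', h₄]
  have h₂'' : Q.bdry (Q.comp r j p i _ he.swap h₁') x = Q.inv (Q.bdry q y) := by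
    rw [h₂', Q.inv_inv]
  have h₄'' : Q.bdry (Q.comp r l q y _ hd.swap h₃') z = Q.inv (Q.bdry p i) := by
    rw [h₄', Q.inv_inv]
  rw [comp_congr hε h₂' rfl rfl hc rfl rfl, comp_congr hδ h₄' rfl rfl hc' rfl rfl,
    Q.comp_comm _ _ _ _ _ _ _ hε.swap h₂'', Q.comp_comm _ _ _ _ _ _ _ hδ.swap h₄'']
  refine comp_right_comm _ _ _ _ _ _ _ _ _ _ _ _ _ _ _ _ _ _ _ _ _ ?_ ?_ fun w => ?_
  · rw [Function.comp_apply, hx]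
    rfl
  · rw [Function.comp_apply, hz]
    rfl
  · exact sumAssoc_symm_swap_of_eq (hw w)

end AugCyclicOperad

theorem sumAssoc_map_left {α β γ κ α' β' γ' κ' : Type*} {e : κ → α ⊕ β} {E : κ' → α' ⊕ β'}
    {f : κ → κ'} {f₁ : α → α'} {f₂ : β → β'} (f₃ : γ → γ')
    (h : ∀ a, E (f a) = Sum.map f₁ f₂ (e a)) (u : κ ⊕ γ) :
    Equiv.sumAssoc _ _ _ (Sum.map E id (Sum.map f f₃ u)) =
      Sum.map f₁ (Sum.map f₂ f₃) (Equiv.sumAssoc _ _ _ (Sum.map e id u)) := by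
  rcases u with a | a
  · simp only [Sum.map_inl, h]
    rcases e a with b | b <;> simp
  · simp

theorem sumAssoc_symm_map_right {α β γ κ α' β' γ' κ' : Type*} {e : κ → β ⊕ γ} {E : κ' → β' ⊕ γ'}
    {f : κ → κ'} (f₁ : α → α') {f₂ : β → β'} {f₃ : γ → γ'}
    (h : ∀ a, E (f a) = Sum.map f₂ f₃ (e a)) (u : α ⊕ κ) :
    (Equiv.sumAssoc _ _ _).symm (Sum.map id E (Sum.map f₁ f u)) =
      Sum.map (Sum.map f₁ f₂) f₃ ((Equiv.sumAssoc _ _ _).symm (Sum.map id e u)) := by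
  rcases u with a | a
  · simp
  · simp only [Sum.map_inr, h]
    rcases e a with b | b <;> simp

theorem sum_map_id_map {α β κ α' β' κ' : Type*} {e : κ → β} {E : κ' → β'} {f : κ → κ'}
    (f₁ : α → α') {f₂ : β → β'} (h : ∀ a, E (f a) = f₂ (e a)) (u : α ⊕ κ) :
    Sum.map id E (Sum.map f₁ f u) = Sum.map f₁ f₂ (Sum.map id e u) := by
  rcases u with a | a
  · simp
  · simp [h]

theorem sum_map_swap_right {α β γ α' β' γ' : Type*} (f₁ : α → α') (f₂ : β → β') (f₃ : γ → γ')
    (u : α ⊕ β ⊕ γ) : Sum.map id Sum.swap (Sum.map f₁ (Sum.map f₂ f₃) u) =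
      Sum.map f₁ (Sum.map f₃ f₂) (Sum.map id Sum.swap u) := by
  rcases u with u | u | u <;> rfl

theorem sum_map_swap_left {α β γ α' β' γ' : Type*} (f₁ : α → α') (f₂ : β → β') (f₃ : γ → γ')
    (u : (α ⊕ β) ⊕ γ) : Sum.map Sum.swap id (Sum.map (Sum.map f₁ f₂) f₃ u) =
      Sum.map (Sum.map f₂ f₁) f₃ (Sum.map Sum.swap id u) := by
  rcases u with (u | u) | u <;> rfl

/-- The permutation of the ports given by permutations of the inputs and of the outputs. -/
def permSum {n m : ℕ} (σ : Equiv.Perm (Fin n)) (τ : Equiv.Perm (Fin m)) :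
    Equiv.Perm (Fin (n + m)) :=
  (finSumFinEquiv.symm.trans (Equiv.sumCongr σ τ)).trans finSumFinEquiv

@[simp] theorem permSum_apply {n m : ℕ} (σ : Equiv.Perm (Fin n)) (τ : Equiv.Perm (Fin m))
    (x : Fin n ⊕ Fin m) :
    permSum σ τ (finSumFinEquiv x) = finSumFinEquiv (Sum.map σ τ x) := by
  simp [permSum]

section glue

variable {n m n' m' k k' : ℕ} (e : Fin k → Fin n ⊕ Fin n') (e' : Fin k' → Fin m ⊕ Fin m')

/-- The enumeration of ports given by enumerations of inputs and of outputs. -/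
def glue : Fin (k + k') → Fin (n + m) ⊕ Fin (n' + m') := fun w =>
  Sum.elim (fun a => Sum.map (fun b => finSumFinEquiv (Sum.inl b)) (fun b => finSumFinEquiv (Sum.inl b)) (e a))
    (fun a => Sum.map (fun b => finSumFinEquiv (Sum.inr b)) (fun b => finSumFinEquiv (Sum.inr b)) (e' a))
    (finSumFinEquiv.symm w)

theorem glue_inl (a : Fin k) : glue e e' (finSumFinEquiv (Sum.inl a)) =
    Sum.map (fun b => finSumFinEquiv (Sum.inl b)) (fun b => finSumFinEquiv (Sum.inl b)) (e a) := by
  simp only [glue, Equiv.symm_apply_apply, Sum.elim_inl]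

theorem glue_inr (a : Fin k') : glue e e' (finSumFinEquiv (Sum.inr a)) =
    Sum.map (fun b => finSumFinEquiv (Sum.inr b)) (fun b => finSumFinEquiv (Sum.inr b)) (e' a) := by
  simp only [glue, Equiv.symm_apply_apply, Sum.elim_inr]

theorem splits_glue :
    Splits finSumFinEquiv.symm finSumFinEquiv.symm finSumFinEquiv.symm (glue e e') e e' := by
  intro w
  obtain ⟨a | a, rfl⟩ := finSumFinEquiv.surjective w
  · rw [glue_inl]
    rcases h : e a with b | b <;>
      simp only [Sum.map_inl, Sum.map_inr, Equiv.symm_apply_apply, h] <;> rfl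
  · rw [glue_inr]
    rcases h : e' a with b | b <;>
      simp only [Sum.map_inl, Sum.map_inr, Equiv.symm_apply_apply, h] <;> rfl

variable {e e'}

theorem enumGlue_glue {i : Fin n} {j : Fin m'} (he : Enumerates e {Sum.inl i}ᶜ)
    (he' : Enumerates e' {Sum.inr j}ᶜ) :
    EnumGlue (finSumFinEquiv (Sum.inl i)) (finSumFinEquiv (Sum.inr j)) (glue e e') :=
  ((splits_glue e e').enumGlue_iff (Equiv.symm_apply_apply _ _)
    (Equiv.symm_apply_apply _ _)).2 ⟨he, he'⟩

end glue

namespace AugCyclicOperad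

variable {Q : AugCyclicOperad.{u}} (F : Q ⟶ direction.{u})

/-- The operation `q` has `n` incoming ports followed by `m` outgoing ports. -/
def Sorted (n m : ℕ) (q : Q.Op (n + m)) : Prop :=
  ∀ x : Fin n ⊕ Fin m, dir F (Q.bdry q (finSumFinEquiv x)) = x.isRight

variable {F}

theorem Sorted.inp {n m : ℕ} {q : Q.Op (n + m)} (h : Sorted F n m q) (i : Fin n) :
    dir F (Q.inv (Q.bdry q (finSumFinEquiv (Sum.inl i)))) = true := by
  rw [dir_inv, h]
  rfl

theorem Sorted.out {n m : ℕ} {q : Q.Op (n + m)} (h : Sorted F n m q) (i : Fin m) :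
    dir F (Q.bdry q (finSumFinEquiv (Sum.inr i))) = true := h _

theorem Sorted.act {n m : ℕ} {q : Q.Op (n + m)} (h : Sorted F n m q) (σ : Equiv.Perm (Fin n))
    (τ : Equiv.Perm (Fin m)) : Sorted F n m (Q.act (permSum σ τ) q) := fun x => by
  rw [Q.bdry_act, Function.comp_apply, permSum_apply, h]
  rcases x with x | x <;> rfl

variable (F) in
/-- The sorted operations with `n` incoming and `m` outgoing ports. -/
abbrev SortedOp (n m : ℕ) : Type u := {q : Q.Op (n + m) // Sorted F n m q}

/-- The incoming colors of a sorted operation. -/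
def SortedOp.inp {n m : ℕ} (p : SortedOp F n m) (i : Fin n) : {c // dir F c = true} :=
  ⟨Q.inv (Q.bdry p.1 (finSumFinEquiv (Sum.inl i))), p.2.inp i⟩

/-- The outgoing colors of a sorted operation. -/
def SortedOp.out {n m : ℕ} (p : SortedOp F n m) (i : Fin m) : {c // dir F c = true} :=
  ⟨Q.bdry p.1 (finSumFinEquiv (Sum.inr i)), p.2.out i⟩

theorem SortedOp.inp_eq_out_iff {n m n' m' : ℕ} {p : SortedOp F n m} {q : SortedOp F n' m'}
    {i : Fin n} {j : Fin m'} : p.inp i = q.out j ↔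
      Q.bdry p.1 (finSumFinEquiv (Sum.inl i)) =
        Q.inv (Q.bdry q.1 (finSumFinEquiv (Sum.inr j))) := by
  rw [Subtype.ext_iff]
  exact ⟨fun h => (Q.inv_inv _).symm.trans (congrArg Q.inv h),
    fun h => (congrArg Q.inv h).trans (Q.inv_inv _)⟩

theorem Sorted.comp {n m n' m' k k' : ℕ} {p : Q.Op (n + m)} {q : Q.Op (n' + m')}
    (hp : Sorted F n m p) (hq : Sorted F n' m' q) (i : Fin (n + m)) (j : Fin (n' + m'))
    (e : Fin k → Fin n ⊕ Fin n') (e' : Fin k' → Fin m ⊕ Fin m')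
    (he : EnumGlue i j (glue e e')) (h : Q.bdry p i = Q.inv (Q.bdry q j)) :
    Sorted F k k' (Q.comp p i q j (glue e e') he h) := by
  rintro (x | x)
  · rw [Q.bdry_comp, Function.comp_apply, glue_inl]
    rcases e x with a | a
    · exact hp _
    · exact hq _
  · rw [Q.bdry_comp, Function.comp_apply, glue_inr]
    rcases e' x with a | a
    · exact hp _
    · exact hq _

theorem sorted_ident {c : Q.Color} (hc : dir F c = true) : Sorted F 1 1 (Q.ident c) := by
  rintro (x | x) <;> rw [Subsingleton.elim x 0]
  · refine (congrArg (dir F) (congrFun (Q.bdry_ident c) 0)).trans ?_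
    change dir F (Q.inv c) = _
    rw [dir_inv, hc]
    rfl
  · exact (congrArg (dir F) (congrFun (Q.bdry_ident c) 1)).trans hc

variable (F)

/-- The dioperad of sorted operations of an augmented cyclic operad with directed colors. -/
def toDioperad : Dioperad.{u} where
  Color := {c : Q.Color // dir F c = true}
  Op := SortedOp F
  inp p := p.inp
  out p := p.out
  act σ τ p := ⟨Q.act (permSum σ τ) p.1, p.2.act σ τ⟩
  ident c := ⟨Q.ident c.1, sorted_ident c.2⟩
  comp p i q j e e' he he' h := ⟨Q.comp p.1 (finSumFinEquiv (Sum.inl i)) q.1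
    (finSumFinEquiv (Sum.inr j)) (glue e e') (enumGlue_glue he he') (SortedOp.inp_eq_out_iff.1 h),
    p.2.comp q.2 _ _ _ _ _ _⟩
  inp_act σ τ p := by
    funext i
    apply Subtype.ext
    simp [-finSumFinEquiv_apply_left, -finSumFinEquiv_apply_right, SortedOp.inp, Q.bdry_act]
  out_act σ τ p := by
    funext i
    apply Subtype.ext
    simp [-finSumFinEquiv_apply_left, -finSumFinEquiv_apply_right, SortedOp.out, Q.bdry_act]
  inp_ident c := by
    funext i
    apply Subtype.ext
    rw [Subsingleton.elim i 0]
    exact (congrArg Q.inv (congrFun (Q.bdry_ident c.1) 0)).trans (Q.inv_inv _)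
  out_ident c := by
    funext i
    apply Subtype.ext
    rw [Subsingleton.elim i 0]
    exact congrFun (Q.bdry_ident c.1) 1
  inp_comp p i q j e e' he he' h := by
    funext w
    apply Subtype.ext
    simp only [SortedOp.inp, Q.bdry_comp, Function.comp_apply, glue_inl]
    rcases e w with a | a <;> rfl
  out_comp p i q j e e' he he' h := by
    funext w
    apply Subtype.ext
    simp only [SortedOp.out, Q.bdry_comp, Function.comp_apply, glue_inr]
    rcases e' w with a | a <;> rfl
  act_one p := by
    apply Subtype.ext
    refine Eq.trans (congrArg (Q.act · p.1) (Equiv.ext fun w => ?_)) (Q.act_one p.1)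
    obtain ⟨x, rfl⟩ := finSumFinEquiv.surjective w
    rw [permSum_apply]
    rcases x with x | x <;> rfl
  act_act σ σ' τ τ' p := by
    apply Subtype.ext
    refine (Q.act_act _ _ _).trans (congrArg (Q.act · p.1) (Equiv.ext fun w => ?_))
    obtain ⟨x, rfl⟩ := finSumFinEquiv.surjective w
    rw [Equiv.Perm.mul_apply, permSum_apply, permSum_apply, permSum_apply]
    rcases x with x | x <;> rfl
  act_comp p i q j e e' he he' h σ τ hσ hτ := by
    apply Subtype.ext
    have hE : glue e e' ∘ permSum σ τ = glue (e ∘ σ) (e' ∘ τ) := by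
      funext w
      obtain ⟨x | x, rfl⟩ := finSumFinEquiv.surjective w
      · simp [-finSumFinEquiv_apply_left, -finSumFinEquiv_apply_right, glue_inl]
      · simp [-finSumFinEquiv_apply_left, -finSumFinEquiv_apply_right, glue_inr]
    have he1 : EnumGlue _ _ (glue e e' ∘ permSum σ τ) := hE ▸ enumGlue_glue hσ hτ
    refine (Q.act_comp _ _ _ _ _ _ _ _ he1).trans ?_
    exact comp_congr _ _ rfl rfl rfl rfl hE
  comp_act p i q j e e' σ τ σ' τ' he he' h hσ hτ h' := by
    apply Subtype.ext
    have h1 : Q.bdry p.1 (permSum σ τ (finSumFinEquiv (Sum.inl i))) =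
        Q.inv (Q.bdry q.1 (permSum σ' τ' (finSumFinEquiv (Sum.inr j)))) := by
      rw [permSum_apply, permSum_apply]
      exact SortedOp.inp_eq_out_iff.1 h'
    refine (comp_act_act _ _ _ _ _ _ _ _ _ h1).trans (comp_congr _ _ rfl ?_ rfl ?_ ?_)
    · rw [permSum_apply, Sum.map_inl]
    · rw [permSum_apply, Sum.map_inr]
    · funext w
      obtain ⟨x | x, rfl⟩ := finSumFinEquiv.surjective w
      · simp only [glue_inl, Function.comp_apply]
        rcases e x with a | a <;> simp [-finSumFinEquiv_apply_left, -finSumFinEquiv_apply_right]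
      · simp only [glue_inr, Function.comp_apply]
        rcases e' x with a | a <;> simp [-finSumFinEquiv_apply_left, -finSumFinEquiv_apply_right]
  ident_comp c q j e e' he he' h σ τ hσ hτ := by
    apply Subtype.ext
    have h1 := SortedOp.inp_eq_out_iff.1 h
    have h2 : Q.bdry q.1 (finSumFinEquiv (Sum.inr j)) = Q.inv (Q.bdry (Q.ident c.1) 0) :=
      (Q.inv_inv _).symm.trans (congrArg Q.inv h1.symm)
    refine (Q.comp_comm _ _ _ _ _ _ _ (enumGlue_glue he he').swap h2).trans ?_
    refine Q.comp_ident _ _ _ _ _ _ (permSum σ τ) fun w => ?_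
    obtain ⟨x | x, rfl⟩ := finSumFinEquiv.surjective w
    · simp [-finSumFinEquiv_apply_left, -finSumFinEquiv_apply_right, glue_inl, hσ]
    · simp only [glue_inr, hτ, permSum_apply, Function.comp_apply]
      by_cases hx : τ x = j
      · simp only [hx, if_true, Sum.map_inl, Sum.map_inr, Sum.swap_inl]
        rfl
      · simp [-finSumFinEquiv_apply_left, -finSumFinEquiv_apply_right, hx]
  comp_ident p i c e e' he he' h σ τ hσ hτ := by
    apply Subtype.ext
    refine comp_ident_one _ _ _ _ _ _ (permSum σ τ) fun w => ?_
    obtain ⟨x | x, rfl⟩ := finSumFinEquiv.surjective w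
    · simp only [glue_inl, hσ, permSum_apply]
      by_cases hx : σ x = i
      · simp only [hx, if_true, Sum.map_inl, Sum.map_inr]
        rfl
      · simp [-finSumFinEquiv_apply_left, -finSumFinEquiv_apply_right, hx]
    · simp [-finSumFinEquiv_apply_left, -finSumFinEquiv_apply_right, glue_inr, hτ]
  comp_assoc p q r i j y l e e' x ε ε' d d' z δ δ' he he' hε hε' hd hd' hδ hδ' h₁ h₂ h₃ h₄ hx hz
      hw hw' := by
    apply Subtype.ext
    refine Q.comp_assoc _ _ _ _ _ _ _ _ _ _ _ _ _ _ _ _ _ _ _ _ _ ?_ ?_ fun w => ?_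
    · rw [glue_inl, hx]
      rfl
    · rw [glue_inr, hz]
      rfl
    · obtain ⟨a | a, rfl⟩ := finSumFinEquiv.surjective w
      · rw [glue_inl, glue_inl, sumAssoc_map_left _ (glue_inl e e'), hw,
          sum_map_id_map _ (glue_inl d d')]
      · rw [glue_inr, glue_inr, sumAssoc_map_left _ (glue_inr e e'), hw',
          sum_map_id_map _ (glue_inr d d')]
  comp_comm_inp p q r i y j l e e' x ε ε' d d' z δ δ' he he' hε hε' hd hd' hδ hδ' h₁ h₂ h₃ h₄ hx hz
      hw hw' := by
    apply Subtype.ext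
    refine comp_right_comm _ _ _ _ _ _ _ _ _ _ _ _ _ _ _ _ _ _ _ _ _ ?_ ?_ fun w => ?_
    · rw [glue_inl, hx]
      rfl
    · rw [glue_inl, hz]
      rfl
    · obtain ⟨a | a, rfl⟩ := finSumFinEquiv.surjective w
      · rw [glue_inl, glue_inl, sumAssoc_map_left _ (glue_inl e e'),
          sumAssoc_map_left _ (glue_inl d d'), sum_map_swap_right, hw]
      · rw [glue_inr, glue_inr, sumAssoc_map_left _ (glue_inr e e'),
          sumAssoc_map_left _ (glue_inr d d'), sum_map_swap_right, hw']
  comp_comm_out p q r i y j l e e' x ε ε' d d' z δ δ' he he' hε hε' hd hd' hδ hδ' h₁ h₂ h₃ h₄ hx hz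
      hw hw' := by
    apply Subtype.ext
    refine comp_left_comm _ _ _ _ _ _ _ _ _ _ _ _ _ _ _ _ _ _ _ _ _ ?_ ?_ fun w => ?_
    · rw [glue_inr, hx]
      rfl
    · rw [glue_inr, hz]
      rfl
    · obtain ⟨a | a, rfl⟩ := finSumFinEquiv.surjective w
      · rw [glue_inl, glue_inl, sumAssoc_symm_map_right _ (glue_inl e e'),
          sumAssoc_symm_map_right _ (glue_inl d d'), sum_map_swap_left, hw]
      · rw [glue_inr, glue_inr, sumAssoc_symm_map_right _ (glue_inr e e'),
          sumAssoc_symm_map_right _ (glue_inr d d'), sum_map_swap_left, hw']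

end AugCyclicOperad

theorem Splits.map_eq_glue {n₀ n₀' k₀ n m n' m' k k' : ℕ} {s : Fin n₀ ≃ Fin n ⊕ Fin m}
    {s' : Fin n₀' ≃ Fin n' ⊕ Fin m'} {S : Fin k₀ ≃ Fin k ⊕ Fin k'}
    {E : Fin k₀ → Fin n₀ ⊕ Fin n₀'} {e : Fin k → Fin n ⊕ Fin n'} {e' : Fin k' → Fin m ⊕ Fin m'}
    (h : Splits s s' S E e e') (w : Fin k₀) :
    Sum.map (s.trans finSumFinEquiv) (s'.trans finSumFinEquiv) (E w) =
      glue e e' (S.trans finSumFinEquiv w) := by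
  rw [(splits_glue e e').eq, Equiv.trans_apply, Equiv.symm_apply_apply, ← h w,
    Equiv.symm_apply_apply, Sum.map_map]
  rcases E w with a | a <;> rfl

/-- The common splitting of the ports of a composite. -/
theorem exists_splits {n₀ n₀' k₀ n m n' m' : ℕ} (s : Fin n₀ ≃ Fin n ⊕ Fin m)
    (s' : Fin n₀' ≃ Fin n' ⊕ Fin m') (E : Fin k₀ → Fin n₀ ⊕ Fin n₀') :
    ∃ (k k' : ℕ) (S : Fin k₀ ≃ Fin k ⊕ Fin k') (e : Fin k → Fin n ⊕ Fin n')
      (e' : Fin k' → Fin m ⊕ Fin m'), Splits s s' S E e e' := by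
  obtain ⟨k, k', S, hS⟩ := exists_split fun w =>
    Sum.elim (fun a => (s a).isRight) (fun a => (s' a).isRight) (E w)
  obtain ⟨e, e', h⟩ := Splits.exists_of_isLeft s s' S E hS
  exact ⟨k, k', S, e, e', h⟩

namespace AugCyclicOperad

variable {Q : AugCyclicOperad.{u}}

/-- The action of a bijection. -/
def actEquiv {k n : ℕ} (a : Fin k ≃ Fin n) (q : Q.Op n) : Q.Op k :=
  have h : n = k := by simpa using (Fintype.card_congr a).symm
  Q.act (a.trans (finCongr h)) (h ▸ q)

theorem actEquiv_eq_act {n : ℕ} (a : Fin n ≃ Fin n) (q : Q.Op n) : actEquiv a q = Q.act a q := rfl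

theorem bdry_actEquiv {k n : ℕ} (a : Fin k ≃ Fin n) (q : Q.Op n) :
    Q.bdry (actEquiv a q) = Q.bdry q ∘ a := by
  obtain rfl : n = k := by simpa using (Fintype.card_congr a).symm
  exact Q.bdry_act _ _

theorem actEquiv_actEquiv {k n l : ℕ} (a : Fin k ≃ Fin n) (b : Fin l ≃ Fin k) (q : Q.Op n) :
    actEquiv b (actEquiv a q) = actEquiv (b.trans a) q := by
  obtain rfl : n = k := by simpa using (Fintype.card_congr a).symm
  obtain rfl : n = l := by simpa using (Fintype.card_congr b).symm
  exact Q.act_act _ _ _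

theorem actEquiv_refl {n : ℕ} (q : Q.Op n) : actEquiv (Equiv.refl _) q = q := Q.act_one q

theorem actEquiv_injective {k n : ℕ} (a : Fin k ≃ Fin n) :
    Function.Injective (actEquiv (Q := Q) a) :=
  Function.LeftInverse.injective (g := actEquiv a.symm) fun q => by
    rw [actEquiv_actEquiv, Equiv.symm_trans_self, actEquiv_refl]

theorem comp_actEquiv {n m k n' m' k' : ℕ} (a : Fin n ≃ Fin n') (b : Fin m ≃ Fin m')
    (c : Fin k ≃ Fin k') (p : Q.Op n') (i : Fin n) (q : Q.Op m') (j : Fin m)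
    (E : Fin k → Fin n ⊕ Fin m) (E' : Fin k' → Fin n' ⊕ Fin m') (he : EnumGlue i j E)
    (he' : EnumGlue (a i) (b j) E')
    (h : Q.bdry (actEquiv a p) i = Q.inv (Q.bdry (actEquiv b q) j))
    (h' : Q.bdry p (a i) = Q.inv (Q.bdry q (b j))) (hE : ∀ w, Sum.map a b (E w) = E' (c w)) :
    Q.comp (actEquiv a p) i (actEquiv b q) j E he h =
      actEquiv c (Q.comp p (a i) q (b j) E' he' h') := by
  obtain rfl : n' = n := by simpa using (Fintype.card_congr a).symm
  obtain rfl : m' = m := by simpa using (Fintype.card_congr b).symm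
  obtain rfl : k' = k := by simpa using (Fintype.card_congr c).symm
  have hE' : Sum.map a b ∘ E = E' ∘ c := funext hE
  refine (comp_act_act p i q j E a b he h h').trans ?_
  have he1 : EnumGlue (a i) (b j) (E' ∘ c) := hE' ▸ he.map a b
  refine (comp_congr he1 h' rfl rfl rfl rfl hE').trans ?_
  exact (Q.act_comp _ _ _ _ _ he' h' c he1).symm

theorem map_actEquiv {Q' : AugCyclicOperad.{u}} (f : Q ⟶ Q') {k n : ℕ} (a : Fin k ≃ Fin n)
    (q : Q.Op n) : Hom.onOp f (actEquiv a q) = actEquiv a (Hom.onOp f q) := by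
  obtain rfl : n = k := by simpa using (Fintype.card_congr a).symm
  exact Hom.map_act f _ _

variable {F : Q ⟶ direction.{u}}

/-- The operation obtained from a sorted operation by reordering its ports. -/
def SortedOp.mk {k n m : ℕ} (s : Fin k ≃ Fin n ⊕ Fin m) (p : SortedOp F n m) : Q.Op k :=
  actEquiv (s.trans finSumFinEquiv) p.1

namespace SortedOp

theorem bdry_mk {k n m : ℕ} (s : Fin k ≃ Fin n ⊕ Fin m) (p : SortedOp F n m) (a : Fin k) :
    Q.bdry (mk s p) a = Q.bdry p.1 (finSumFinEquiv (s a)) := by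
  rw [mk, bdry_actEquiv]
  rfl

theorem dir_mk {k n m : ℕ} (s : Fin k ≃ Fin n ⊕ Fin m) (p : SortedOp F n m) (a : Fin k) :
    dir F (Q.bdry (mk s p) a) = (s a).isRight := by
  rw [bdry_mk, p.2]

theorem mk_symm {n m : ℕ} (p : SortedOp F n m) : mk finSumFinEquiv.symm p = p.1 := by
  rw [mk, Equiv.symm_trans_self, actEquiv_refl]

theorem mk_injective {k n m : ℕ} (s : Fin k ≃ Fin n ⊕ Fin m) :
    Function.Injective (mk (F := F) s) := fun _ _ h =>
  Subtype.ext (actEquiv_injective _ h)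

theorem act_mk {k n m : ℕ} (σ : Equiv.Perm (Fin k)) (s : Fin k ≃ Fin n ⊕ Fin m)
    (p : SortedOp F n m) : Q.act σ (mk s p) = mk (σ.trans s) p := by
  rw [← actEquiv_eq_act, mk, actEquiv_actEquiv]
  rfl

theorem mk_trans {k n m : ℕ} (s : Fin k ≃ Fin n ⊕ Fin m) (σ : Equiv.Perm (Fin n))
    (τ : Equiv.Perm (Fin m)) (p : SortedOp F n m) :
    mk (s.trans (Equiv.sumCongr σ τ)) p = mk s ((toDioperad F).act σ τ p) := by
  change _ = actEquiv _ (Q.act _ _)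
  rw [← actEquiv_eq_act, mk, actEquiv_actEquiv]
  congr 1
  ext a
  simp [permSum]

theorem exists_mk {k : ℕ} (F : Q ⟶ direction.{u}) (q : Q.Op k) :
    ∃ (n m : ℕ) (s : Fin k ≃ Fin n ⊕ Fin m) (p : SortedOp F n m), mk s p = q := by
  obtain ⟨n, m, s, hs⟩ := exists_split fun a => dir F (Q.bdry q a)
  refine ⟨n, m, s, ⟨actEquiv (s.trans finSumFinEquiv).symm q, fun x => ?_⟩, ?_⟩
  · rw [bdry_actEquiv, Function.comp_apply, ← hs]
    simp [-finSumFinEquiv_apply_left, -finSumFinEquiv_apply_right]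
  · rw [mk, actEquiv_actEquiv, Equiv.self_trans_symm, actEquiv_refl]

theorem mk_comp {n₀ n₀' k₀ n m n' m' k k' : ℕ} {s : Fin n₀ ≃ Fin n ⊕ Fin m}
    {s' : Fin n₀' ≃ Fin n' ⊕ Fin m'} {S : Fin k₀ ≃ Fin k ⊕ Fin k'}
    {E : Fin k₀ → Fin n₀ ⊕ Fin n₀'} {e : Fin k → Fin n ⊕ Fin n'} {e' : Fin k' → Fin m ⊕ Fin m'}
    (hS : Splits s s' S E e e') (p : SortedOp F n m) (q : SortedOp F n' m') {i : Fin n₀}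
    {j : Fin n₀'} {i' : Fin n} {j' : Fin m'} (hi : s i = Sum.inl i') (hj : s' j = Sum.inr j')
    (hE : EnumGlue i j E) (h : Q.bdry (mk s p) i = Q.inv (Q.bdry (mk s' q) j))
    (he : Enumerates e {Sum.inl i'}ᶜ) (he' : Enumerates e' {Sum.inr j'}ᶜ)
    (h' : p.inp i' = q.out j') :
    Q.comp (mk s p) i (mk s' q) j E hE h =
      mk S ((toDioperad F).comp p i' q j' e e' he he' h') := by
  have hi' : s.trans finSumFinEquiv i = finSumFinEquiv (Sum.inl i') := by
    rw [Equiv.trans_apply, hi]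
  have hj' : s'.trans finSumFinEquiv j = finSumFinEquiv (Sum.inr j') := by
    rw [Equiv.trans_apply, hj]
  have hG := enumGlue_glue he he'
  rw [← hi', ← hj'] at hG
  have h1 := inp_eq_out_iff.1 h'
  rw [← hi', ← hj'] at h1
  refine (comp_actEquiv _ _ (S.trans finSumFinEquiv) _ _ _ _ _ _ hE hG h h1 hS.map_eq_glue).trans ?_
  exact congrArg (actEquiv _) (comp_congr _ _ rfl hi' rfl hj' rfl)

end SortedOp

theorem dir_map {Y Y' : Over direction.{u}} (f : Y ⟶ Y') (c : Y.left.Color) :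
    dir Y'.hom (Hom.onColor f.left c) = dir Y.hom c := by
  rw [← Over.w f]
  rfl

/-- The functor from directed augmented cyclic operads to dioperads. -/
def toDioperadFunctor : Over direction.{u} ⥤ Dioperad.{u} where
  obj Y := toDioperad Y.hom
  map {Y Y'} f :=
    { onColor := fun c => ⟨Hom.onColor f.left c.1, (dir_map f c.1).trans c.2⟩
      onOp := fun p => ⟨Hom.onOp f.left p.1, fun x => by
        rw [Hom.map_bdry f.left, Function.comp_apply, dir_map]
        exact p.2 x⟩
      map_inp := fun p => by
        funext i
        apply Subtype.ext
        exact (congrArg Y'.left.inv (congrFun (Hom.map_bdry f.left p.1) _)).trans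
          (Hom.map_inv f.left _).symm
      map_out := fun p => by
        funext i
        apply Subtype.ext
        exact congrFun (Hom.map_bdry f.left p.1) _
      map_act := fun σ τ p => Subtype.ext (Hom.map_act f.left _ _)
      map_ident := fun c => Subtype.ext (Hom.map_ident f.left _)
      map_comp := fun p i q j e e' he he' h h' => Subtype.ext (Hom.map_comp f.left _ _ _ _ _ _ _ _) }
  map_id _ := rfl
  map_comp _ _ := rfl

theorem map_mk {Y Y' : Over direction.{u}} (f : Y ⟶ Y') {k n m : ℕ} (s : Fin k ≃ Fin n ⊕ Fin m)
    (p : SortedOp Y.hom n m) : Hom.onOp f.left (SortedOp.mk s p) =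
      SortedOp.mk s (Dioperad.Hom.onOp (toDioperadFunctor.map f) p) :=
  map_actEquiv _ _ _

instance : toDioperadFunctor.{u}.Faithful where
  map_injective {Y Y' f g} h := by
    apply Over.OverMorphism.ext
    have hc : ∀ c, dir Y.hom c = true → Hom.onColor f.left c = Hom.onColor g.left c := fun c hc =>
      congrArg Subtype.val (congrFun (congrArg Dioperad.Hom.onColor h) ⟨c, hc⟩)
    have ho : ∀ {k} (q : Y.left.Op k), Hom.onOp f.left q = Hom.onOp g.left q := fun q => by
      obtain ⟨n, m, s, p, rfl⟩ := SortedOp.exists_mk Y.hom q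
      rw [map_mk, map_mk, h]
    refine Hom.ext (funext fun c => ?_) ?_
    · cases hd : dir Y.hom c
      · have h1 := hc (Y.left.inv c) (by rw [dir_inv, hd]; rfl)
        rw [Hom.map_inv f.left, Hom.map_inv g.left] at h1
        rw [← Y'.left.inv_inv (Hom.onColor f.left c), h1, Y'.left.inv_inv]
      · exact hc c hd
    · funext k q
      exact ho q

section Full

variable {Y Y' : Over direction.{u}} (f : toDioperadFunctor.obj Y ⟶ toDioperadFunctor.obj Y')

/-- The extension to all colors of a map defined on outgoing colors. -/
def extendColor (c : Y.left.Color) : Y'.left.Color :=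
  if h : dir Y.hom c = true then (Dioperad.Hom.onColor f ⟨c, h⟩).1 else
    Y'.left.inv (Dioperad.Hom.onColor f ⟨Y.left.inv c, by rw [dir_inv, Bool.eq_false_of_not_eq_true h]; rfl⟩).1

theorem extendColor_of_true {c : Y.left.Color} (h : dir Y.hom c = true) :
    extendColor f c = (Dioperad.Hom.onColor f ⟨c, h⟩).1 := dif_pos h

theorem extendColor_inv (c : Y.left.Color) :
    extendColor f (Y.left.inv c) = Y'.left.inv (extendColor f c) := by
  unfold extendColor
  by_cases hd : dir Y.hom c = true
  · rw [dif_neg (by rw [dir_inv, hd]; simp), dif_pos hd]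
    simp only [Y.left.inv_inv]
  · rw [dif_pos (by rw [dir_inv, Bool.eq_false_of_not_eq_true hd]; rfl), dif_neg hd,
      Y'.left.inv_inv]

theorem dir_extendColor (c : Y.left.Color) : dir Y'.hom (extendColor f c) = dir Y.hom c := by
  have key : ∀ c, dir Y.hom c = true → dir Y'.hom (extendColor f c) = dir Y.hom c := fun c h => by
    rw [extendColor_of_true f h, h]
    exact (Dioperad.Hom.onColor f ⟨c, h⟩).2
  cases hd : dir Y.hom c
  · have h1 := key (Y.left.inv c) (by rw [dir_inv, hd]; rfl)
    rwa [extendColor_inv, dir_inv, dir_inv, Bool.not_inj_iff, hd] at h1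
  · rw [key c hd, hd]

/-- The action of a map of dioperads on sorted operations. -/
def onSorted {n m : ℕ} (p : SortedOp Y.hom n m) : SortedOp Y'.hom n m := Dioperad.Hom.onOp f p

theorem extendColor_bdry {n m : ℕ} (p : SortedOp Y.hom n m) (x : Fin n ⊕ Fin m) :
    extendColor f (Y.left.bdry p.1 (finSumFinEquiv x)) =
      Y'.left.bdry (onSorted f p).1 (finSumFinEquiv x) := by
  rcases x with x | x
  · have h1 := congrArg Subtype.val (congrFun (Dioperad.Hom.map_inp f p) x)
    change Y'.left.inv (Y'.left.bdry (onSorted f p).1 _) = _ at h1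
    rw [← Y'.left.inv_inv (Y'.left.bdry _ _), h1]
    change _ = Y'.left.inv (Dioperad.Hom.onColor f (p.inp x)).1
    rw [← extendColor_of_true f (p.inp x).2, ← extendColor_inv]
    exact congrArg _ (Y.left.inv_inv _).symm
  · rw [extendColor_of_true f (p.2.out x)]
    exact (congrArg Subtype.val (congrFun (Dioperad.Hom.map_out f p) x)).symm

theorem exists_extendOp {k : ℕ} (q : Y.left.Op k) : ∃ q' : Y'.left.Op k,
    ∀ (n m : ℕ) (s : Fin k ≃ Fin n ⊕ Fin m) (p : SortedOp Y.hom n m), SortedOp.mk s p = q →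
      q' = SortedOp.mk s (onSorted f p) := by
  obtain ⟨n, m, s, p, rfl⟩ := SortedOp.exists_mk Y.hom q
  refine ⟨SortedOp.mk s (onSorted f p), fun n' m' s' p' h => ?_⟩
  obtain ⟨rfl, rfl, σ, τ, hs⟩ := exists_perm_of_isRight_eq s' s fun a => by
    rw [← SortedOp.dir_mk s p, ← SortedOp.dir_mk s' p', h]
  obtain rfl : s = s'.trans (Equiv.sumCongr σ τ) := Equiv.ext hs
  rw [SortedOp.mk_trans] at h
  rw [SortedOp.mk_trans]
  rw [SortedOp.mk_injective s' h]
  exact congrArg _ (Dioperad.Hom.map_act f σ τ p).symm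

/-- The extension to all operations of a map defined on sorted operations. -/
noncomputable def extendOp {k : ℕ} (q : Y.left.Op k) : Y'.left.Op k :=
  (exists_extendOp f q).choose

theorem extendOp_mk {k n m : ℕ} (s : Fin k ≃ Fin n ⊕ Fin m) (p : SortedOp Y.hom n m) :
    extendOp f (SortedOp.mk s p) = SortedOp.mk s (onSorted f p) :=
  (exists_extendOp f (SortedOp.mk s p)).choose_spec n m s p rfl

theorem bdry_extendOp {k : ℕ} (q : Y.left.Op k) :
    Y'.left.bdry (extendOp f q) = extendColor f ∘ Y.left.bdry q := by
  obtain ⟨n, m, s, p, rfl⟩ := SortedOp.exists_mk Y.hom q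
  funext a
  rw [extendOp_mk, Function.comp_apply, SortedOp.bdry_mk, SortedOp.bdry_mk, extendColor_bdry]

theorem extendOp_act {k : ℕ} (σ : Equiv.Perm (Fin k)) (q : Y.left.Op k) :
    extendOp f (Y.left.act σ q) = Y'.left.act σ (extendOp f q) := by
  obtain ⟨n, m, s, p, rfl⟩ := SortedOp.exists_mk Y.hom q
  rw [extendOp_mk, SortedOp.act_mk, SortedOp.act_mk, extendOp_mk]

theorem extendOp_val {n m : ℕ} (p : SortedOp Y.hom n m) :
    extendOp f p.1 = (onSorted f p).1 := by
  refine (congrArg _ (SortedOp.mk_symm p).symm).trans ?_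
  rw [extendOp_mk, SortedOp.mk_symm]

theorem extendOp_ident (c : Y.left.Color) :
    extendOp f (Y.left.ident c) = Y'.left.ident (extendColor f c) := by
  have key : ∀ c, dir Y.hom c = true →
      extendOp f (Y.left.ident c) = Y'.left.ident (extendColor f c) := fun c h => by
    rw [extendColor_of_true f h]
    exact (extendOp_val f ((toDioperad Y.hom).ident ⟨c, h⟩)).trans
      (congrArg Subtype.val (Dioperad.Hom.map_ident f ⟨c, h⟩))
  cases hd : dir Y.hom c
  · have h1 := key (Y.left.inv c) (by rw [dir_inv, hd]; rfl)
    rw [extendColor_inv] at h1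
    rw [← Y.left.inv_inv c, ← Y.left.act_ident, extendOp_act, h1, Y'.left.act_ident,
      Y.left.inv_inv, Y'.left.inv_inv]
  · exact key c hd

theorem extendOp_comp {n m k : ℕ} (p : Y.left.Op n) (i : Fin n) (q : Y.left.Op m) (j : Fin m)
    (E : Fin k → Fin n ⊕ Fin m) (hE : EnumGlue i j E)
    (h : Y.left.bdry p i = Y.left.inv (Y.left.bdry q j))
    (h' : Y'.left.bdry (extendOp f p) i = Y'.left.inv (Y'.left.bdry (extendOp f q) j)) :
    extendOp f (Y.left.comp p i q j E hE h) =
      Y'.left.comp (extendOp f p) i (extendOp f q) j E hE h' := by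
  wlog hd : dir Y.hom (Y.left.bdry p i) = false generalizing n m p q i j
  · have h₁ : Y.left.bdry q j = Y.left.inv (Y.left.bdry p i) := by rw [h, Y.left.inv_inv]
    have h₂ : Y'.left.bdry (extendOp f q) j = Y'.left.inv (Y'.left.bdry (extendOp f p) i) := by
      rw [h', Y'.left.inv_inv]
    rw [Y.left.comp_comm _ _ _ _ _ _ _ hE.swap h₁, Y'.left.comp_comm _ _ _ _ _ _ _ hE.swap h₂]
    refine this _ _ _ _ _ _ _ _ ?_
    rw [h₁, dir_inv, Bool.eq_true_of_not_eq_false hd]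
    rfl
  · obtain ⟨n, m, s, p, rfl⟩ := SortedOp.exists_mk Y.hom p
    obtain ⟨n', m', s', q, rfl⟩ := SortedOp.exists_mk Y.hom q
    obtain ⟨k, k', S, e, e', hS⟩ := exists_splits s s' E
    have hd' : dir Y.hom (Y.left.bdry (SortedOp.mk s' q) j) = true := by
      rw [h, dir_inv, Bool.not_eq_false'] at hd
      exact hd
    rw [SortedOp.dir_mk] at hd hd'
    obtain ⟨i', hi⟩ := Sum.isLeft_iff.1 (Sum.isRight_eq_false.1 hd)
    obtain ⟨j', hj⟩ := Sum.isRight_iff.1 hd'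
    obtain ⟨he, he'⟩ := (hS.enumGlue_iff hi hj).1 hE
    have h₁ : p.inp i' = q.out j' := by
      rw [SortedOp.inp_eq_out_iff, ← hi, ← hj, ← SortedOp.bdry_mk s p, ← SortedOp.bdry_mk s' q, h]
    have h₂ : (onSorted f p).inp i' = (onSorted f q).out j' := by
      have h1 := congrFun (Dioperad.Hom.map_inp f p) i'
      have h2 := congrFun (Dioperad.Hom.map_out f q) j'
      exact h1.trans ((congrArg (Dioperad.Hom.onColor f) h₁).trans h2.symm)
    have h₃ : Y'.left.bdry (SortedOp.mk s (onSorted f p)) i =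
        Y'.left.inv (Y'.left.bdry (SortedOp.mk s' (onSorted f q)) j) := by
      rw [← extendOp_mk, ← extendOp_mk, h']
    refine Eq.trans ?_ (comp_congr hE h₃ (extendOp_mk f s p) rfl (extendOp_mk f s' q) rfl rfl).symm
    rw [SortedOp.mk_comp hS p q hi hj hE h he he' h₁, SortedOp.mk_comp hS _ _ hi hj hE _ he he' h₂]
    refine (extendOp_mk f _ _).trans (congrArg _ ?_)
    exact Dioperad.Hom.map_comp f p i' q j' e e' he he' h₁ h₂

end Full

instance : toDioperadFunctor.{u}.Full where
  map_surjective {Y Y'} f := by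
    let g : Y.left ⟶ Y'.left :=
      { onColor := extendColor f
        onOp := extendOp f
        map_inv := extendColor_inv f
        map_bdry := bdry_extendOp f
        map_act := extendOp_act f
        map_ident := extendOp_ident f
        map_comp := extendOp_comp f }
    refine ⟨Over.homMk g (hom_direction_ext fun c => ?_), ?_⟩
    · exact ULift.down_injective (dir_extendColor f c)
    · have ho : ∀ {n m} (p : SortedOp Y.hom n m), extendOp f p.1 = (onSorted f p).1 :=
        extendOp_val f
      refine Dioperad.Hom.ext (funext fun c => Subtype.ext (extendColor_of_true f c.2)) ?_
      funext n m p
      exact Subtype.ext (ho p)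

end AugCyclicOperad

namespace Splits

variable {n₀ n₀' k₀ n m n' m' k k' : ℕ} {s : Fin n₀ ≃ Fin n ⊕ Fin m}
  {s' : Fin n₀' ≃ Fin n' ⊕ Fin m'} {S : Fin k₀ ≃ Fin k ⊕ Fin k'}
  {E : Fin k₀ → Fin n₀ ⊕ Fin n₀'} {e : Fin k → Fin n ⊕ Fin n'} {e' : Fin k' → Fin m ⊕ Fin m'}

theorem inl (h : Splits s s' S E e e') (a : Fin k) : E (S.symm (Sum.inl a)) =
    Sum.map (fun b => s.symm (Sum.inl b)) (fun b => s'.symm (Sum.inl b)) (e a) := by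
  rw [h.eq, S.apply_symm_apply, Sum.map_inl]
  rcases e a with b | b <;> rfl

theorem inr (h : Splits s s' S E e e') (a : Fin k') : E (S.symm (Sum.inr a)) =
    Sum.map (fun b => s.symm (Sum.inr b)) (fun b => s'.symm (Sum.inr b)) (e' a) := by
  rw [h.eq, S.apply_symm_apply, Sum.map_inr]
  rcases e' a with b | b <;> rfl

theorem isRight (h : Splits s s' S E e e') (w : Fin k₀) :
    (S w).isRight = Sum.elim (fun a => (s a).isRight) (fun a => (s' a).isRight) (E w) := by
  obtain ⟨a | a, rfl⟩ := S.symm.surjective w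
  · rw [h.inl]
    rcases e a with b | b <;> simp
  · rw [h.inr]
    rcases e' a with b | b <;> simp

/-- Splittings of both ways to list the ports of a composite of three operations in a row. -/
theorem assoc {np nq nr p p' q q' r r' K₁ K₂ L₁ a a' b b' c c' : ℕ}
    {sp : Fin np ≃ Fin p ⊕ Fin p'} {sq : Fin nq ≃ Fin q ⊕ Fin q'} {sr : Fin nr ≃ Fin r ⊕ Fin r'}
    {S₁ : Fin K₁ ≃ Fin a ⊕ Fin a'} {S₂ : Fin K₂ ≃ Fin b ⊕ Fin b'} {T₁ : Fin L₁ ≃ Fin c ⊕ Fin c'}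
    {E₁ : Fin K₁ → Fin np ⊕ Fin nq} {E₂ : Fin K₂ → Fin K₁ ⊕ Fin nr}
    {F₁ : Fin L₁ → Fin nq ⊕ Fin nr} {F₂ : Fin K₂ → Fin np ⊕ Fin L₁}
    {e₁ : Fin a → Fin p ⊕ Fin q} {e₁' : Fin a' → Fin p' ⊕ Fin q'}
    {e₂ : Fin b → Fin a ⊕ Fin r} {e₂' : Fin b' → Fin a' ⊕ Fin r'}
    {f₁ : Fin c → Fin q ⊕ Fin r} {f₁' : Fin c' → Fin q' ⊕ Fin r'}
    (h₁ : Splits sp sq S₁ E₁ e₁ e₁') (h₂ : Splits S₁ sr S₂ E₂ e₂ e₂')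
    (h₃ : Splits sq sr T₁ F₁ f₁ f₁')
    (hw : ∀ w, Equiv.sumAssoc _ _ _ (Sum.map E₁ id (E₂ w)) = Sum.map id F₁ (F₂ w)) :
    ∃ f₂ f₂', Splits sp T₁ S₂ F₂ f₂ f₂' ∧
      (∀ w, Equiv.sumAssoc _ _ _ (Sum.map e₁ id (e₂ w)) = Sum.map id f₁ (f₂ w)) ∧
      ∀ w, Equiv.sumAssoc _ _ _ (Sum.map e₁' id (e₂' w)) = Sum.map id f₁' (f₂' w) := by
  obtain ⟨f₂, f₂', h₄⟩ := exists_of_isLeft sp T₁ S₂ F₂ fun w => by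
    rw [h₂.isRight, funext h₁.isRight, funext h₃.isRight]
    exact DTree.elim_assoc (hw w)
  refine ⟨f₂, f₂', h₄, fun w => ?_, fun w => ?_⟩
  · have h := hw (S₂.symm (Sum.inl w))
    rw [h₂.inl, h₄.inl, sumAssoc_map_left _ h₁.inl, sum_map_id_map _ h₃.inl] at h
    exact (Sum.map_injective.2 ⟨sp.symm.injective.comp Sum.inl_injective, Sum.map_injective.2
      ⟨sq.symm.injective.comp Sum.inl_injective, sr.symm.injective.comp Sum.inl_injective⟩⟩) h
  · have h := hw (S₂.symm (Sum.inr w))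
    rw [h₂.inr, h₄.inr, sumAssoc_map_left _ h₁.inr, sum_map_id_map _ h₃.inr] at h
    exact (Sum.map_injective.2 ⟨sp.symm.injective.comp Sum.inr_injective, Sum.map_injective.2
      ⟨sq.symm.injective.comp Sum.inr_injective, sr.symm.injective.comp Sum.inr_injective⟩⟩) h

theorem right_comm {np nq nr p p' q q' r r' K₁ K₂ L₁ a a' b b' c c' : ℕ}
    {sp : Fin np ≃ Fin p ⊕ Fin p'} {sq : Fin nq ≃ Fin q ⊕ Fin q'} {sr : Fin nr ≃ Fin r ⊕ Fin r'}
    {S₁ : Fin K₁ ≃ Fin a ⊕ Fin a'} {S₂ : Fin K₂ ≃ Fin b ⊕ Fin b'} {T₁ : Fin L₁ ≃ Fin c ⊕ Fin c'}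
    {E₁ : Fin K₁ → Fin np ⊕ Fin nq} {E₂ : Fin K₂ → Fin K₁ ⊕ Fin nr}
    {F₁ : Fin L₁ → Fin np ⊕ Fin nr} {F₂ : Fin K₂ → Fin L₁ ⊕ Fin nq}
    {e₁ : Fin a → Fin p ⊕ Fin q} {e₁' : Fin a' → Fin p' ⊕ Fin q'}
    {e₂ : Fin b → Fin a ⊕ Fin r} {e₂' : Fin b' → Fin a' ⊕ Fin r'}
    {f₁ : Fin c → Fin p ⊕ Fin r} {f₁' : Fin c' → Fin p' ⊕ Fin r'}
    (h₁ : Splits sp sq S₁ E₁ e₁ e₁') (h₂ : Splits S₁ sr S₂ E₂ e₂ e₂')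
    (h₃ : Splits sp sr T₁ F₁ f₁ f₁')
    (hw : ∀ w, Sum.map id Sum.swap (Equiv.sumAssoc _ _ _ (Sum.map E₁ id (E₂ w))) =
      Equiv.sumAssoc _ _ _ (Sum.map F₁ id (F₂ w))) :
    ∃ f₂ f₂', Splits T₁ sq S₂ F₂ f₂ f₂' ∧
      (∀ w, Sum.map id Sum.swap (Equiv.sumAssoc _ _ _ (Sum.map e₁ id (e₂ w))) =
        Equiv.sumAssoc _ _ _ (Sum.map f₁ id (f₂ w))) ∧
      ∀ w, Sum.map id Sum.swap (Equiv.sumAssoc _ _ _ (Sum.map e₁' id (e₂' w))) =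
        Equiv.sumAssoc _ _ _ (Sum.map f₁' id (f₂' w)) := by
  obtain ⟨f₂, f₂', h₄⟩ := exists_of_isLeft T₁ sq S₂ F₂ fun w => by
    rw [h₂.isRight, funext h₁.isRight, funext h₃.isRight]
    exact DTree.elim_comm_inp (hw w)
  refine ⟨f₂, f₂', h₄, fun w => ?_, fun w => ?_⟩
  · have h := hw (S₂.symm (Sum.inl w))
    rw [h₂.inl, h₄.inl, sumAssoc_map_left _ h₁.inl, sumAssoc_map_left _ h₃.inl,
      sum_map_swap_right] at h
    exact (Sum.map_injective.2 ⟨sp.symm.injective.comp Sum.inl_injective, Sum.map_injective.2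
      ⟨sr.symm.injective.comp Sum.inl_injective, sq.symm.injective.comp Sum.inl_injective⟩⟩) h
  · have h := hw (S₂.symm (Sum.inr w))
    rw [h₂.inr, h₄.inr, sumAssoc_map_left _ h₁.inr, sumAssoc_map_left _ h₃.inr,
      sum_map_swap_right] at h
    exact (Sum.map_injective.2 ⟨sp.symm.injective.comp Sum.inr_injective, Sum.map_injective.2
      ⟨sr.symm.injective.comp Sum.inr_injective, sq.symm.injective.comp Sum.inr_injective⟩⟩) h

theorem left_comm {np nq nr p p' q q' r r' K₁ K₂ L₁ a a' b b' c c' : ℕ}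
    {sp : Fin np ≃ Fin p ⊕ Fin p'} {sq : Fin nq ≃ Fin q ⊕ Fin q'} {sr : Fin nr ≃ Fin r ⊕ Fin r'}
    {S₁ : Fin K₁ ≃ Fin a ⊕ Fin a'} {S₂ : Fin K₂ ≃ Fin b ⊕ Fin b'} {T₁ : Fin L₁ ≃ Fin c ⊕ Fin c'}
    {E₁ : Fin K₁ → Fin np ⊕ Fin nr} {E₂ : Fin K₂ → Fin nq ⊕ Fin K₁}
    {F₁ : Fin L₁ → Fin nq ⊕ Fin nr} {F₂ : Fin K₂ → Fin np ⊕ Fin L₁}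
    {e₁ : Fin a → Fin p ⊕ Fin r} {e₁' : Fin a' → Fin p' ⊕ Fin r'}
    {e₂ : Fin b → Fin q ⊕ Fin a} {e₂' : Fin b' → Fin q' ⊕ Fin a'}
    {f₁ : Fin c → Fin q ⊕ Fin r} {f₁' : Fin c' → Fin q' ⊕ Fin r'}
    (h₁ : Splits sp sr S₁ E₁ e₁ e₁') (h₂ : Splits sq S₁ S₂ E₂ e₂ e₂')
    (h₃ : Splits sq sr T₁ F₁ f₁ f₁')
    (hw : ∀ w, (Equiv.sumAssoc _ _ _).symm (Sum.map id E₁ (E₂ w)) =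
      Sum.map Sum.swap id ((Equiv.sumAssoc _ _ _).symm (Sum.map id F₁ (F₂ w)))) :
    ∃ f₂ f₂', Splits sp T₁ S₂ F₂ f₂ f₂' ∧
      (∀ w, (Equiv.sumAssoc _ _ _).symm (Sum.map id e₁ (e₂ w)) =
        Sum.map Sum.swap id ((Equiv.sumAssoc _ _ _).symm (Sum.map id f₁ (f₂ w)))) ∧
      ∀ w, (Equiv.sumAssoc _ _ _).symm (Sum.map id e₁' (e₂' w)) =
        Sum.map Sum.swap id ((Equiv.sumAssoc _ _ _).symm (Sum.map id f₁' (f₂' w))) := by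
  obtain ⟨f₂, f₂', h₄⟩ := exists_of_isLeft sp T₁ S₂ F₂ fun w => by
    rw [h₂.isRight, funext h₁.isRight, funext h₃.isRight]
    exact DTree.elim_comm_out (hw w)
  refine ⟨f₂, f₂', h₄, fun w => ?_, fun w => ?_⟩
  · have h := hw (S₂.symm (Sum.inl w))
    rw [h₂.inl, h₄.inl, sumAssoc_symm_map_right _ h₁.inl, sumAssoc_symm_map_right _ h₃.inl,
      sum_map_swap_left] at h
    exact (Sum.map_injective.2 ⟨Sum.map_injective.2 ⟨sq.symm.injective.comp Sum.inl_injective,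
      sp.symm.injective.comp Sum.inl_injective⟩, sr.symm.injective.comp Sum.inl_injective⟩) h
  · have h := hw (S₂.symm (Sum.inr w))
    rw [h₂.inr, h₄.inr, sumAssoc_symm_map_right _ h₁.inr, sumAssoc_symm_map_right _ h₃.inr,
      sum_map_swap_left] at h
    exact (Sum.map_injective.2 ⟨Sum.map_injective.2 ⟨sq.symm.injective.comp Sum.inr_injective,
      sp.symm.injective.comp Sum.inr_injective⟩, sr.symm.injective.comp Sum.inr_injective⟩) h

end Splits

namespace Dioperad

variable {P : Dioperad.{u}}

theorem comp_congr {n m n' m' k k' : ℕ} {p p₂ : P.Op n m} {i i₂ : Fin n} {q q₂ : P.Op n' m'}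
    {j j₂ : Fin m'} {e e₂ : Fin k → Fin n ⊕ Fin n'} {e' e₂' : Fin k' → Fin m ⊕ Fin m'}
    {he : Enumerates e {Sum.inl i}ᶜ} {he' : Enumerates e' {Sum.inr j}ᶜ}
    {h : P.inp p i = P.out q j} (he₂ : Enumerates e₂ {Sum.inl i₂}ᶜ)
    (he₂' : Enumerates e₂' {Sum.inr j₂}ᶜ) (h₂ : P.inp p₂ i₂ = P.out q₂ j₂) (hp : p = p₂)
    (hi : i = i₂) (hq : q = q₂) (hj : j = j₂) (hee : e = e₂) (hee' : e' = e₂') :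
    P.comp p i q j e e' he he' h = P.comp p₂ i₂ q₂ j₂ e₂ e₂' he₂ he₂' h₂ := by
  subst hp hi hq hj hee hee'
  rfl

variable (P) in
/-- An operation of a dioperad, with a common ordering of the inputs and outputs. -/
structure PreOp (k : ℕ) where
  n : ℕ
  m : ℕ
  op : P.Op n m
  split : Fin k ≃ Fin n ⊕ Fin m

/-- Simultaneous permutation of the inputs and outputs of an operation and of their positions in
the common ordering. -/
inductive PreOp.Rel {k : ℕ} : P.PreOp k → P.PreOp k → Prop
  | mk {n m : ℕ} (p : P.Op n m) (s : Fin k ≃ Fin n ⊕ Fin m) (σ : Equiv.Perm (Fin n))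
    (τ : Equiv.Perm (Fin m)) :
    PreOp.Rel ⟨n, m, P.act σ τ p, s⟩ ⟨n, m, p, s.trans (Equiv.sumCongr σ τ)⟩

theorem PreOp.rel_of_eq {k n m : ℕ} {p p' : P.Op n m} {s s' : Fin k ≃ Fin n ⊕ Fin m}
    (σ : Equiv.Perm (Fin n)) (τ : Equiv.Perm (Fin m)) (hp : p = P.act σ τ p')
    (hs : ∀ a, s' a = Sum.map σ τ (s a)) : PreOp.Rel ⟨n, m, p, s⟩ ⟨n, m, p', s'⟩ := by
  obtain rfl : s' = s.trans (Equiv.sumCongr σ τ) := Equiv.ext hs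
  subst hp
  exact .mk p' s σ τ

variable (P) in
/-- The equivalence relation generated by permutations. -/
instance PreOp.setoid (k : ℕ) : Setoid (P.PreOp k) where
  r := PreOp.Rel
  iseqv := by
    refine ⟨fun x => ?_, ?_, ?_⟩
    · exact rel_of_eq 1 1 (P.act_one _).symm fun a => by simp
    · rintro _ _ ⟨p, s, σ, τ⟩
      refine rel_of_eq σ⁻¹ τ⁻¹ ?_ fun a => ?_
      · rw [P.act_act, mul_inv_cancel, mul_inv_cancel, P.act_one]
      · rw [Equiv.trans_apply, Equiv.sumCongr_apply, Sum.map_map]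
        rcases s a with b | b <;> simp
    · rintro _ _ z ⟨p, s, σ, τ⟩ h
      generalize hy : (⟨_, _, p, s.trans (Equiv.sumCongr σ τ)⟩ : P.PreOp k) = y at h
      obtain ⟨p', s', σ', τ'⟩ := h
      cases hy
      refine rel_of_eq (σ' * σ) (τ' * τ) (P.act_act _ _ _ _ _) fun a => ?_
      simp only [Equiv.trans_apply, Equiv.sumCongr_apply]
      rcases s a with b | b <;> rfl

end Dioperad

namespace Dioperad

variable (P : Dioperad.{u})

/-- Operations of a dioperad with a common ordering of the inputs and outputs, up to reordering
of the inputs and of the outputs. -/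
def CycOp (k : ℕ) : Type u := Quotient (PreOp.setoid P k)

variable {P}

namespace CycOp

/-- The operation `p`, with its inputs and outputs ordered by `s`. -/
def mk {k n m : ℕ} (s : Fin k ≃ Fin n ⊕ Fin m) (p : P.Op n m) : P.CycOp k :=
  Quotient.mk (PreOp.setoid P k) ⟨n, m, p, s⟩

theorem exists_mk {k : ℕ} (x : P.CycOp k) :
    ∃ (n m : ℕ) (s : Fin k ≃ Fin n ⊕ Fin m) (p : P.Op n m), x = mk s p := by
  obtain ⟨⟨n, m, p, s⟩, rfl⟩ := Quotient.exists_rep x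
  exact ⟨n, m, s, p, rfl⟩

theorem rel_of_mk_eq {k n m n' m' : ℕ} {s : Fin k ≃ Fin n ⊕ Fin m} {p : P.Op n m}
    {s' : Fin k ≃ Fin n' ⊕ Fin m'} {p' : P.Op n' m'} (h : mk s p = mk s' p') :
    PreOp.Rel ⟨n, m, p, s⟩ ⟨n', m', p', s'⟩ :=
  Quotient.exact h

theorem mk_eq {k n m : ℕ} {s s' : Fin k ≃ Fin n ⊕ Fin m} {p p' : P.Op n m}
    (σ : Equiv.Perm (Fin n)) (τ : Equiv.Perm (Fin m)) (hp : p = P.act σ τ p')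
    (hs : ∀ a, s' a = Sum.map σ τ (s a)) : mk s p = mk s' p' :=
  Quotient.sound (PreOp.rel_of_eq σ τ hp hs)

/-- The directed color of a port. -/
def bdry {k : ℕ} (x : P.CycOp k) (a : Fin k) : P.Color × Bool :=
  Quotient.lift (s := PreOp.setoid P k) (fun y : P.PreOp k =>
    Sum.elim (fun i => (P.inp y.op i, false)) (fun j => (P.out y.op j, true)) (y.split a)) (by
      rintro _ _ ⟨p, s, σ, τ⟩
      simp only [Equiv.trans_apply, Equiv.sumCongr_apply, P.inp_act, P.out_act]
      rcases s a with b | b <;> rfl) x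

theorem bdry_mk {k n m : ℕ} (s : Fin k ≃ Fin n ⊕ Fin m) (p : P.Op n m) (a : Fin k) :
    bdry (mk s p) a =
      Sum.elim (fun i => (P.inp p i, false)) (fun j => (P.out p j, true)) (s a) := rfl

/-- The permutation action on the common ordering. -/
def act {k : ℕ} (π : Equiv.Perm (Fin k)) (x : P.CycOp k) : P.CycOp k :=
  Quotient.map' (s₁ := PreOp.setoid P k) (s₂ := PreOp.setoid P k)
    (fun y : P.PreOp k => ⟨y.n, y.m, y.op, π.trans y.split⟩) (by
      rintro _ _ ⟨p, s, σ, τ⟩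
      exact PreOp.Rel.mk p (π.trans s) σ τ) x

theorem act_mk {k n m : ℕ} (π : Equiv.Perm (Fin k)) (s : Fin k ≃ Fin n ⊕ Fin m) (p : P.Op n m) :
    act π (mk s p) = mk (π.trans s) p := rfl

theorem act_one {k : ℕ} (x : P.CycOp k) : act 1 x = x := by
  obtain ⟨n, m, s, p, rfl⟩ := x.exists_mk
  rfl

/-- The identity of a directed color. -/
def ident : P.Color × Bool → P.CycOp 2
  | (c, true) => mk (finSumFinEquiv (m := 1) (n := 1)).symm (P.ident c)
  | (c, false) => mk ((Equiv.swap 0 1).trans (finSumFinEquiv (m := 1) (n := 1)).symm) (P.ident c)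

theorem comp_rel {a b k n m : ℕ} {i₀ : Fin a} {j₀ : Fin b} {E : Fin k → Fin a ⊕ Fin b}
    {x x₂ : P.PreOp a} {y y₂ : P.PreOp b} (hx : PreOp.Rel x x₂) (hy : PreOp.Rel y y₂)
    {S : Fin k ≃ Fin n ⊕ Fin m} {n₂ m₂ : ℕ} {S₂ : Fin k ≃ Fin n₂ ⊕ Fin m₂}
    {i : Fin x.n} {j : Fin y.m} {e : Fin n → Fin x.n ⊕ Fin y.n} {e' : Fin m → Fin x.m ⊕ Fin y.m}
    {i₂ : Fin x₂.n} {j₂ : Fin y₂.m} {e₂ : Fin n₂ → Fin x₂.n ⊕ Fin y₂.n}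
    {e₂' : Fin m₂ → Fin x₂.m ⊕ Fin y₂.m}
    (hi : x.split i₀ = Sum.inl i) (hj : y.split j₀ = Sum.inr j)
    (hi₂ : x₂.split i₀ = Sum.inl i₂) (hj₂ : y₂.split j₀ = Sum.inr j₂)
    (h : Splits x.split y.split S E e e') (h₂ : Splits x₂.split y₂.split S₂ E e₂ e₂')
    (he : Enumerates e {Sum.inl i}ᶜ) (he' : Enumerates e' {Sum.inr j}ᶜ)
    (hc : P.inp x.op i = P.out y.op j)
    (he₂ : Enumerates e₂ {Sum.inl i₂}ᶜ) (he₂' : Enumerates e₂' {Sum.inr j₂}ᶜ)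
    (hc₂ : P.inp x₂.op i₂ = P.out y₂.op j₂) :
    mk S (P.comp x.op i y.op j e e' he he' hc) =
      mk S₂ (P.comp x₂.op i₂ y₂.op j₂ e₂ e₂' he₂ he₂' hc₂) := by
  obtain ⟨p, s, σ, τ⟩ := hx
  obtain ⟨q, t, σ', τ'⟩ := hy
  dsimp only at *
  obtain ⟨rfl, rfl, σ'', τ'', hS⟩ := exists_perm_of_isRight_eq S S₂ fun w => by
    rw [h.isRight, h₂.isRight]
    rcases E w with c | c <;> simp
  have hi' : i₂ = σ i := by
    rw [Equiv.trans_apply, hi] at hi₂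
    exact (Sum.inl_injective hi₂).symm
  have hj' : j₂ = τ' j := by
    rw [Equiv.trans_apply, hj] at hj₂
    exact (Sum.inr_injective hj₂).symm
  subst hi' hj'
  have hE : ∀ w, Sum.map (Sum.map σ σ') (Sum.map τ τ') (Sum.map e e' (S w)) =
      Sum.map e₂ e₂' (Sum.map σ'' τ'' (S w)) := fun w => by
    rw [← hS, ← h₂ w, ← h w]
    rcases E w with c | c
    · rcases h' : s c with d | d <;> simp [h']
    · rcases h' : t c with d | d <;> simp [h']
  have h1 : Sum.map σ σ' ∘ e = e₂ ∘ σ'' := funext fun w => by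
    have := hE (S.symm (Sum.inl w))
    rw [S.apply_symm_apply] at this
    exact Sum.inl_injective this
  have h2 : Sum.map τ τ' ∘ e' = e₂' ∘ τ'' := funext fun w => by
    have := hE (S.symm (Sum.inr w))
    rw [S.apply_symm_apply] at this
    exact Sum.inr_injective this
  have hσ : Enumerates (Sum.map σ σ' ∘ e) {Sum.inl (σ i)}ᶜ :=
    he.equiv (Equiv.sumCongr σ σ') (Equiv.refl _) (fun _ => rfl) (by rintro (w | w) <;> simp)
  have hτ : Enumerates (Sum.map τ τ' ∘ e') {Sum.inr (τ' j)}ᶜ :=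
    he'.equiv (Equiv.sumCongr τ τ') (Equiv.refl _) (fun _ => rfl) (by rintro (w | w) <;> simp)
  refine mk_eq σ'' τ'' ?_ hS
  rw [P.comp_act p i q j e e' σ τ σ' τ' he he' hc hσ hτ hc₂,
    P.act_comp _ _ _ _ _ _ _ _ _ σ'' τ'' (h1 ▸ hσ) (h2 ▸ hτ)]
  exact comp_congr _ _ _ rfl rfl rfl rfl h1 h2

/-- `z` is the composite of `x` and `y` along the input `i₀` of `x` and the output `j₀` of `y`. -/
inductive IsCompInp {a b k : ℕ} (i₀ : Fin a) (j₀ : Fin b) (E : Fin k → Fin a ⊕ Fin b) :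
    P.CycOp a → P.CycOp b → P.CycOp k → Prop
  | mk {n m n' m' k' k'' : ℕ} {s : Fin a ≃ Fin n ⊕ Fin m} {s' : Fin b ≃ Fin n' ⊕ Fin m'}
      {S : Fin k ≃ Fin k' ⊕ Fin k''} (p : P.Op n m) (i : Fin n) (q : P.Op n' m') (j : Fin m')
      (e : Fin k' → Fin n ⊕ Fin n') (e' : Fin k'' → Fin m ⊕ Fin m')
      (he : Enumerates e {Sum.inl i}ᶜ) (he' : Enumerates e' {Sum.inr j}ᶜ)
      (h : P.inp p i = P.out q j) (hi : s i₀ = Sum.inl i) (hj : s' j₀ = Sum.inr j)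
      (hs : Splits s s' S E e e') :
      IsCompInp i₀ j₀ E (CycOp.mk s p) (CycOp.mk s' q)
        (CycOp.mk S (P.comp p i q j e e' he he' h))

namespace IsCompInp

variable {a b k : ℕ} {i₀ : Fin a} {j₀ : Fin b} {E : Fin k → Fin a ⊕ Fin b} {x : P.CycOp a}
  {y : P.CycOp b} {z z' : P.CycOp k}

theorem bdry_left (h : IsCompInp i₀ j₀ E x y z) : (bdry x i₀).2 = false := by
  obtain ⟨p, i, q, j, e, e', he, he', hc, hi, hj, hs⟩ := h
  rw [bdry_mk, hi]
  rfl

theorem bdry_right (h : IsCompInp i₀ j₀ E x y z) : (bdry y j₀).2 = true := by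
  obtain ⟨p, i, q, j, e, e', he, he', hc, hi, hj, hs⟩ := h
  rw [bdry_mk, hj]
  rfl

theorem unique (h : IsCompInp i₀ j₀ E x y z) (h' : IsCompInp i₀ j₀ E x y z') : z = z' := by
  obtain ⟨p, i, q, j, e, e', he, he', hc, hi, hj, hs⟩ := h
  generalize hx : CycOp.mk _ p = x at h'
  generalize hy : CycOp.mk _ q = y at h'
  obtain ⟨p₂, i₂, q₂, j₂, e₂, e₂', he₂, he₂', hc₂, hi₂, hj₂, hs₂⟩ := h'
  exact comp_rel (rel_of_mk_eq hx) (rel_of_mk_eq hy) hi hj hi₂ hj₂ hs hs₂ he he' hc he₂ he₂' hc₂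

theorem exists_of_bdry (hE : EnumGlue i₀ j₀ E) {c : P.Color} (hx : bdry x i₀ = (c, false))
    (hy : bdry y j₀ = (c, true)) : ∃ z, IsCompInp i₀ j₀ E x y z := by
  obtain ⟨n, m, s, p, rfl⟩ := x.exists_mk
  obtain ⟨n', m', s', q, rfl⟩ := y.exists_mk
  obtain ⟨k', k'', S, e, e', hs⟩ := exists_splits s s' E
  rw [bdry_mk] at hx hy
  rcases hi : s i₀ with i | i <;> rw [hi] at hx
  · rcases hj : s' j₀ with j | j <;> rw [hj] at hy
    · simp at hy
    · simp only [Sum.elim_inl, Sum.elim_inr, Prod.mk.injEq, and_true] at hx hy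
      have he := (hs.enumGlue_iff hi hj).1 hE
      exact ⟨_, .mk p i q j e e' he.1 he.2 (hx.trans hy.symm) hi hj hs⟩
  · simp at hx

theorem act (π : Equiv.Perm (Fin a)) (ρ : Equiv.Perm (Fin b))
    (h : IsCompInp (π i₀) (ρ j₀) (Sum.map π ρ ∘ E) x y z) :
    IsCompInp i₀ j₀ E (act π x) (act ρ y) z := by
  obtain ⟨p, i, q, j, e, e', he, he', hc, hi, hj, hs⟩ := h
  refine .mk p i q j e e' he he' hc hi hj fun w => ?_
  rw [← hs w, Function.comp_apply, Sum.map_map]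
  rfl

theorem act_comp (π : Equiv.Perm (Fin k)) (h : IsCompInp i₀ j₀ E x y z) :
    IsCompInp i₀ j₀ (E ∘ π) x y (CycOp.act π z) := by
  obtain ⟨p, i, q, j, e, e', he, he', hc, hi, hj, hs⟩ := h
  exact .mk p i q j e e' he he' hc hi hj fun w => hs (π w)

theorem bdry_comp (h : IsCompInp i₀ j₀ E x y z) :
    bdry z = Sum.elim (bdry x) (bdry y) ∘ E := by
  obtain ⟨p, i, q, j, e, e', he, he', hc, hi, hj, hs⟩ := h
  rename_i S
  funext w
  obtain ⟨w | w, rfl⟩ := S.symm.surjective w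
  · simp only [Function.comp_apply, hs.inl, bdry_mk, Equiv.apply_symm_apply, Sum.elim_inl,
      P.inp_comp]
    rcases e w with c | c <;> simp [bdry_mk]
  · simp only [Function.comp_apply, hs.inr, bdry_mk, Equiv.apply_symm_apply, Sum.elim_inr,
      P.out_comp]
    rcases e' w with c | c <;> simp [bdry_mk]

end IsCompInp

/-- `z` is the composite of `x` and `y` along their ports `i₀` and `j₀`. -/
def IsComp {a b k : ℕ} (i₀ : Fin a) (j₀ : Fin b) (E : Fin k → Fin a ⊕ Fin b)
    (x : P.CycOp a) (y : P.CycOp b) (z : P.CycOp k) : Prop :=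
  IsCompInp i₀ j₀ E x y z ∨ IsCompInp j₀ i₀ (Sum.swap ∘ E) y x z

namespace IsComp

variable {a b k : ℕ} {i₀ : Fin a} {j₀ : Fin b} {E : Fin k → Fin a ⊕ Fin b} {x : P.CycOp a}
  {y : P.CycOp b} {z z' : P.CycOp k}

theorem unique (h : IsComp i₀ j₀ E x y z) (h' : IsComp i₀ j₀ E x y z') : z = z' := by
  rcases h with h | h <;> rcases h' with h' | h'
  · exact h.unique h'
  · simpa [h.bdry_left] using h'.bdry_right
  · simpa [h'.bdry_left] using h.bdry_right
  · exact h.unique h'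

theorem swap (h : IsComp i₀ j₀ E x y z) : IsComp j₀ i₀ (Sum.swap ∘ E) y x z := by
  refine h.symm.imp id fun h => ?_
  rw [← Function.comp_assoc, Sum.swap_swap_eq]
  exact h

theorem exists_of_bdry (hE : EnumGlue i₀ j₀ E)
    (h : bdry x i₀ = Prod.map id Bool.not (bdry y j₀)) : ∃ z, IsComp i₀ j₀ E x y z := by
  rcases hy : bdry y j₀ with ⟨c, _ | _⟩ <;> rw [hy] at h
  · obtain ⟨z, hz⟩ := IsCompInp.exists_of_bdry hE.swap hy h
    exact ⟨z, .inr hz⟩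
  · obtain ⟨z, hz⟩ := IsCompInp.exists_of_bdry hE h hy
    exact ⟨z, .inl hz⟩

theorem act (π : Equiv.Perm (Fin a))
    (h : IsComp (π i₀) j₀ (Sum.map π id ∘ E) x y z) : IsComp i₀ j₀ E (act π x) y z := by
  rcases h with h | h
  · refine .inl ?_
    rw [← y.act_one]
    exact IsCompInp.act π 1 h
  · refine .inr ?_
    rw [← y.act_one]
    refine IsCompInp.act 1 π ?_
    have hE : Sum.map (1 : Equiv.Perm (Fin b)) π ∘ Sum.swap ∘ E =
        Sum.swap ∘ Sum.map π id ∘ E := funext fun w => by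
      simp only [Function.comp_apply]
      rcases E w with c | c <;> rfl
    rw [hE]
    exact h

theorem act_comp (π : Equiv.Perm (Fin k)) (h : IsComp i₀ j₀ E x y z) :
    IsComp i₀ j₀ (E ∘ π) x y (CycOp.act π z) :=
  h.imp (·.act_comp π) (·.act_comp π)

theorem bdry_comp (h : IsComp i₀ j₀ E x y z) : bdry z = Sum.elim (bdry x) (bdry y) ∘ E := by
  rcases h with h | h
  · exact h.bdry_comp
  · rw [h.bdry_comp]
    funext w
    simp only [Function.comp_apply]
    rcases E w with c | c <;> rfl

end IsComp

section comp

variable {a b k : ℕ} {x : P.CycOp a} {i₀ : Fin a} {y : P.CycOp b} {j₀ : Fin b}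
  {E : Fin k → Fin a ⊕ Fin b}

variable (x i₀ y j₀ E) in
/-- Composition along two ports of opposite directed colors. -/
noncomputable def comp (hE : EnumGlue i₀ j₀ E)
    (h : bdry x i₀ = Prod.map id Bool.not (bdry y j₀)) : P.CycOp k :=
  (IsComp.exists_of_bdry hE h).choose

theorem isComp (hE : EnumGlue i₀ j₀ E) (h : bdry x i₀ = Prod.map id Bool.not (bdry y j₀)) :
    IsComp i₀ j₀ E x y (comp x i₀ y j₀ E hE h) :=
  (IsComp.exists_of_bdry hE h).choose_spec

theorem IsComp.comp_eq {z : P.CycOp k} (hz : IsComp i₀ j₀ E x y z) (hE : EnumGlue i₀ j₀ E)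
    (h : bdry x i₀ = Prod.map id Bool.not (bdry y j₀)) : comp x i₀ y j₀ E hE h = z :=
  (isComp hE h).unique hz

theorem comp_mk_inp {n m n' m' k' k'' : ℕ} {s : Fin a ≃ Fin n ⊕ Fin m}
    {s' : Fin b ≃ Fin n' ⊕ Fin m'} {S : Fin k ≃ Fin k' ⊕ Fin k''} {p : P.Op n m} {i : Fin n}
    {q : P.Op n' m'} {j : Fin m'} {e : Fin k' → Fin n ⊕ Fin n'} {e' : Fin k'' → Fin m ⊕ Fin m'}
    (he : Enumerates e {Sum.inl i}ᶜ) (he' : Enumerates e' {Sum.inr j}ᶜ)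
    (h : P.inp p i = P.out q j) (hi : s i₀ = Sum.inl i) (hj : s' j₀ = Sum.inr j)
    (hs : Splits s s' S E e e') (hE : EnumGlue i₀ j₀ E)
    (hc : bdry (mk s p) i₀ = Prod.map id Bool.not (bdry (mk s' q) j₀)) :
    comp (mk s p) i₀ (mk s' q) j₀ E hE hc = mk S (P.comp p i q j e e' he he' h) :=
  IsComp.comp_eq (.inl (.mk p i q j e e' he he' h hi hj hs)) hE hc

theorem comp_mk_out {n m n' m' k' k'' : ℕ} {s : Fin a ≃ Fin n ⊕ Fin m}
    {s' : Fin b ≃ Fin n' ⊕ Fin m'} {S : Fin k ≃ Fin k' ⊕ Fin k''} {p : P.Op n m} {i : Fin m}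
    {q : P.Op n' m'} {j : Fin n'} {e : Fin k' → Fin n' ⊕ Fin n} {e' : Fin k'' → Fin m' ⊕ Fin m}
    (he : Enumerates e {Sum.inl j}ᶜ) (he' : Enumerates e' {Sum.inr i}ᶜ)
    (h : P.inp q j = P.out p i) (hi : s i₀ = Sum.inr i) (hj : s' j₀ = Sum.inl j)
    (hs : Splits s' s S (Sum.swap ∘ E) e e') (hE : EnumGlue i₀ j₀ E)
    (hc : bdry (mk s p) i₀ = Prod.map id Bool.not (bdry (mk s' q) j₀)) :
    comp (mk s p) i₀ (mk s' q) j₀ E hE hc = mk S (P.comp q j p i e e' he he' h) :=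
  IsComp.comp_eq (.inr (.mk q j p i e e' he he' h hj hi hs)) hE hc

end comp

end CycOp

end Dioperad

section

variable {α β γ κ ι : Type*} {e : κ → α ⊕ β} {f : ι → β ⊕ γ} {u : κ ⊕ γ} {v : α ⊕ ι}

theorem sumAssoc_reverse (h : Equiv.sumAssoc _ _ _ (Sum.map e id u) = Sum.map id f v) :
    Equiv.sumAssoc _ _ _ (Sum.map (Sum.swap ∘ f) id (Sum.swap v)) =
      Sum.map id (Sum.swap ∘ e) (Sum.swap u) := by
  rcases u with a | a <;> rcases v with b | b
  · rcases h1 : e a with c | c <;> simp [h1] at h ⊢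
    exact h.symm
  · rcases h1 : e a with c | c <;> rcases h2 : f b with c' | c' <;> simp [h1, h2] at h ⊢
    exact h.symm
  · simp at h
  · rcases h2 : f b with c' | c' <;> simp [h2] at h ⊢
    exact h.symm

theorem sumAssoc_symm_swap (h : Equiv.sumAssoc _ _ _ (Sum.map e id u) = Sum.map id f v) :
    (Equiv.sumAssoc _ _ _).symm (Sum.map id e (Sum.swap u)) =
      Sum.map Sum.swap id ((Equiv.sumAssoc _ _ _).symm (Sum.map id (Sum.swap ∘ f) v)) := by
  rcases u with a | a <;> rcases v with b | b
  · rcases h1 : e a with c | c <;> simp [h1] at h ⊢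
    exact h
  · rcases h1 : e a with c | c <;> rcases h2 : f b with c' | c' <;> simp [h1, h2] at h ⊢
    exact h
  · simp at h
  · rcases h2 : f b with c' | c' <;> simp [h2] at h ⊢
    exact h

theorem sumAssoc_swap (h : Equiv.sumAssoc _ _ _ (Sum.map e id u) = Sum.map id f v) :
    Sum.map id Sum.swap (Equiv.sumAssoc _ _ _ (Sum.map (Sum.swap ∘ e) id u)) =
      Equiv.sumAssoc _ _ _ (Sum.map f id (Sum.swap v)) := by
  rcases u with a | a <;> rcases v with b | b
  · rcases h1 : e a with c | c <;> simp [h1] at h ⊢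
    exact h
  · rcases h1 : e a with c | c <;> rcases h2 : f b with c' | c' <;> simp [h1, h2] at h ⊢
    exact h
  · simp at h
  · rcases h2 : f b with c' | c' <;> simp [h2] at h ⊢
    exact h

end

namespace Splits

variable {n₀ n₀' k₀ n m n' m' k k' : ℕ} {s : Fin n₀ ≃ Fin n ⊕ Fin m}
  {s' : Fin n₀' ≃ Fin n' ⊕ Fin m'} {S : Fin k₀ ≃ Fin k ⊕ Fin k'}
  {E : Fin k₀ → Fin n₀ ⊕ Fin n₀'} {e : Fin k → Fin n ⊕ Fin n'} {e' : Fin k' → Fin m ⊕ Fin m'}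

theorem exists_of_inl_inl (h : Splits s s' S E e e') {w : Fin k₀} {a : Fin n₀} {b : Fin n}
    (hw : E w = Sum.inl a) (ha : s a = Sum.inl b) : ∃ c, S w = Sum.inl c ∧ e c = Sum.inl b := by
  have h1 := h w
  rw [hw, Sum.map_inl, ha] at h1
  rcases hc : S w with c | c <;> rw [hc] at h1
  · exact ⟨c, rfl, Sum.inl_injective h1.symm⟩
  · simp at h1

theorem exists_of_inl_inr (h : Splits s s' S E e e') {w : Fin k₀} {a : Fin n₀} {b : Fin m}
    (hw : E w = Sum.inl a) (ha : s a = Sum.inr b) : ∃ c, S w = Sum.inr c ∧ e' c = Sum.inl b := by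
  have h1 := h w
  rw [hw, Sum.map_inl, ha] at h1
  rcases hc : S w with c | c <;> rw [hc] at h1
  · simp at h1
  · exact ⟨c, rfl, Sum.inr_injective h1.symm⟩

theorem exists_of_inr_inl (h : Splits s s' S E e e') {w : Fin k₀} {a : Fin n₀'} {b : Fin n'}
    (hw : E w = Sum.inr a) (ha : s' a = Sum.inl b) : ∃ c, S w = Sum.inl c ∧ e c = Sum.inr b := by
  have h1 := h w
  rw [hw, Sum.map_inr, ha] at h1
  rcases hc : S w with c | c <;> rw [hc] at h1
  · exact ⟨c, rfl, Sum.inl_injective h1.symm⟩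
  · simp at h1

theorem exists_of_inr_inr (h : Splits s s' S E e e') {w : Fin k₀} {a : Fin n₀'} {b : Fin m'}
    (hw : E w = Sum.inr a) (ha : s' a = Sum.inr b) : ∃ c, S w = Sum.inr c ∧ e' c = Sum.inr b := by
  have h1 := h w
  rw [hw, Sum.map_inr, ha] at h1
  rcases hc : S w with c | c <;> rw [hc] at h1
  · simp at h1
  · exact ⟨c, rfl, Sum.inr_injective h1.symm⟩

end Splits

namespace Dioperad

variable {P : Dioperad.{u}}

namespace CycOp

theorem mk_bdry_eq {a b n m n' m' : ℕ} {s : Fin a ≃ Fin n ⊕ Fin m} {s' : Fin b ≃ Fin n' ⊕ Fin m'}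
    {p : P.Op n m} {q : P.Op n' m'} {i₀ : Fin a} {j₀ : Fin b}
    (h : bdry (mk s p) i₀ = Prod.map id Bool.not (bdry (mk s' q) j₀)) :
    (∃ i j, s i₀ = Sum.inl i ∧ s' j₀ = Sum.inr j ∧ P.inp p i = P.out q j) ∨
      ∃ i j, s i₀ = Sum.inr i ∧ s' j₀ = Sum.inl j ∧ P.inp q j = P.out p i := by
  rw [bdry_mk, bdry_mk] at h
  rcases hi : s i₀ with i | i <;> rcases hj : s' j₀ with j | j <;> rw [hi, hj] at h
  · simp at h
  · exact .inl ⟨i, j, rfl, rfl, congrArg Prod.fst h⟩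
  · exact .inr ⟨i, j, rfl, rfl, (congrArg Prod.fst h).symm⟩
  · simp at h

theorem comp_swap {a b k : ℕ} (x : P.CycOp a) (i : Fin a) (y : P.CycOp b) (j : Fin b)
    (E : Fin k → Fin a ⊕ Fin b) (hE : EnumGlue i j E)
    (h : bdry x i = Prod.map id Bool.not (bdry y j)) (hE' : EnumGlue j i (Sum.swap ∘ E))
    (h' : bdry y j = Prod.map id Bool.not (bdry x i)) :
    comp x i y j E hE h = comp y j x i (Sum.swap ∘ E) hE' h' :=
  (((isComp hE h).swap).comp_eq _ _).symm

theorem comp_ident {a : ℕ} (x : P.CycOp a) (i : Fin a) (c : P.Color × Bool)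
    (E : Fin a → Fin a ⊕ Fin 2) (hE : EnumGlue i 0 E)
    (h : bdry x i = Prod.map id Bool.not (bdry (ident c) 0)) (π : Equiv.Perm (Fin a))
    (hw : ∀ w, E w = if π w = i then Sum.inr 1 else Sum.inl (π w)) :
    comp x i (ident c) 0 E hE h = act π x := by
  obtain ⟨n, m, s, p, rfl⟩ := x.exists_mk
  rw [act_mk]
  rcases c with ⟨c, _ | _⟩
  · obtain ⟨i₁, j₁, hi, hj, hc⟩ | ⟨i₁, j₁, hi, hj, hc⟩ := mk_bdry_eq h
    · let e : Fin n → Fin n ⊕ Fin 1 := fun w => if w = i₁ then Sum.inr 0 else Sum.inl w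
      have hs : Splits s ((Equiv.swap 0 1).trans (finSumFinEquiv (m := 1) (n := 1)).symm)
          (π.trans s) E e Sum.inl := fun w => by
        rw [hw, Equiv.trans_apply]
        split_ifs with h1
        · rw [h1, hi]
          simp only [e, Sum.map_inl, if_true]
          rfl
        · rcases h2 : s (π w) with b | b
          · have h3 : b ≠ i₁ := fun h3 => h1 (s.injective (by rw [h2, hi, h3]))
            simp [e, h2, h3]
          · simp [h2]
      have he := (hs.enumGlue_iff hi hj).1 hE
      obtain rfl := Subsingleton.elim j₁ 0
      refine (comp_mk_inp he.1 he.2 hc hi hj hs hE h).trans (congrArg _ ?_)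
      exact (P.comp_ident _ _ _ _ _ _ _ _ 1 1 (fun _ => rfl) fun _ => rfl).trans (P.act_one _)
    · cases (show Sum.inr (0 : Fin 1) = Sum.inl j₁ from hj)
  · obtain ⟨i₁, j₁, hi, hj, hc⟩ | ⟨i₁, j₁, hi, hj, hc⟩ := mk_bdry_eq h
    · cases (show Sum.inl (0 : Fin 1) = Sum.inr j₁ from hj)
    · let e : Fin m → Fin 1 ⊕ Fin m := fun w => if w = i₁ then Sum.inl 0 else Sum.inr w
      have hs : Splits (finSumFinEquiv (m := 1) (n := 1)).symm s
          (π.trans s) (Sum.swap ∘ E) Sum.inr e := fun w => by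
        rw [Function.comp_apply, hw, Equiv.trans_apply]
        split_ifs with h1
        · rw [h1, hi]
          simp only [e, Sum.map_inr, if_true]
          rfl
        · rcases h2 : s (π w) with b | b
          · simp [h2]
          · have h3 : b ≠ i₁ := fun h3 => h1 (s.injective (by rw [h2, hi, h3]))
            simp [e, h2, h3]
      have he := (hs.enumGlue_iff hj hi).1 hE.swap
      obtain rfl := Subsingleton.elim j₁ 0
      refine (comp_mk_out he.1 he.2 hc hi hj hs hE h).trans (congrArg _ ?_)
      exact (P.ident_comp _ _ _ _ _ _ _ _ 1 1 (fun _ => rfl) fun _ => rfl).trans (P.act_one _)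

section

variable {n m s k k' K : ℕ} {p : P.CycOp n} {q : P.CycOp m} {r : P.CycOp s} {i : Fin n}
  {j y : Fin m} {l : Fin s} {e : Fin k → Fin n ⊕ Fin m} {x : Fin k} {e' : Fin K → Fin k ⊕ Fin s}
  {f : Fin k' → Fin m ⊕ Fin s} {z : Fin k'} {f' : Fin K → Fin n ⊕ Fin k'}
  (he : EnumGlue i j e) (he' : EnumGlue x l e') (hf : EnumGlue y l f) (hf' : EnumGlue i z f')
  (h₁ : bdry p i = Prod.map id Bool.not (bdry q j))
  (h₂ : bdry (comp p i q j e he h₁) x = Prod.map id Bool.not (bdry r l))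
  (h₃ : bdry q y = Prod.map id Bool.not (bdry r l))
  (h₄ : bdry p i = Prod.map id Bool.not (bdry (comp q y r l f hf h₃) z))

theorem comp_assoc_of_inp (hi : (bdry p i).2 = false) (hy : (bdry q y).2 = false)
    (hx : e x = Sum.inr y) (hz : f z = Sum.inl j)
    (hw : ∀ w, Equiv.sumAssoc _ _ _ (Sum.map e id (e' w)) = Sum.map id f (f' w)) :
    comp (comp p i q j e he h₁) x r l e' he' h₂ = comp p i (comp q y r l f hf h₃) z f' hf' h₄ := by
  obtain ⟨_, _, sp, p, rfl⟩ := p.exists_mk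
  obtain ⟨_, _, sq, q, rfl⟩ := q.exists_mk
  obtain ⟨_, _, sr, r, rfl⟩ := r.exists_mk
  obtain ⟨i₁, j₁, hi₁, hj₁, hc⟩ | ⟨i₁, j₁, hi₁, hj₁, hc⟩ := mk_bdry_eq h₁
  swap
  · simp [bdry_mk, hi₁] at hi
  obtain ⟨y₁, l₁, hy₁, hl₁, hc'⟩ | ⟨y₁, l₁, hy₁, hl₁, hc'⟩ := mk_bdry_eq h₃
  swap
  · simp [bdry_mk, hy₁] at hy
  obtain ⟨_, _, S₁, e₁, e₁', hS₁⟩ := exists_splits sp sq e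
  obtain ⟨_, _, S₂, e₂, e₂', hS₂⟩ := exists_splits S₁ sr e'
  obtain ⟨_, _, T₁, f₁, f₁', hT₁⟩ := exists_splits sq sr f
  obtain ⟨f₂, f₂', hT₂, hw₁, hw₂⟩ := hS₁.assoc hS₂ hT₁ hw
  obtain ⟨x₁, hx₁, hex⟩ := hS₁.exists_of_inr_inl hx hy₁
  obtain ⟨z₁, hz₁, hfz⟩ := hT₁.exists_of_inl_inr hz hj₁
  have he₁ := (hS₁.enumGlue_iff hi₁ hj₁).1 he
  have he₂ := (hS₂.enumGlue_iff hx₁ hl₁).1 he'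
  have hf₁ := (hT₁.enumGlue_iff hy₁ hl₁).1 hf
  have hf₂ := (hT₂.enumGlue_iff hi₁ hz₁).1 hf'
  have E₁ := comp_mk_inp he₁.1 he₁.2 hc hi₁ hj₁ hS₁ he h₁
  have E₂ := comp_mk_inp hf₁.1 hf₁.2 hc' hy₁ hl₁ hT₁ hf h₃
  have hc₂ : P.inp (P.comp p i₁ q j₁ e₁ e₁' he₁.1 he₁.2 hc) x₁ = P.out r l₁ := by
    rw [P.inp_comp, Function.comp_apply, hex]
    exact hc'
  have hc₃ : P.inp p i₁ = P.out (P.comp q y₁ r l₁ f₁ f₁' hf₁.1 hf₁.2 hc') z₁ := by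
    rw [P.out_comp, Function.comp_apply, hfz]
    exact hc
  simp only [E₁, E₂]
  rw [comp_mk_inp he₂.1 he₂.2 hc₂ hx₁ hl₁ hS₂, comp_mk_inp hf₂.1 hf₂.2 hc₃ hi₁ hz₁ hT₂]
  exact congrArg _ (P.comp_assoc _ _ _ _ _ _ _ _ _ _ _ _ _ _ _ _ _ _ _ _ _ _ _ _ _ _ _ _ _
    hex hfz hw₁ hw₂)

theorem comp_assoc_of_inp_out (hi : (bdry p i).2 = false) (hy : (bdry q y).2 = true)
    (hx : e x = Sum.inr y) (hz : f z = Sum.inl j)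
    (hw : ∀ w, Equiv.sumAssoc _ _ _ (Sum.map e id (e' w)) = Sum.map id f (f' w)) :
    comp (comp p i q j e he h₁) x r l e' he' h₂ = comp p i (comp q y r l f hf h₃) z f' hf' h₄ := by
  obtain ⟨_, _, sp, p, rfl⟩ := p.exists_mk
  obtain ⟨_, _, sq, q, rfl⟩ := q.exists_mk
  obtain ⟨_, _, sr, r, rfl⟩ := r.exists_mk
  obtain ⟨i₁, j₁, hi₁, hj₁, hc⟩ | ⟨i₁, j₁, hi₁, hj₁, hc⟩ := mk_bdry_eq h₁
  swap
  · simp [bdry_mk, hi₁] at hi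
  obtain ⟨y₁, l₁, hy₁, hl₁, hc'⟩ | ⟨y₁, l₁, hy₁, hl₁, hc'⟩ := mk_bdry_eq h₃
  · simp [bdry_mk, hy₁] at hy
  obtain ⟨_, _, S₁, e₁, e₁', hS₁⟩ := exists_splits sp sq e
  obtain ⟨_, _, S₂, e₂, e₂', hS₂⟩ := exists_splits sr S₁ (Sum.swap ∘ e')
  obtain ⟨_, _, T₁, f₁, f₁', hT₁⟩ := exists_splits sr sq (Sum.swap ∘ f)
  obtain ⟨f₂, f₂', hT₂, hw₁, hw₂⟩ := hS₁.left_comm hS₂ hT₁ fun w => sumAssoc_symm_swap (hw w)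
  obtain ⟨x₁, hx₁, hex⟩ := hS₁.exists_of_inr_inr hx hy₁
  obtain ⟨z₁, hz₁, hfz⟩ := hT₁.exists_of_inr_inr (congrArg Sum.swap hz) hj₁
  have he₁ := (hS₁.enumGlue_iff hi₁ hj₁).1 he
  have he₂ := (hS₂.enumGlue_iff hl₁ hx₁).1 he'.swap
  have hf₁ := (hT₁.enumGlue_iff hl₁ hy₁).1 hf.swap
  have hf₂ := (hT₂.enumGlue_iff hi₁ hz₁).1 hf'
  have E₁ := comp_mk_inp he₁.1 he₁.2 hc hi₁ hj₁ hS₁ he h₁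
  have E₂ := comp_mk_out hf₁.1 hf₁.2 hc' hy₁ hl₁ hT₁ hf h₃
  have hc₂ : P.inp r l₁ = P.out (P.comp p i₁ q j₁ e₁ e₁' he₁.1 he₁.2 hc) x₁ := by
    rw [P.out_comp, Function.comp_apply, hex]
    exact hc'
  have hc₃ : P.inp p i₁ = P.out (P.comp r l₁ q y₁ f₁ f₁' hf₁.1 hf₁.2 hc') z₁ := by
    rw [P.out_comp, Function.comp_apply, hfz]
    exact hc
  simp only [E₁, E₂]
  rw [comp_mk_out he₂.1 he₂.2 hc₂ hx₁ hl₁ hS₂, comp_mk_inp hf₂.1 hf₂.2 hc₃ hi₁ hz₁ hT₂]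
  exact congrArg _ (P.comp_comm_out _ _ _ _ _ _ _ _ _ _ _ _ _ _ _ _ _ _ _ _ _ _ _ _ _ _ _ _ _
    hex hfz hw₁ hw₂)

theorem comp_assoc_of_out_inp (hi : (bdry p i).2 = true) (hy : (bdry q y).2 = false)
    (hx : e x = Sum.inr y) (hz : f z = Sum.inl j)
    (hw : ∀ w, Equiv.sumAssoc _ _ _ (Sum.map e id (e' w)) = Sum.map id f (f' w)) :
    comp (comp p i q j e he h₁) x r l e' he' h₂ = comp p i (comp q y r l f hf h₃) z f' hf' h₄ := by
  obtain ⟨_, _, sp, p, rfl⟩ := p.exists_mk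
  obtain ⟨_, _, sq, q, rfl⟩ := q.exists_mk
  obtain ⟨_, _, sr, r, rfl⟩ := r.exists_mk
  obtain ⟨i₁, j₁, hi₁, hj₁, hc⟩ | ⟨i₁, j₁, hi₁, hj₁, hc⟩ := mk_bdry_eq h₁
  · simp [bdry_mk, hi₁] at hi
  obtain ⟨y₁, l₁, hy₁, hl₁, hc'⟩ | ⟨y₁, l₁, hy₁, hl₁, hc'⟩ := mk_bdry_eq h₃
  swap
  · simp [bdry_mk, hy₁] at hy
  obtain ⟨_, _, S₁, e₁, e₁', hS₁⟩ := exists_splits sq sp (Sum.swap ∘ e)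
  obtain ⟨_, _, S₂, e₂, e₂', hS₂⟩ := exists_splits S₁ sr e'
  obtain ⟨_, _, T₁, f₁, f₁', hT₁⟩ := exists_splits sq sr f
  obtain ⟨f₂, f₂', hT₂, hw₁, hw₂⟩ := hS₁.right_comm hS₂ hT₁ fun w => sumAssoc_swap (hw w)
  obtain ⟨x₁, hx₁, hex⟩ := hS₁.exists_of_inl_inl (congrArg Sum.swap hx) hy₁
  obtain ⟨z₁, hz₁, hfz⟩ := hT₁.exists_of_inl_inl hz hj₁
  have he₁ := (hS₁.enumGlue_iff hj₁ hi₁).1 he.swap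
  have he₂ := (hS₂.enumGlue_iff hx₁ hl₁).1 he'
  have hf₁ := (hT₁.enumGlue_iff hy₁ hl₁).1 hf
  have hf₂ := (hT₂.enumGlue_iff hz₁ hi₁).1 hf'.swap
  have E₁ := comp_mk_out he₁.1 he₁.2 hc hi₁ hj₁ hS₁ he h₁
  have E₂ := comp_mk_inp hf₁.1 hf₁.2 hc' hy₁ hl₁ hT₁ hf h₃
  have hc₂ : P.inp (P.comp q j₁ p i₁ e₁ e₁' he₁.1 he₁.2 hc) x₁ = P.out r l₁ := by
    rw [P.inp_comp, Function.comp_apply, hex]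
    exact hc'
  have hc₃ : P.inp (P.comp q y₁ r l₁ f₁ f₁' hf₁.1 hf₁.2 hc') z₁ = P.out p i₁ := by
    rw [P.inp_comp, Function.comp_apply, hfz]
    exact hc
  simp only [E₁, E₂]
  rw [comp_mk_inp he₂.1 he₂.2 hc₂ hx₁ hl₁ hS₂, comp_mk_out hf₂.1 hf₂.2 hc₃ hi₁ hz₁ hT₂]
  exact congrArg _ (P.comp_comm_inp _ _ _ _ _ _ _ _ _ _ _ _ _ _ _ _ _ _ _ _ _ _ _ _ _ _ _ _ _
    hex hfz hw₁ hw₂)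

theorem bdry_comp {a b k : ℕ} {x : P.CycOp a} {i : Fin a} {y : P.CycOp b} {j : Fin b}
    {E : Fin k → Fin a ⊕ Fin b} (hE : EnumGlue i j E)
    (h : bdry x i = Prod.map id Bool.not (bdry y j)) :
    bdry (comp x i y j E hE h) = Sum.elim (bdry x) (bdry y) ∘ E :=
  (isComp hE h).bdry_comp

theorem comp_congr {n m k : ℕ} {p p' : P.CycOp n} {i : Fin n} {q q' : P.CycOp m} {j : Fin m}
    {e : Fin k → Fin n ⊕ Fin m} {he : EnumGlue i j e}
    {h : bdry p i = Prod.map id Bool.not (bdry q j)}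
    (h' : bdry p' i = Prod.map id Bool.not (bdry q' j)) (hp : p = p') (hq : q = q') :
    comp p i q j e he h = comp p' i q' j e he h' := by
  subst hp hq
  rfl

theorem flip_bdry {c d : P.Color × Bool} (h : c = Prod.map id Bool.not d) :
    d = Prod.map id Bool.not c := by
  subst h
  obtain ⟨d, _ | _⟩ := d <;> rfl

theorem comp_assoc (hx : e x = Sum.inr y) (hz : f z = Sum.inl j)
    (hw : ∀ w, Equiv.sumAssoc _ _ _ (Sum.map e id (e' w)) = Sum.map id f (f' w)) :
    comp (comp p i q j e he h₁) x r l e' he' h₂ = comp p i (comp q y r l f hf h₃) z f' hf' h₄ := by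
  cases hi : (bdry p i).2 <;> cases hy : (bdry q y).2
  · exact comp_assoc_of_inp he he' hf hf' h₁ h₂ h₃ h₄ hi hy hx hz hw
  · exact comp_assoc_of_inp_out he he' hf hf' h₁ h₂ h₃ h₄ hi hy hx hz hw
  · exact comp_assoc_of_out_inp he he' hf hf' h₁ h₂ h₃ h₄ hi hy hx hz hw
  · have E₁ := comp_swap p i q j e he h₁ he.swap (flip_bdry h₁)
    have E₂ := comp_swap q y r l f hf h₃ hf.swap (flip_bdry h₃)
    have h₂' := h₂
    have h₄' := h₄
    rw [E₁] at h₂'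
    rw [E₂] at h₄'
    rw [comp_congr h₂' E₁ rfl, comp_congr h₄' rfl E₂,
      comp_swap _ _ _ _ _ he' h₂' he'.swap (flip_bdry h₂'),
      comp_swap _ _ _ _ _ hf' h₄' hf'.swap (flip_bdry h₄')]
    refine (comp_assoc_of_inp _ _ _ _ _ _ _ _ ?_ ?_ ?_ ?_ fun w => ?_).symm
    · rw [flip_bdry h₃, Prod.map_snd, hy]
      rfl
    · rw [flip_bdry h₁, Prod.map_snd, hi]
      rfl
    · exact congrArg Sum.swap hz
    · exact congrArg Sum.swap hx
    · exact sumAssoc_reverse (hw w)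

end

end CycOp

variable (P) in
/-- The augmented cyclic operad with the colors of `P` in both directions, whose operations are
those of `P`. -/
noncomputable def toCyclic : AugCyclicOperad.{u} where
  Color := P.Color × Bool
  inv := Prod.map id Bool.not
  inv_inv c := (CycOp.flip_bdry rfl).symm
  Op := P.CycOp
  bdry := CycOp.bdry
  act := CycOp.act
  ident := CycOp.ident
  comp := CycOp.comp
  bdry_act σ p := by
    obtain ⟨n, m, s, p, rfl⟩ := p.exists_mk
    rfl
  bdry_ident := by
    rintro ⟨c, _ | _⟩ <;> funext i <;> fin_cases i
    · exact congrArg (·, true) (congrFun (P.out_ident c) 0)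
    · exact congrArg (·, false) (congrFun (P.inp_ident c) 0)
    · exact congrArg (·, false) (congrFun (P.inp_ident c) 0)
    · exact congrArg (·, true) (congrFun (P.out_ident c) 0)
  bdry_comp _ _ _ _ _ he h := CycOp.bdry_comp he h
  act_one := CycOp.act_one
  act_act σ τ p := by
    obtain ⟨n, m, s, p, rfl⟩ := p.exists_mk
    rfl
  act_ident := by
    rintro ⟨c, _ | _⟩
    · refine (CycOp.act_mk _ _ _).trans (congrArg (CycOp.mk · _) (Equiv.ext fun w => ?_))
      simp
    · rfl
  act_comp _ _ _ _ _ he h σ he' :=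
    (((CycOp.isComp he h).act_comp σ).comp_eq he' h).symm
  comp_act _ _ _ _ _ σ he h he' h' :=
    ((CycOp.isComp he' h').act σ).comp_eq he h
  comp_comm := CycOp.comp_swap
  comp_ident := CycOp.comp_ident
  comp_assoc _ _ _ _ _ _ _ _ _ _ _ _ _ he he' hf hf' h₁ h₂ h₃ h₄ hx hz hw :=
    CycOp.comp_assoc he he' hf hf' h₁ h₂ h₃ h₄ hx hz hw

end Dioperad

namespace Dioperad

/-- A map of dioperads that is bijective on colors and operations is invertible. -/
theorem isIso_of_bijective {P Q : Dioperad.{u}} (f : P ⟶ Q)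
    (hc : Function.Bijective (Hom.onColor f))
    (ho : ∀ n m, Function.Bijective (Hom.onOp f (n := n) (m := m))) : IsIso f := by
  let c := Equiv.ofBijective _ hc
  let o n m := Equiv.ofBijective _ (ho n m)
  have hco : ∀ x, Hom.onColor f (c.symm x) = x := c.apply_symm_apply
  have hoo : ∀ {n m} (p : Q.Op n m), Hom.onOp f ((o n m).symm p) = p := fun p =>
    (o _ _).apply_symm_apply p
  have hinp : ∀ {n m} (p : Q.Op n m), P.inp ((o n m).symm p) = c.symm ∘ Q.inp p := fun p => by
    refine hc.1.comp_left ?_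
    change Hom.onColor f ∘ _ = _
    rw [← Hom.map_inp f, hoo]
    exact funext fun w => (hco _).symm
  have hout : ∀ {n m} (p : Q.Op n m), P.out ((o n m).symm p) = c.symm ∘ Q.out p := fun p => by
    refine hc.1.comp_left ?_
    change Hom.onColor f ∘ _ = _
    rw [← Hom.map_out f, hoo]
    exact funext fun w => (hco _).symm
  let g : Q ⟶ P :=
    { onColor := c.symm
      onOp := fun {n m} => (o n m).symm
      map_inp := hinp
      map_out := hout
      map_act := fun σ τ p => (ho _ _).1 (by rw [hoo, Hom.map_act f, hoo])
      map_ident := fun x => (ho _ _).1 (by rw [hoo, Hom.map_ident f, hco])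
      map_comp := fun p i q j e e' he he' h h' => (ho _ _).1 (by
        rw [hoo, Hom.map_comp f _ _ _ _ _ _ _ _ _ (by rw [hoo, hoo]; exact h)]
        exact comp_congr _ _ _ (hoo p).symm rfl (hoo q).symm rfl rfl rfl) }
  refine ⟨g, Hom.ext ?_ ?_, Hom.ext ?_ ?_⟩
  · exact funext c.symm_apply_apply
  · funext n m p
    exact (o n m).symm_apply_apply p
  · exact funext c.apply_symm_apply
  · funext n m p
    exact (o n m).apply_symm_apply p

variable (P : Dioperad.{u})

/-- The direction of the colors of `P.toCyclic`. -/
noncomputable def toCyclicDirection : P.toCyclic ⟶ AugCyclicOperad.direction.{u} :=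
  AugCyclicOperad.toDirection P.toCyclic Prod.snd fun _ => rfl

variable {P}

theorem sorted_mk {n m : ℕ} (p : P.Op n m) :
    AugCyclicOperad.Sorted P.toCyclicDirection n m (CycOp.mk finSumFinEquiv.symm p) := fun x => by
  change (CycOp.bdry _ _).2 = _
  rw [CycOp.bdry_mk, Equiv.symm_apply_apply]
  rcases x with x | x <;> rfl

/-- An operation of `P` as an operation of `P.toCyclic`. -/
def sortedMk {n m : ℕ} (p : P.Op n m) : AugCyclicOperad.SortedOp P.toCyclicDirection n m :=
  ⟨CycOp.mk finSumFinEquiv.symm p, sorted_mk p⟩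

theorem inp_sortedMk {n m : ℕ} (p : P.Op n m) (i : Fin n) :
    ((sortedMk p).inp i).1 = (P.inp p i, true) := by
  change Prod.map id Bool.not (CycOp.bdry (CycOp.mk finSumFinEquiv.symm p)
    (finSumFinEquiv (Sum.inl i))) = _
  rw [CycOp.bdry_mk, Equiv.symm_apply_apply]
  rfl

theorem out_sortedMk {n m : ℕ} (p : P.Op n m) (i : Fin m) :
    ((sortedMk p).out i).1 = (P.out p i, true) := by
  change CycOp.bdry (CycOp.mk finSumFinEquiv.symm p) (finSumFinEquiv (Sum.inr i)) = _
  rw [CycOp.bdry_mk, Equiv.symm_apply_apply]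
  rfl

theorem CycOp.mk_injective {k n m : ℕ} (s : Fin k ≃ Fin n ⊕ Fin m) :
    Function.Injective (CycOp.mk (P := P) s) := by
  intro p q h
  have h1 := CycOp.rel_of_mk_eq h
  generalize hx : (⟨n, m, p, s⟩ : P.PreOp k) = x at h1
  generalize hy : (⟨n, m, q, s⟩ : P.PreOp k) = y at h1
  obtain ⟨q', s', σ, τ⟩ := h1
  cases hx
  simp only [PreOp.mk.injEq, heq_eq_eq, true_and] at hy
  obtain ⟨rfl, hs⟩ := hy
  have key : ∀ x, Sum.map σ τ x = x := fun x => by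
    obtain ⟨a, rfl⟩ := s.surjective x
    exact (congrArg (· a) hs).symm
  rw [show σ = 1 from Equiv.ext fun a => Sum.inl_injective (key (Sum.inl a)),
    show τ = 1 from Equiv.ext fun a => Sum.inr_injective (key (Sum.inr a)), P.act_one]

theorem bijective_sortedMk (n m : ℕ) : Function.Bijective (sortedMk (P := P) (n := n) (m := m)) := by
  constructor
  · exact fun p q h => CycOp.mk_injective _ (congrArg Subtype.val h)
  · rintro ⟨x, hx⟩
    obtain ⟨n', m', s, p, rfl⟩ := x.exists_mk
    obtain ⟨rfl, rfl, σ, τ, hs⟩ := exists_perm_of_isRight_eq finSumFinEquiv.symm s fun a => by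
      obtain ⟨a, rfl⟩ := finSumFinEquiv.surjective a
      have h1 : (CycOp.bdry _ _).2 = _ := hx a
      rw [CycOp.bdry_mk] at h1
      rw [Equiv.symm_apply_apply, ← h1]
      rcases s (finSumFinEquiv a) with b | b <;> rfl
    exact ⟨P.act σ τ p, Subtype.ext (CycOp.mk_eq σ τ rfl hs)⟩

variable (P) in
/-- A dioperad is the dioperad of sorted operations of its augmented cyclic operad. -/
noncomputable def toDioperadToCyclic :
    P ⟶ AugCyclicOperad.toDioperadFunctor.obj (Over.mk P.toCyclicDirection) where
  onColor c := ⟨(c, true), rfl⟩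
  onOp := sortedMk
  map_inp p := funext fun i => Subtype.ext (inp_sortedMk p i)
  map_out p := funext fun i => Subtype.ext (out_sortedMk p i)
  map_act {n m} σ τ p := by
    refine Subtype.ext (CycOp.mk_eq σ τ rfl fun a => ?_)
    obtain ⟨a, rfl⟩ := finSumFinEquiv.surjective a
    rw [Equiv.trans_apply, permSum_apply, Equiv.symm_apply_apply, Equiv.symm_apply_apply]
  map_ident c := rfl
  map_comp {n m n' m' k k'} p i q j e e' he he' h h' := by
    refine Subtype.ext ?_
    refine (CycOp.comp_mk_inp he he' h (Equiv.symm_apply_apply _ _) (Equiv.symm_apply_apply _ _)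
      (splits_glue e e') (enumGlue_glue he he') ?_).symm
    exact AugCyclicOperad.SortedOp.inp_eq_out_iff.1 h'

instance : IsIso P.toDioperadToCyclic :=
  isIso_of_bijective _ ⟨fun _ _ h => congrArg (fun c => (Subtype.val c).1) h, fun ⟨⟨c, _⟩, hb⟩ =>
    ⟨c, Subtype.ext (congrArg (Prod.mk c) hb.symm)⟩⟩ bijective_sortedMk

end Dioperad

instance : AugCyclicOperad.toDioperadFunctor.{u}.EssSurj where
  mem_essImage P := ⟨_, ⟨(asIso P.toDioperadToCyclic).symm⟩⟩

instance : AugCyclicOperad.toDioperadFunctor.{u}.IsEquivalence where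

namespace DTree

open UGraph DGraph AugCyclicOperad Opposite

/-- The functor sending a directed tree to the directed augmented cyclic operad it generates. -/
def overDirection : DTree.{u} ⥤ Over AugCyclicOperad.direction.{u} where
  obj G := Over.mk G.direction
  map φ := Over.homMk (UTree.freeCycFunctor.map (undir.map φ)) (direction_naturality φ)
  map_id G := by
    apply Over.OverMorphism.ext
    exact (congrArg UTree.freeCycFunctor.map (undir.map_id G)).trans
      (UTree.freeCycFunctor.map_id _)
  map_comp φ ψ := by
    apply Over.OverMorphism.ext
    exact (congrArg UTree.freeCycFunctor.map (undir.map_comp φ ψ)).trans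
      (UTree.freeCycFunctor.map_comp _ _)

variable {G : DTree.{u}} {n m : ℕ}

/-- The ports of an operation of the free dioperad, the inputs first. -/
def FreeOp.label (p : FreeOp G n m) : Fin (n + m) → G.toUGraph.Arc := fun a =>
  Sum.elim (fun i => G.bwd (p.inp i)) (fun i => G.fwd (p.out i)) (finSumFinEquiv.symm a)

theorem FreeOp.label_apply (p : FreeOp G n m) (x : Fin n ⊕ Fin m) : p.label (finSumFinEquiv x) =
    Sum.elim (fun i => G.bwd (p.inp i)) (fun i => G.fwd (p.out i)) x := by
  rw [label, Equiv.symm_apply_apply]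

theorem FreeOp.enum (p : FreeOp G n m) : Enumerates p.label p.sub.boundary := by
  constructor
  · refine Function.Injective.comp (Function.Injective.sumElim ?_ ?_ ?_) finSumFinEquiv.symm.injective
    · exact bwd_injective.comp p.enum_inp.1
    · exact fwd_injective.comp p.enum_out.1
    · exact fun _ _ => (fwd_ne_bwd _ _).symm
  · ext a
    constructor
    · rintro ⟨w, rfl⟩
      obtain ⟨x | x, rfl⟩ := finSumFinEquiv.surjective w
      · rw [label_apply]
        exact p.inp_mem x
      · rw [label_apply]
        exact p.out_mem x
    · intro ha
      rcases a with a | a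
      · have h1 : a ∈ Set.range p.out := p.enum_out.2 ▸ (mem_outputs_iff _ _).2 ha
        obtain ⟨i, rfl⟩ := h1
        exact ⟨finSumFinEquiv (Sum.inr i), p.label_apply _⟩
      · have h1 : a ∈ Set.range p.inp := p.enum_inp.2 ▸ (mem_inputs_iff _ _).2 ha
        obtain ⟨i, rfl⟩ := h1
        exact ⟨finSumFinEquiv (Sum.inl i), p.label_apply _⟩

/-- An operation of the free dioperad as an operation of the free augmented cyclic operad. -/
def FreeOp.sorted (p : FreeOp G n m) : SortedOp G.direction n m :=
  ⟨(⟨p.sub, p.label, p.enum⟩ : UTree.FreeOp (undir.obj G) (n + m)), fun x => by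
    change G.isFwd (p.label _) = _
    rw [p.label_apply]
    rcases x with x | x <;> rfl⟩

/-- Ordered subtrees with the inputs first are operations of the free dioperad. -/
theorem FreeOp.exists_of_label (S : Subtree G.toUGraph) (l : Fin (n + m) → G.toUGraph.Arc)
    (hl : Enumerates l S.boundary) (hd : ∀ x, G.isFwd (l (finSumFinEquiv x)) = x.isRight) :
    ∃ p : FreeOp G n m, p.sub = S ∧ p.label = l := by
  have hi : ∀ i : Fin n, ∃ e, l (finSumFinEquiv (Sum.inl i)) = G.bwd e := fun i =>
    Sum.isRight_iff.1 (Sum.isLeft_eq_false.1 (hd (Sum.inl i)))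
  have ho : ∀ i : Fin m, ∃ e, l (finSumFinEquiv (Sum.inr i)) = G.fwd e := fun i =>
    Sum.isLeft_iff.1 (hd (Sum.inr i))
  choose f hf using hi
  choose g hg using ho
  have hr : ∀ a, a ∈ S.boundary ↔ ∃ x, l (finSumFinEquiv x) = a := fun a => by
    rw [← hl.2, Set.mem_range, finSumFinEquiv.surjective.exists]
  refine ⟨⟨S, f, g, ⟨fun i j h => ?_, ?_⟩, ⟨fun i j h => ?_, ?_⟩⟩, ?_⟩
  · apply Sum.inl_injective (β := Fin m)
    apply finSumFinEquiv.injective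
    apply hl.1
    rw [hf, hf, h]
  · ext e
    rw [mem_inputs_iff, hr]
    constructor
    · rintro ⟨i, rfl⟩
      exact ⟨_, hf i⟩
    · rintro ⟨i | i, h⟩
      · exact ⟨i, bwd_injective ((hf i).symm.trans h)⟩
      · exact absurd ((hg i).symm.trans h) (fwd_ne_bwd _ _)
  · apply Sum.inr_injective (α := Fin n)
    apply finSumFinEquiv.injective
    apply hl.1
    rw [hg, hg, h]
  · ext e
    rw [mem_outputs_iff, hr]
    constructor
    · rintro ⟨i, rfl⟩
      exact ⟨_, hg i⟩
    · rintro ⟨i | i, h⟩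
      · exact absurd ((hf i).symm.trans h).symm (fwd_ne_bwd _ _)
      · exact ⟨i, fwd_injective ((hg i).symm.trans h)⟩
  · refine ⟨rfl, funext fun a => ?_⟩
    obtain ⟨x | x, rfl⟩ := finSumFinEquiv.surjective a
    · exact (FreeOp.label_apply _ _).trans (hf x).symm
    · exact (FreeOp.label_apply _ _).trans (hg x).symm

theorem FreeOp.bijective_sorted : Function.Bijective (FreeOp.sorted (G := G) (n := n) (m := m)) := by
  constructor
  · intro p q h
    have h1 : p.label = q.label := congrArg (fun z => UTree.FreeOp.label z.1) h
    refine FreeOp.ext (congrArg (fun z => UTree.FreeOp.sub z.1) h) (funext fun i => ?_)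
      (funext fun i => ?_)
    · have h2 := congrFun h1 (finSumFinEquiv (Sum.inl i))
      rw [label_apply, label_apply] at h2
      exact bwd_injective h2
    · have h2 := congrFun h1 (finSumFinEquiv (Sum.inr i))
      rw [label_apply, label_apply] at h2
      exact fwd_injective h2
  · rintro ⟨⟨S, l, hl⟩, hd⟩
    obtain ⟨p, rfl, rfl⟩ := FreeOp.exists_of_label S l hl hd
    exact ⟨p, rfl⟩

/-- The free dioperad on a directed tree consists of the sorted operations of the free augmented
cyclic operad. -/
def freeDiToDioperad (G : DTree.{u}) :
    freeDiFunctor.obj G ⟶ toDioperadFunctor.obj (overDirection.obj G) where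
  onColor e := ⟨G.fwd e, rfl⟩
  onOp p := FreeOp.sorted p
  map_inp p := funext fun i => Subtype.ext (congrArg G.toUGraph.inv (FreeOp.label_apply p (Sum.inl i)))
  map_out p := funext fun i => Subtype.ext (FreeOp.label_apply p (Sum.inr i))
  map_act σ τ p := by
    refine Subtype.ext (UTree.FreeOp.ext rfl (funext fun a => ?_))
    obtain ⟨x, rfl⟩ := finSumFinEquiv.surjective a
    refine (FreeOp.label_apply _ x).trans ?_
    change _ = FreeOp.label p (permSum σ τ (finSumFinEquiv x))
    rw [permSum_apply]
    refine Eq.trans ?_ (FreeOp.label_apply p _).symm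
    rcases x with x | x <;> rfl
  map_ident e := by
    refine Subtype.ext (UTree.FreeOp.ext rfl (funext fun a => ?_))
    fin_cases a <;> rfl
  map_comp p i q j e e' he he' h h' := by
    refine Subtype.ext (UTree.FreeOp.ext rfl (funext fun a => ?_))
    obtain ⟨x, rfl⟩ := finSumFinEquiv.surjective a
    refine (FreeOp.label_apply _ x).trans ?_
    change _ = Sum.elim (FreeOp.label p) (FreeOp.label q) (glue e e' (finSumFinEquiv x))
    rcases x with x | x
    · rw [glue_inl]
      change G.bwd (Sum.elim (FreeOp.inp p) (FreeOp.inp q) (e x)) = _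
      rcases e x with b | b <;> exact (FreeOp.label_apply _ (Sum.inl b)).symm
    · rw [glue_inr]
      change G.fwd (Sum.elim (FreeOp.out p) (FreeOp.out q) (e' x)) = _
      rcases e' x with b | b <;> exact (FreeOp.label_apply _ (Sum.inr b)).symm

instance (G : DTree.{u}) : IsIso (freeDiToDioperad G) :=
  Dioperad.isIso_of_bijective _
    ⟨fun _ _ h => fwd_injective (congrArg Subtype.val h), fun ⟨_, hc⟩ =>
      (Sum.isLeft_iff.1 hc).imp fun _ h => Subtype.ext h.symm⟩
    fun _ _ => FreeOp.bijective_sorted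

theorem freeDiToDioperad_naturality {G G' : DTree.{u}} (φ : G ⟶ G') :
    freeDiFunctor.map φ ≫ freeDiToDioperad G' =
      freeDiToDioperad G ≫ toDioperadFunctor.map (overDirection.map φ) := by
  refine Dioperad.Hom.ext rfl ?_
  funext n m p
  refine Subtype.ext (UTree.FreeOp.ext rfl (funext fun a => ?_))
  obtain ⟨x | x, rfl⟩ := finSumFinEquiv.surjective a
  · exact (FreeOp.label_apply _ (Sum.inl x)).trans
      (congrArg (UTree.Hom.onArc (undir.map φ)) (FreeOp.label_apply p (Sum.inl x))).symm
  · exact (FreeOp.label_apply _ (Sum.inr x)).trans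
      (congrArg (UTree.Hom.onArc (undir.map φ)) (FreeOp.label_apply p (Sum.inr x))).symm

end DTree

namespace DTree

open AugCyclicOperad Opposite

section

variable (Y : Over AugCyclicOperad.direction.{u})

/-- An element of the fiber of the nerve is a map to `Y` from the directed augmented cyclic operad
generated by a tree. -/
noncomputable def fiberEquiv (G : DTree.{u}) :
    (fiberFunctor.obj ((Over.post AugCyclicOperad.nerve).obj Y)).obj (op G) ≃
      (overDirection.obj G ⟶ Y) :=
  Equiv.ofBijective (fun x => Over.homMk (fiberVal _ x) (app_fiberVal x)) ⟨fun _ _ h =>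
    fiberVal_injective (congrArg CommaMorphism.left h), fun f => by
      obtain ⟨x, hx⟩ := exists_fiberVal_eq (Y := (Over.post AugCyclicOperad.nerve).obj Y) f.left
        (Over.w f)
      exact ⟨x, Over.OverMorphism.ext hx⟩⟩

/-- An element of the fiber of the nerve is an element of the nerve of the dioperad of sorted
operations. -/
noncomputable def fiberEquivNerve (G : DTree.{u}) :
    (fiberFunctor.obj ((Over.post AugCyclicOperad.nerve).obj Y)).obj (op G) ≃
      (freeDiFunctor.obj G ⟶ toDioperadFunctor.obj Y) :=
  (fiberEquiv Y G).trans ((Functor.FullyFaithful.ofFullyFaithful toDioperadFunctor).homEquiv.trans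
    (asIso (freeDiToDioperad G)).homFromEquiv.symm)

theorem fiberEquivNerve_apply {G : DTree.{u}}
    (x : (fiberFunctor.obj ((Over.post AugCyclicOperad.nerve).obj Y)).obj (op G)) :
    fiberEquivNerve Y G x = freeDiToDioperad G ≫ toDioperadFunctor.map (fiberEquiv Y G x) := rfl

/-- The fiber of the nerve of `Y` is the nerve of the dioperad of sorted operations of `Y`. -/
noncomputable def fiberNerveIsoObj : fiberFunctor.obj ((Over.post AugCyclicOperad.nerve).obj Y) ≅
    Dioperad.nerve.obj (toDioperadFunctor.obj Y) :=
  NatIso.ofComponents (fun G => (fiberEquivNerve Y G.unop).toIso) fun {G G'} φ => by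
    ext x
    have h1 : fiberEquiv Y G'.unop ((fiberFunctor.obj _).map φ x) =
        overDirection.map φ.unop ≫ fiberEquiv Y G.unop x :=
      Over.OverMorphism.ext (fiberVal_map φ.unop x)
    refine (fiberEquivNerve_apply Y _).trans ?_
    have h2 : freeDiToDioperad G'.unop ≫
        toDioperadFunctor.map (overDirection.map φ.unop ≫ fiberEquiv Y G.unop x) =
        freeDiFunctor.map φ.unop ≫ freeDiToDioperad G.unop ≫
          toDioperadFunctor.map (fiberEquiv Y G.unop x) := by
      rw [Functor.map_comp, ← Category.assoc, ← freeDiToDioperad_naturality, Category.assoc]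
    exact (congrArg (fun f => freeDiToDioperad G'.unop ≫ toDioperadFunctor.map f) h1).trans h2

end

/-- The nerves of augmented cyclic operads and of dioperads agree under the equivalences between
dioperads and directed augmented cyclic operads and between presheaves on directed trees and
presheaves on undirected trees with a direction. -/
noncomputable def fiberNerveIso : Over.post AugCyclicOperad.nerve ⋙ fiberFunctor ≅
    toDioperadFunctor.{u} ⋙ Dioperad.nerve :=
  NatIso.ofComponents fiberNerveIsoObj fun {Y Y'} f => by
    ext G x
    refine (fiberEquivNerve_apply Y' _).trans ?_
    refine Eq.trans ?_ ((congrArg (freeDiToDioperad G.unop ≫ ·)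
      (toDioperadFunctor.map_comp (fiberEquiv Y G.unop x) f)).trans (Category.assoc _ _ _).symm)
    rfl

end DTree

/-- The nerve theorem for augmented cyclic operads implies the nerve theorem for dioperads. -/
theorem mainTheorem5 :
    (∃ h : ∀ P : AugCyclicOperad.{u}, UTree.IsSegal (AugCyclicOperad.nerve.obj P),
      (ObjectProperty.lift UTree.IsSegal AugCyclicOperad.nerve.{u} h).IsEquivalence) →
    ∃ h : ∀ P : Dioperad.{u}, DTree.IsSegal (Dioperad.nerve.obj P),
      (ObjectProperty.lift DTree.IsSegal Dioperad.nerve.{u} h).IsEquivalence := by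
  rintro ⟨hN, hE⟩
  have hN' : (AugCyclicOperad.nerve.{u}).Full :=
    inferInstanceAs (UTree.IsSegal.lift AugCyclicOperad.nerve.{u} hN ⋙ UTree.IsSegal.ι).Full
  have hN'' : (AugCyclicOperad.nerve.{u}).Faithful :=
    inferInstanceAs (UTree.IsSegal.lift AugCyclicOperad.nerve.{u} hN ⋙ UTree.IsSegal.ι).Faithful
  have hA := hN AugCyclicOperad.direction
  have h : ∀ P : Dioperad.{u}, DTree.IsSegal (Dioperad.nerve.obj P) := fun P =>
    DTree.IsSegal.prop_of_iso (DTree.fiberNerveIso.app _ ≪≫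
      Dioperad.nerve.mapIso (AugCyclicOperad.toDioperadFunctor.objObjPreimageIso P))
      (DTree.isSegal_fiber hA (hN _))
  refine ⟨h, ?_⟩
  have hc : (AugCyclicOperad.toDioperadFunctor.{u} ⋙ Dioperad.nerve).Full :=
    Functor.Full.of_iso DTree.fiberNerveIso
  have hc' : (AugCyclicOperad.toDioperadFunctor.{u} ⋙ Dioperad.nerve).Faithful :=
    Functor.Faithful.of_iso DTree.fiberNerveIso
  let e : AugCyclicOperad.toDioperadFunctor.{u}.inv ⋙
      AugCyclicOperad.toDioperadFunctor.{u} ⋙ Dioperad.nerve ≅ Dioperad.nerve :=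
    AugCyclicOperad.toDioperadFunctor.{u}.asEquivalence.invFunIdAssoc Dioperad.nerve
  have hD : (Dioperad.nerve.{u}).Full := Functor.Full.of_iso e
  have hD' : (Dioperad.nerve.{u}).Faithful := Functor.Faithful.of_iso e
  have hs : (DTree.IsSegal.lift Dioperad.nerve.{u} h).EssSurj := ⟨fun X => by
    let Y := DTree.fiberFunctor.objPreimage X.obj
    have i : DTree.fiberFunctor.obj Y ≅ X.obj := DTree.fiberFunctor.objObjPreimageIso X.obj
    have hY : UTree.IsSegal Y.left :=
      DTree.isSegal_of_fiber hA (DTree.IsSegal.prop_of_iso i.symm X.property)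
    let L := UTree.IsSegal.lift AugCyclicOperad.nerve.{u} hN
    let Q := L.objPreimage ⟨Y.left, hY⟩
    have j : AugCyclicOperad.nerve.obj Q ≅ Y.left :=
      UTree.IsSegal.ι.mapIso (L.objObjPreimageIso ⟨Y.left, hY⟩)
    obtain ⟨F, hF⟩ := AugCyclicOperad.nerve.map_surjective (j.hom ≫ Y.hom)
    have k : (Over.post AugCyclicOperad.nerve).obj (Over.mk F) ≅ Y := Over.isoMk j hF.symm
    exact ⟨AugCyclicOperad.toDioperadFunctor.obj (Over.mk F), ⟨DTree.IsSegal.isoMk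
      ((DTree.fiberNerveIso.app _).symm ≪≫ DTree.fiberFunctor.mapIso k ≪≫ i)⟩⟩⟩
  exact { }
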